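/- Let $T>0$, let $\alpha$ be a continuous, strictly positive function on $[0,T]$, let $a,b,\lambda\ge 0$, and put $\beta(u)=\alpha(u)(1+\frac b2)$. On a probability space let $\mathbb F^0\subseteq\mathbb F$ be filtrations indexed by $[0,T]$, $S$ a jointly measurable $\mathbb F^0$-adapted process with $\mathbb E[\sup_{0\le t\le T}S_t^2]<\infty$, and $X^1,X^2,\dots$ and $\overline X$ square integrable $\mathbb F$-martingales such that $\mathbb E[X^i_t|\mathcal F^0_t]=\overline X_t$ a.s. for all $i$ and $t$. Put $\check X^i=X^i-\overline X$ and assume that these square integrable $\mathbb F$-martingales are orthogonal, i.e. $\mathbb E[\check X^i_T\check X^j_T]=0$ for $i\ne j$, and that $\mathbb E[(\check X^i_T)^2]$ does not depend on $i$. For $N\ge1$ put $\overline X^N=\frac1N\sum_{i=1}^NX^i$, $\widetilde S_t=\mathbb E[S_T|\mathcal F_t]$, $$\eta^N_{s,t}=e^{-\int_s^t\frac{(N-1)a}{N\beta(u)}du},\quad \Delta^N_{s,t}=\int_s^t\frac{\eta^N_{u,t}}{\beta(u)}du,\quad \tilde\eta^N_{s,t}=e^{\int_s^t\frac{a}{N\alpha(u)}du},\quad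 \widetilde\Delta^N_{s,t}=\int_s^t\frac{\tilde\eta^N_{u,t}}{\alpha(u)}du,$$ $$I^N_t=\int_0^t\frac{\eta^N_{s,t}}{\beta(s)}S_s\,ds,\qquad \widetilde I^N_t=\mathbb E[I^N_T|\mathcal F_t],$$ and $$\eta_{s,t}=e^{-\int_s^t\frac{a}{\beta(u)}du},\quad \Delta_{s,t}=\int_s^t\frac{\eta_{u,t}}{\beta(u)}du,\quad \widetilde\Delta_{s,t}=\int_s^t\frac{du}{\alpha(u)},\quad I_t=\int_0^t\frac{\eta_{s,t}}{\beta(s)}S_s\,ds,\quad \widetilde I_t=\mathbb E[I_T|\mathcal F_t].$$ The position of agent $i\le N$ in the $N$-player setting, the average position and the price are $$\phi^{i*}_t=X^i_0+\frac{1+\frac aN\Delta^N_{0,t}}{1+\frac aN\Delta^N_{0,T}}(\widetilde I^N_0-\widetilde S_0\Delta^N_{0,T})-(I^N_t-\Delta^N_{0,t}\widetilde S_0)+\int_0^t\Delta^N_{s,t}\frac{(\frac aN+\lambda)d\widetilde I^N_s+\lambda d\overline X^N_s+d\widetilde S_s}{1+(\frac aN+\lambda)\Delta^N_{s,T}}+\int_0^t\widetilde\Delta^N_{s,t}\frac{\lambda\,d(X^i-\overline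 X^N)_s}{1+(\frac aN+\lambda)\widetilde\Delta^N_{s,T}},$$ $$\overline\phi^{N*}_t=\frac1N\sum_{i=1}^N\phi^{i*}_t,\qquad P^N_t=S_t+a(\overline\phi^{N*}_t-\overline\phi^{N*}_0).$$ In the mean-field setting, the aggregate position, the position of agent $i$ and the price are $$\overline\phi^*_t=\overline X_0+(\widetilde I_0-\widetilde S_0\Delta_{0,T})-(I_t-\Delta_{0,t}\widetilde S_0)+\int_0^t\Delta_{s,t}\frac{\lambda d\widetilde I_s+\lambda d\overline X_s+d\widetilde S_s}{1+\lambda\Delta_{s,T}},$$ $$\phi^{MF,i*}_t=\overline\phi^*_t+\check X^i_0+\int_0^t\widetilde\Delta_{s,t}\frac{\lambda\,d\check X^i_s}{1+\lambda\widetilde\Delta_{s,T}},\qquad P_t=S_t+a(\overline\phi^*_t-\overline\phi^*_0).$$ Then $\overline\phi^{N*}$ and $\overline\phi^*$ have trading rates, i.e. jointly measurable, adapted (up to null sets) processes $\dot{\overline\phi}{}^{N*}$, $\dot{\overline\phi}{}^{*}$, square integrable for $dt\otimes\mathbb P$, with $\overline\phi^{N*}_t=\overline\phi^{N*}_0+\int_0^t\dot{\overline\phi}{}^{N*}_s\,ds$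 and $\overline\phi^{*}_t=\overline\phi^{*}_0+\int_0^t\dot{\overline\phi}{}^{*}_s\,ds$ a.s. for each $t\in[0,T]$ (they are unique up to $dt\otimes\mathbb P$-null sets), and versions of them, that of $\dot{\overline\phi}{}^{*}$ not depending on $N$, can be chosen such that for all $N\ge1$ and $i\le N$ $$\sup_{0\le t\le T}\mathbb E[(\phi^{i*}_t-\phi^{MF,i*}_t)^2]+\sup_{0\le t\le T}\mathbb E[(\overline\phi^{N*}_t-\overline\phi^*_t)^2]+\sup_{0\le t\le T}\mathbb E[(P^N_t-P_t)^2]+\sup_{0\le t\le T}\mathbb E[(\dot{\overline\phi}{}^{N*}_t-\dot{\overline\phi}{}^*_t)^2]$$ $$\le\frac C{N^2}\mathbb E\Big[\sup_{0\le t\le T}S_t^2\Big]+\frac C{N^2}\mathbb E[\overline X_T^2]+\frac CN\mathbb E[(\check X^i_T)^2],$$ where the constant $C$ depends only on $\alpha$ (including its domain $[0,T]$), $b$, $\lambda$ and $a$. Moreover, if in addition $\mathbb E[Z|\mathcal F_t]=\mathbb E[Z|\mathcal F^0_t]$ a.s. for every $t\in[0,T]$ and every integrable $\mathcal F^0_T$-measurable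 $Z$, then $\overline\phi^*_t=\mathbb E[\phi^{MF,i*}_t|\mathcal F^0_t]$ a.s. for all $i$ and $t$. -/

import Mathlib

open MeasureTheory Filter Topology Set
open scoped ENNReal NNReal

universe u

noncomputable section

/-- The deterministic coefficients: the horizon `T`, the liquidity function `α` (continuous and
strictly positive on `[0,T]`), the price impact `a`, the crowd impact `b`, and the imbalance
penalty `lam`. -/
structure Coefficients where
  T : ℝ
  T_pos : 0 < T
  α : ℝ → ℝ
  α_cont : ContinuousOn α (Icc 0 T)
  α_pos : ∀ t ∈ Icc 0 T, 0 < α t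
  a : ℝ
  a_nonneg : 0 ≤ a
  b : ℝ
  b_nonneg : 0 ≤ b
  lam : ℝ
  lam_nonneg : 0 ≤ lam

namespace Coefficients

variable (p : Coefficients)

/-- The effective trading cost `α(u) (1 + b/2)`. -/
def effCost (u : ℝ) : ℝ := p.α u * (1 + p.b / 2)

/-! Kernels of the game with `N` players. -/

def etaN (N : ℕ) (s t : ℝ) : ℝ :=
  Real.exp (-∫ u in s..t, ((N : ℝ) - 1) * p.a / ((N : ℝ) * p.effCost u))

def DeltaN (N : ℕ) (s t : ℝ) : ℝ := ∫ u in s..t, p.etaN N u t / p.effCost u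

def etaTildeN (N : ℕ) (s t : ℝ) : ℝ := Real.exp (∫ u in s..t, p.a / ((N : ℝ) * p.α u))

def DeltaTildeN (N : ℕ) (s t : ℝ) : ℝ := ∫ u in s..t, p.etaTildeN N u t / p.α u

/-! Kernels of the mean-field game. -/

def eta (s t : ℝ) : ℝ := Real.exp (-∫ u in s..t, p.a / p.effCost u)

def Delta (s t : ℝ) : ℝ := ∫ u in s..t, p.eta u t / p.effCost u

def DeltaTilde (s t : ℝ) : ℝ := ∫ u in s..t, 1 / p.α u

end Coefficients

section Stochastic

variable {Ω : Type u} {mΩ : MeasurableSpace Ω}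

/-- The restriction of a filtration to the time interval `[0,T]`. (Processes and filtrations are
indexed by `ℝ` for convenience; only times in `[0,T]` matter.) -/
def filtrationOn (T : ℝ) (F : Filtration ℝ mΩ) : Filtration (Icc (0 : ℝ) T) mΩ where
  seq t := F t
  mono' _ _ h := F.mono h
  le' t := F.le t

/-- `M` is a square integrable `F`-martingale on `[0,T]`. -/
def IsSqMartingale (T : ℝ) (F : Filtration ℝ mΩ) (μ : Measure Ω) (M : ℝ → Ω → ℝ) : Prop :=
  Martingale (fun t : Icc (0 : ℝ) T => M t) (filtrationOn T F) μ ∧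
    ∀ t ∈ Icc 0 T, MemLp (M t) 2 μ

/-- `𝔼[Z²]`, as an extended nonnegative number. -/
def secondMoment (μ : Measure Ω) (Z : Ω → ℝ) : ℝ≥0∞ := ∫⁻ ω, ENNReal.ofReal (Z ω ^ 2) ∂μ

/-- `sup_{0 ≤ t ≤ T} 𝔼[Z_t²]`. -/
def supSecondMoment (T : ℝ) (μ : Measure Ω) (Z : ℝ → Ω → ℝ) : ℝ≥0∞ :=
  ⨆ t ∈ Icc 0 T, secondMoment μ (Z t)

/-- `𝔼[sup_{0 ≤ t ≤ T} Z_t²]`. -/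
def momentOfSup (T : ℝ) (μ : Measure Ω) (Z : ℝ → Ω → ℝ) : ℝ≥0∞ :=
  ∫⁻ ω, ⨆ t ∈ Icc 0 T, ENNReal.ofReal (Z t ω ^ 2) ∂μ

/-- Left-point Riemann sum of `∫_0^t f(s) dM_s` along the partition of `[0,t]` into `n` intervals
of equal length. -/
def riemannSum (f : ℝ → ℝ) (M : ℝ → Ω → ℝ) (t : ℝ) (n : ℕ) (ω : Ω) : ℝ :=
  ∑ k ∈ Finset.range n,
    f ((k : ℝ) * t / n) * (M (((k : ℝ) + 1) * t / n) ω - M ((k : ℝ) * t / n) ω)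

open Classical in
/-- The stochastic integral `∫_0^t f(s) dM_s` of a deterministic integrand: the limit in `L²` of
the Riemann sums. For `f` continuous on `[0,t]` and `M` a square integrable martingale, the limit
exists, whatever the regularity of the paths of `M`; it is unique up to null sets and, if `M` has
right-continuous paths, it is the Itô integral. -/
def stochInt (μ : Measure Ω) (f : ℝ → ℝ) (M : ℝ → Ω → ℝ) (t : ℝ) : Ω → ℝ :=
  if h : ∃ J : Ω → ℝ, MemLp J 2 μ ∧
      Tendsto (fun n => eLpNorm (riemannSum f M t n - J) 2 μ) atTop (𝓝 0)
  then h.choose else 0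

end Stochastic

/-- The random data: the filtration `F` of the agents, the common filtration `F0`, the fundamental
price `S`, the forecasts `X i` of the agents (numbered from `0`) and the common forecast `Xbar`. -/
structure Market (Ω : Type u) [mΩ : MeasurableSpace Ω] where
  F : Filtration ℝ mΩ
  F0 : Filtration ℝ mΩ
  S : ℝ → Ω → ℝ
  X : ℕ → ℝ → Ω → ℝ
  Xbar : ℝ → Ω → ℝ

namespace Market

variable {Ω : Type u} [MeasurableSpace Ω] (m : Market Ω) (p : Coefficients) (μ : Measure Ω)

/-- The individual part `X^i - Xbar` of the forecast of agent `i`. -/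
def Xcheck (i : ℕ) (t : ℝ) (ω : Ω) : ℝ := m.X i t ω - m.Xbar t ω

/-- The standing assumption: all games live on one probability space, and the individual parts of
the forecasts are orthogonal in `L²`, with the same variance. -/
structure Assumption : Prop where
  F0_le : ∀ t ∈ Icc 0 p.T, m.F0 t ≤ m.F t
  S_measurable : Measurable fun q : Icc (0 : ℝ) p.T × Ω => m.S q.1 q.2
  S_adapted : StronglyAdapted (filtrationOn p.T m.F0) fun t : Icc (0 : ℝ) p.T => m.S t
  S_sup : momentOfSup p.T μ m.S < ∞
  X_mart : ∀ i, IsSqMartingale p.T m.F μ (m.X i)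
  Xbar_mart : IsSqMartingale p.T m.F μ m.Xbar
  condExp_X : ∀ i, ∀ t ∈ Icc 0 p.T, μ[m.X i t | m.F0 t] =ᵐ[μ] m.Xbar t
  Xcheck_mart : ∀ i, IsSqMartingale p.T m.F μ (m.Xcheck i)
  Xcheck_orth : ∀ i j, i ≠ j → ∫ ω, m.Xcheck i p.T ω * m.Xcheck j p.T ω ∂μ = 0
  Xcheck_var : ∀ i j, ∫ ω, m.Xcheck i p.T ω ^ 2 ∂μ = ∫ ω, m.Xcheck j p.T ω ^ 2 ∂μ

/-- `S̃_t = 𝔼[S_T | F_t]`. -/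
def Stilde (t : ℝ) : Ω → ℝ := μ[m.S p.T | m.F t]

/-! The game with `N` players. -/

/-- The average forecast of the first `N` agents. -/
def XbarN (N : ℕ) (t : ℝ) (ω : Ω) : ℝ := (1 / (N : ℝ)) * ∑ i ∈ Finset.range N, m.X i t ω

def IN (N : ℕ) (t : ℝ) (ω : Ω) : ℝ :=
  ∫ s in (0 : ℝ)..t, p.etaN N s t / p.effCost s * m.S s ω

def ItildeN (N : ℕ) (t : ℝ) : Ω → ℝ := μ[m.IN p N p.T | m.F t]

/-- The martingale `(a/N + lam) Ĩ^N + lam X̄^N + S̃`. -/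
def commonMartN (N : ℕ) (t : ℝ) (ω : Ω) : ℝ :=
  (p.a / N + p.lam) * m.ItildeN p μ N t ω + p.lam * m.XbarN N t ω + m.Stilde p μ t ω

/-- The equilibrium position `φ^{i*}_t` of agent `i` in the game with `N` players. -/
def positionN (N i : ℕ) (t : ℝ) (ω : Ω) : ℝ :=
  m.X i 0 ω
    + (1 + p.a / N * p.DeltaN N 0 t) / (1 + p.a / N * p.DeltaN N 0 p.T)
        * (m.ItildeN p μ N 0 ω - m.Stilde p μ 0 ω * p.DeltaN N 0 p.T)
    - (m.IN p N t ω - p.DeltaN N 0 t * m.Stilde p μ 0 ω)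
    + stochInt μ (fun s => p.DeltaN N s t / (1 + (p.a / N + p.lam) * p.DeltaN N s p.T))
        (m.commonMartN p μ N) t ω
    + stochInt μ
        (fun s => p.DeltaTildeN N s t * p.lam / (1 + (p.a / N + p.lam) * p.DeltaTildeN N s p.T))
        (fun s ω' => m.X i s ω' - m.XbarN N s ω') t ω

/-- The average position of the `N` players. -/
def aggregateN (N : ℕ) (t : ℝ) (ω : Ω) : ℝ :=
  (1 / (N : ℝ)) * ∑ i ∈ Finset.range N, m.positionN p μ N i t ω

/-- The equilibrium price `P^N_t = S_t + a (φ̄^N_t - φ̄^N_0)`. -/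
def priceN (N : ℕ) (t : ℝ) (ω : Ω) : ℝ :=
  m.S t ω + p.a * (m.aggregateN p μ N t ω - m.aggregateN p μ N 0 ω)

/-! The mean-field game. -/

def I (t : ℝ) (ω : Ω) : ℝ := ∫ s in (0 : ℝ)..t, p.eta s t / p.effCost s * m.S s ω

def Itilde (t : ℝ) : Ω → ℝ := μ[m.I p p.T | m.F t]

/-- The martingale `lam Ĩ + lam X̄ + S̃`. -/
def commonMart (t : ℝ) (ω : Ω) : ℝ :=
  p.lam * m.Itilde p μ t ω + p.lam * m.Xbar t ω + m.Stilde p μ t ω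

/-- The mean-field position `φ^{MF,i*}_t` of agent `i`. -/
def positionMF (i : ℕ) (t : ℝ) (ω : Ω) : ℝ :=
  m.X i 0 ω
    + (m.Itilde p μ 0 ω - m.Stilde p μ 0 ω * p.Delta 0 p.T)
    - (m.I p t ω - p.Delta 0 t * m.Stilde p μ 0 ω)
    + stochInt μ (fun s => p.Delta s t / (1 + p.lam * p.Delta s p.T)) (m.commonMart p μ) t ω
    + stochInt μ (fun s => p.DeltaTilde s t * p.lam / (1 + p.lam * p.DeltaTilde s p.T))
        (m.Xcheck i) t ω

/-- The aggregate mean-field position `φ̄^*_t`: the part of the mean-field position that is common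
to all agents. -/
def aggregateMF (t : ℝ) (ω : Ω) : ℝ :=
  m.Xbar 0 ω
    + (m.Itilde p μ 0 ω - m.Stilde p μ 0 ω * p.Delta 0 p.T)
    - (m.I p t ω - p.Delta 0 t * m.Stilde p μ 0 ω)
    + stochInt μ (fun s => p.Delta s t / (1 + p.lam * p.Delta s p.T)) (m.commonMart p μ) t ω

/-- The mean-field price `P_t = S_t + a (φ̄^*_t - φ̄^*_0)`. -/
def priceMF (t : ℝ) (ω : Ω) : ℝ :=
  m.S t ω + p.a * (m.aggregateMF p μ t ω - m.aggregateMF p μ 0 ω)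

/-- `ψ` is the rate of trading of the position `φ`: it is a jointly measurable process, adapted
(up to null sets) and square integrable, with `φ_t = φ_0 + ∫_0^t ψ_s ds` almost surely for all `t`.
It is determined by `φ` up to `dt ⊗ μ`-null sets. -/
structure IsTradingRate (φ ψ : ℝ → Ω → ℝ) : Prop where
  measurable : Measurable fun q : Icc (0 : ℝ) p.T × Ω => ψ q.1 q.2
  adapted : ∀ t ∈ Icc 0 p.T, AEStronglyMeasurable[m.F t] (ψ t) μ
  sq_integrable : ∫⁻ ω, (∫⁻ t in Icc 0 p.T, ENNReal.ofReal (ψ t ω ^ 2)) ∂μ < ∞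
  eq_integral : ∀ t ∈ Icc 0 p.T, ∀ᵐ ω ∂μ, φ t ω = φ 0 ω + ∫ s in (0 : ℝ)..t, ψ s ω

/-- The common filtration is immersed in the filtration of the agents: the agents do not predict
common quantities better than the common information does. -/
def Immersed : Prop :=
  ∀ t ∈ Icc 0 p.T, ∀ Z : Ω → ℝ, StronglyMeasurable[m.F0 p.T] Z → Integrable Z μ →
    μ[Z | m.F t] =ᵐ[μ] μ[Z | m.F0 t]

end Market

end

/-! Put ε = a/N, W = ∫ du/β, W̃ = ∫ du/α and E_κ(x) = ∫_0^x e^{-κv} dv (`expKer`). Measured in the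
clocks W and W̃, all kernels of both games are exponentials or values E_κ of clock increments: κ = a
- ε and κ = -ε with N players, κ = a and κ = 0 in the mean-field game. The aggregate positions of
both games are therefore values of one formula, `Market.aggregate`, with parameters (κ, ε, θ, Y)
equal to (a - ε, ε, ε + λ, X̄^N) and (a, 0, λ, X̄). The theorem becomes a perturbation estimate for
ε in [0, a].

Two sources of error remain. The deterministic coefficients are Lipschitz in ε uniformly in time
(`Lip`), which costs O(ε) times the L² size of S and X̄_T. The forecast error X̄^N - X̄ is the mean
of N orthogonal martingales of equal variance, so its norm is at most σ/√N, where σ is the L² norm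
of X̌^i_T. Sums, multiplication by coefficients, conditional expectations, time integrals and
stochastic integrals all propagate such estimates (`LipPair`); for stochastic integrals this is the
Itô isometry for Riemann sums. The individual integrals are compared in the same way, X^i - X̄^N
against X̌^i, and they cancel in the average over the agents because the X^i - X̄^N sum to zero.
Squaring gives the rates 1/N² and 1/N.

The trading rate comes from the factorisation E_κ(W_t - W_s) = e^{κW_s} ∫_s^t e^{-κW_u} dW_u. With
L_u = ∫_0^u e^{κW_s}/(1 + θΔ_{s,T}) dM_s, interchanging the integrals turns ∫_0^t Δ_{s,t}/(1 +
θΔ_{s,T}) dM_s into ∫_0^t e^{-κW_u} L_u dW_u, and the rate gets the explicit form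
`Market.aggregateRate`, to which the same perturbation argument applies. As no path regularity is
assumed, a jointly measurable L has to be constructed: the energy 𝔼[M_t²] is monotone and controls
the increments, which yields a jointly measurable version of M
(`IsSqMartingale.exists_measurable_modification`), and integration by parts then defines L pathwise
(`IsSqMartingale.hasStochInt`, `IsSqMartingale.exists_stochInt_process`).

Under immersion, common information after time s says nothing new about what is F_s-measurable
(`Market.Immersed.condExp_common`). Hence X̌^i_s has zero conditional expectation given F⁰_t for s ≤
t, and so have its stochastic integrals up to time t, while the aggregate position is
F⁰_t-measurable. -/

noncomputable section

/-! ### Bounds in L² and conditional expectations. -/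

section L2

variable {Ω : Type u} {mΩ : MeasurableSpace Ω} {μ : Measure Ω}

/-- The random variable `Z` has `L²` norm at most `K`. -/
structure L2Bound (μ : Measure Ω) (Z : Ω → ℝ) (K : ℝ) : Prop where
  nonneg : 0 ≤ K
  aesm : AEStronglyMeasurable Z μ
  le : eLpNorm Z 2 μ ≤ ENNReal.ofReal K

theorem secondMoment_eq_eLpNorm_sq (Z : Ω → ℝ) : secondMoment μ Z = eLpNorm Z 2 μ ^ 2 := by
  rw [eLpNorm_eq_lintegral_rpow_enorm_toReal (by norm_num) (by norm_num), ← ENNReal.rpow_natCast,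
    ← ENNReal.rpow_mul]
  simp only [ENNReal.toReal_ofNat, one_div, Nat.cast_ofNat, ne_eq, OfNat.ofNat_ne_zero,
    not_false_eq_true, inv_mul_cancel₀, ENNReal.rpow_one, secondMoment]
  refine lintegral_congr fun ω => ?_
  rw [← sq_abs, ENNReal.ofReal_pow (abs_nonneg _), ← Real.enorm_eq_ofReal_abs,
    ← ENNReal.rpow_natCast]
  norm_num

theorem MeasureTheory.MemLp.secondMoment_eq {Z : Ω → ℝ} (hZ : MemLp Z 2 μ) :
    secondMoment μ Z = ENNReal.ofReal (∫ ω, Z ω ^ 2 ∂μ) := by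
  rw [secondMoment, ofReal_integral_eq_lintegral_ofReal hZ.integrable_sq
    (ae_of_all _ fun ω => sq_nonneg _)]

namespace L2Bound

variable {Z Y : Ω → ℝ} {K L : ℝ}

theorem memLp (h : L2Bound μ Z K) : MemLp Z 2 μ :=
  ⟨h.aesm, h.le.trans_lt ENNReal.ofReal_lt_top⟩

theorem integrable [IsFiniteMeasure μ] (h : L2Bound μ Z K) : Integrable Z μ :=
  h.memLp.integrable (by norm_num)

theorem mono (h : L2Bound μ Z K) (hKL : K ≤ L) : L2Bound μ Z L :=
  ⟨h.nonneg.trans hKL, h.aesm, h.le.trans (ENNReal.ofReal_le_ofReal hKL)⟩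

theorem congr (h : L2Bound μ Z K) (hZY : Z =ᵐ[μ] Y) : L2Bound μ Y K :=
  ⟨h.nonneg, h.aesm.congr hZY, (eLpNorm_congr_ae hZY).symm.le.trans h.le⟩

theorem zero : L2Bound μ (0 : Ω → ℝ) 0 :=
  ⟨le_rfl, aestronglyMeasurable_zero, by simp⟩

theorem add (h : L2Bound μ Z K) (h' : L2Bound μ Y L) : L2Bound μ (Z + Y) (K + L) :=
  ⟨add_nonneg h.nonneg h'.nonneg, h.aesm.add h'.aesm,
    (eLpNorm_add_le h.aesm h'.aesm (by norm_num)).trans <| by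
      rw [ENNReal.ofReal_add h.nonneg h'.nonneg]; exact add_le_add h.le h'.le⟩

theorem neg (h : L2Bound μ Z K) : L2Bound μ (-Z) K :=
  ⟨h.nonneg, h.aesm.neg, by rw [eLpNorm_neg]; exact h.le⟩

theorem sub (h : L2Bound μ Z K) (h' : L2Bound μ Y L) : L2Bound μ (Z - Y) (K + L) := by
  rw [sub_eq_add_neg]; exact h.add h'.neg

theorem smul (h : L2Bound μ Z K) (c : ℝ) : L2Bound μ (c • Z) (|c| * K) :=
  ⟨mul_nonneg (abs_nonneg _) h.nonneg, h.aesm.const_smul c, by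
    rw [eLpNorm_const_smul, ENNReal.ofReal_mul (abs_nonneg _), Real.enorm_eq_ofReal_abs]
    gcongr; exact h.le⟩

theorem smul_le (h : L2Bound μ Z K) {c k : ℝ} (hc : |c| ≤ k) : L2Bound μ (c • Z) (k * K) :=
  (h.smul c).mono (mul_le_mul_of_nonneg_right hc h.nonneg)

theorem sum {ι : Type*} (s : Finset ι) {Z : ι → Ω → ℝ} {K : ι → ℝ}
    (h : ∀ i ∈ s, L2Bound μ (Z i) (K i)) : L2Bound μ (∑ i ∈ s, Z i) (∑ i ∈ s, K i) := by
  classical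
  induction s using Finset.induction_on with
  | empty => simpa using zero
  | insert a s ha ih =>
    rw [Finset.sum_insert ha, Finset.sum_insert ha]
    exact (h a (by simp)).add (ih fun i hi => h i (by simp [hi]))

theorem condExp (h : L2Bound μ Z K) (m : MeasurableSpace Ω) : L2Bound μ (μ[Z | m]) K :=
  ⟨h.nonneg, (h.memLp.condExp (by norm_num)).1,
    (eLpNorm_condExp_le_eLpNorm Z (by norm_num)).trans h.le⟩

theorem secondMoment_le (h : L2Bound μ Z K) : secondMoment μ Z ≤ ENNReal.ofReal (K ^ 2) := by
  rw [secondMoment_eq_eLpNorm_sq, ENNReal.ofReal_pow h.nonneg]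
  exact pow_le_pow_left' h.le 2

theorem of_secondMoment_le (hZ : AEStronglyMeasurable Z μ) (hK : 0 ≤ K)
    (h : secondMoment μ Z ≤ ENNReal.ofReal (K ^ 2)) : L2Bound μ Z K := by
  refine ⟨hK, hZ, ?_⟩
  rw [secondMoment_eq_eLpNorm_sq, ENNReal.ofReal_pow hK] at h
  exact (ENNReal.pow_le_pow_left_iff two_ne_zero).1 h

theorem integral_sq_le (h : L2Bound μ Z K) : ∫ ω, Z ω ^ 2 ∂μ ≤ K ^ 2 := by
  have := h.secondMoment_le
  rw [h.memLp.secondMoment_eq] at this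
  exact (ENNReal.ofReal_le_ofReal_iff (sq_nonneg _)).1 this

theorem of_integral_sq_le (hZ : MemLp Z 2 μ) (hK : 0 ≤ K) (h : ∫ ω, Z ω ^ 2 ∂μ ≤ K ^ 2) :
    L2Bound μ Z K :=
  of_secondMoment_le hZ.1 hK (by
    rw [hZ.secondMoment_eq]; exact ENNReal.ofReal_le_ofReal h)

theorem of_tendsto {R : ℕ → Ω → ℝ} (hR : ∀ n, L2Bound μ (R n) K) (hZ : AEStronglyMeasurable Z μ)
    (h : Tendsto (fun n => eLpNorm (R n - Z) 2 μ) atTop (𝓝 0)) : L2Bound μ Z K := by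
  refine ⟨(hR 0).nonneg, hZ, ?_⟩
  have h2 : Tendsto (fun n => ENNReal.ofReal K + eLpNorm (R n - Z) 2 μ) atTop
      (𝓝 (ENNReal.ofReal K)) := by simpa using tendsto_const_nhds.add h
  refine ge_of_tendsto' h2 fun n => ?_
  have : Z = R n - (R n - Z) := by simp
  calc eLpNorm Z 2 μ = eLpNorm (R n - (R n - Z)) 2 μ := by rw [← this]
    _ ≤ eLpNorm (R n) 2 μ + eLpNorm (R n - Z) 2 μ :=
      eLpNorm_sub_le (hR n).aesm ((hR n).aesm.sub hZ) (by norm_num)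
    _ ≤ _ := by gcongr; exact (hR n).le

end L2Bound

theorem aeStronglyMeasurable_of_condExp_ae_eq {G : MeasurableSpace Ω} {Z : Ω → ℝ}
    (h : μ[Z | G] =ᵐ[μ] Z) : AEStronglyMeasurable[G] Z μ :=
  stronglyMeasurable_condExp.aestronglyMeasurable.congr h

/-- The limit in `L²` of random variables that are measurable with respect to a sub-σ-algebra
is measurable with respect to it, up to null sets. -/
theorem aeStronglyMeasurable_of_tendsto_L2 [IsFiniteMeasure μ] {G : MeasurableSpace Ω}
    (hG : G ≤ mΩ) {R : ℕ → Ω → ℝ} {Z : Ω → ℝ} (hR : ∀ n, AEStronglyMeasurable[G] (R n) μ)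
    (hR2 : ∀ n, MemLp (R n) 2 μ) (hZ : MemLp Z 2 μ)
    (h : Tendsto (fun n => eLpNorm (R n - Z) 2 μ) atTop (𝓝 0)) : AEStronglyMeasurable[G] Z μ := by
  refine aeStronglyMeasurable_of_condExp_ae_eq ?_
  -- As `R n` is known to `G`, μ[Z | G] - Z equals (R n - Z) - μ[R n - Z | G], whose norm is at most
  -- twice that of R n - Z.
  have h0 : eLpNorm (μ[Z | G] - Z) 2 μ ≤ 0 := by
    refine ge_of_tendsto' (x := atTop)
      (f := fun n => eLpNorm (R n - Z) 2 μ + eLpNorm (R n - Z) 2 μ) (by simpa using h.add h) fun n => ?_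
    have hi : Integrable (R n) μ := (hR2 n).integrable (by norm_num)
    have e1 : μ[R n - Z | G] =ᵐ[μ] R n - μ[Z | G] :=
      (condExp_sub hi (hZ.integrable (by norm_num)) G).trans
        ((condExp_of_aestronglyMeasurable' hG (hR n) hi).sub EventuallyEq.rfl)
    have e2 : μ[Z | G] - Z =ᵐ[μ] (R n - Z) - μ[R n - Z | G] := by
      filter_upwards [e1] with ω hω
      simp only [Pi.sub_apply] at hω ⊢
      rw [hω]; ring
    rw [eLpNorm_congr_ae e2]
    have h3 := (hR2 n).sub hZ
    exact (eLpNorm_sub_le h3.1 (h3.condExp (by norm_num)).1 (by norm_num)).trans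
      (by gcongr; exact eLpNorm_condExp_le_eLpNorm _ (by norm_num))
  have h1 := (eLpNorm_eq_zero_iff ((hZ.condExp (m := G) (by norm_num)).sub hZ).1 (by norm_num)).1
    (le_antisymm h0 bot_le)
  filter_upwards [h1] with ω hω
  exact sub_eq_zero.1 hω

/-- `U` pulls out of the conditional expectation. This orthogonality underlies the Itô isometry, the
measurability of time integrals and the immersion argument. -/
theorem integral_mul_eq_zero_of_condExp_eq_zero {Ω : Type u} {G mΩ : MeasurableSpace Ω}
    {μ : Measure Ω} [IsFiniteMeasure μ] {U Y : Ω → ℝ} (hG : G ≤ mΩ) (hU : MemLp U 2 μ)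
    (hUG : AEStronglyMeasurable[G] U μ) (hY : MemLp Y 2 μ) (hYG : μ[Y | G] =ᵐ[μ] 0) :
    ∫ ω, U ω * Y ω ∂μ = 0 := by
  have e := condExp_mul_of_aestronglyMeasurable_left (g := Y) hUG
    (hU.integrable_mul hY) (hY.integrable (by norm_num))
  have := integral_condExp hG (μ := μ) (f := U * Y)
  simp only [Pi.mul_apply] at this
  rw [← this]
  refine integral_eq_zero_of_ae ?_
  filter_upwards [e, hYG] with ω h1 h2
  rw [h1]; simp [h2]

end L2

/-! ### Time integrals of jointly measurable processes. -/

section TimeIntegral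

variable {Ω : Type u} {mΩ : MeasurableSpace Ω} {μ : Measure Ω} {Z : ℝ → Ω → ℝ} {a b K : ℝ}

theorem lintegral_timeIntegral_sq_le [SFinite μ] (hZ : Measurable (Function.uncurry Z)) (hab : a ≤ b)
    (h : ∀ u ∈ Icc a b, L2Bound μ (Z u) K) :
    ∫⁻ ω, (∫⁻ u in Icc a b, ENNReal.ofReal (Z u ω ^ 2)) ∂μ ≤ ENNReal.ofReal ((b - a) * K ^ 2) := by
  have hm : Measurable (Function.uncurry fun (ω : Ω) (u : ℝ) => ENNReal.ofReal (Z u ω ^ 2)) :=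
    ((hZ.comp measurable_swap).pow_const 2).ennreal_ofReal
  rw [lintegral_lintegral_swap hm.aemeasurable]
  calc ∫⁻ u in Icc a b, ∫⁻ ω, ENNReal.ofReal (Z u ω ^ 2) ∂μ
      ≤ ∫⁻ _ in Icc a b, ENNReal.ofReal (K ^ 2) :=
        setLIntegral_mono measurable_const fun u hu => (h u hu).secondMoment_le
    _ = _ := by
      rw [setLIntegral_const, Real.volume_Icc, mul_comm, ENNReal.ofReal_mul (by linarith)]

theorem ae_memLp_path [SFinite μ] (hZ : Measurable (Function.uncurry Z)) (hab : a ≤ b)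
    (h : ∀ u ∈ Icc a b, L2Bound μ (Z u) K) :
    ∀ᵐ ω ∂μ, MemLp (fun u => Z u ω) 2 (volume.restrict (Icc a b)) := by
  have hm : Measurable (Function.uncurry fun (ω : Ω) (u : ℝ) => ENNReal.ofReal (Z u ω ^ 2)) :=
    ((hZ.comp measurable_swap).pow_const 2).ennreal_ofReal
  have h1 := ae_lt_top (hm.lintegral_prod_right' (ν := volume.restrict (Icc a b)))
    ((lintegral_timeIntegral_sq_le hZ hab h).trans_lt ENNReal.ofReal_lt_top).ne
  filter_upwards [h1] with ω hω
  refine ⟨(hZ.comp (measurable_id.prodMk measurable_const)).aestronglyMeasurable, ?_⟩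
  have h2 := secondMoment_eq_eLpNorm_sq (μ := volume.restrict (Icc a b)) (fun u => Z u ω)
  rw [secondMoment] at h2
  have h3 : eLpNorm (fun u => Z u ω) 2 (volume.restrict (Icc a b)) ^ 2 < ∞ := h2 ▸ hω
  exact lt_top_iff_ne_top.2 fun h4 => by simp [h4] at h3

theorem ae_intervalIntegrable_path [SFinite μ] (hZ : Measurable (Function.uncurry Z)) (hab : a ≤ b)
    (h : ∀ u ∈ Icc a b, L2Bound μ (Z u) K) :
    ∀ᵐ ω ∂μ, IntervalIntegrable (fun u => Z u ω) volume a b := by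
  filter_upwards [ae_memLp_path hZ hab h] with ω hω
  rw [intervalIntegrable_iff_integrableOn_Icc_of_le hab]
  exact hω.integrable (by norm_num)

theorem measurable_timeIntegral (hZ : Measurable (Function.uncurry Z)) (a b : ℝ) :
    Measurable fun ω => ∫ u in a..b, Z u ω := by
  have h1 : StronglyMeasurable (Function.uncurry fun (ω : Ω) (u : ℝ) => Z u ω) :=
    (hZ.comp measurable_swap).stronglyMeasurable
  simp only [intervalIntegral]
  exact (h1.integral_prod_right (ν := volume.restrict (Ioc a b))).measurable.sub
    (h1.integral_prod_right (ν := volume.restrict (Ioc b a))).measurable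

/-- Minkowski's inequality for the time integral of a process. -/
theorem L2Bound.timeIntegral [SFinite μ] (hZ : Measurable (Function.uncurry Z)) (hab : a ≤ b)
    (h : ∀ u ∈ Icc a b, L2Bound μ (Z u) K) :
    L2Bound μ (fun ω => ∫ u in a..b, Z u ω) ((b - a) * K) := by
  refine L2Bound.of_secondMoment_le (measurable_timeIntegral hZ a b).aestronglyMeasurable
    (mul_nonneg (by linarith) (h a ⟨le_rfl, hab⟩).nonneg) ?_
  -- Cauchy–Schwarz in time, path by path; Tonelli then moves the expectation inside.
  have key : ∀ ω, ENNReal.ofReal ((∫ u in a..b, Z u ω) ^ 2)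
      ≤ (∫⁻ u in Icc a b, ENNReal.ofReal (Z u ω ^ 2)) * ENNReal.ofReal (b - a) := by
    intro ω
    have hm : AEStronglyMeasurable (fun u => Z u ω) (volume.restrict (Icc a b)) :=
      (hZ.comp (measurable_id.prodMk measurable_const)).aestronglyMeasurable
    have h1 : ‖∫ u in a..b, Z u ω‖ₑ ≤ eLpNorm (fun u => Z u ω) 2 (volume.restrict (Icc a b))
        * ENNReal.ofReal (b - a) ^ (1 / 2 : ℝ) := by
      rw [intervalIntegral.integral_of_le hab, ← integral_Icc_eq_integral_Ioc]
      refine (enorm_integral_le_lintegral_enorm _).trans ?_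
      rw [← eLpNorm_one_eq_lintegral_enorm]
      refine (eLpNorm_le_eLpNorm_mul_rpow_measure_univ (q := 2) (by norm_num) hm).trans ?_
      simp only [MeasurableSet.univ, Measure.restrict_apply, univ_inter, Real.volume_Icc]
      norm_num
    have h2 := secondMoment_eq_eLpNorm_sq (μ := volume.restrict (Icc a b)) (fun u => Z u ω)
    rw [secondMoment] at h2
    rw [h2, ← sq_abs, ENNReal.ofReal_pow (abs_nonneg _), ← Real.enorm_eq_ofReal_abs]
    calc _ ≤ _ := pow_le_pow_left' h1 2
      _ = _ := by
        rw [mul_pow, ← ENNReal.rpow_natCast (ENNReal.ofReal (b - a) ^ (1 / 2 : ℝ)),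
          ← ENNReal.rpow_mul]
        norm_num
  have hm : Measurable (Function.uncurry fun (ω : Ω) (u : ℝ) => ENNReal.ofReal (Z u ω ^ 2)) :=
    ((hZ.comp measurable_swap).pow_const 2).ennreal_ofReal
  calc secondMoment μ (fun ω => ∫ u in a..b, Z u ω)
      ≤ ∫⁻ ω, (∫⁻ u in Icc a b, ENNReal.ofReal (Z u ω ^ 2)) * ENNReal.ofReal (b - a) ∂μ :=
        lintegral_mono key
    _ = (∫⁻ ω, (∫⁻ u in Icc a b, ENNReal.ofReal (Z u ω ^ 2)) ∂μ) * ENNReal.ofReal (b - a) :=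
        lintegral_mul_const _ (hm.lintegral_prod_right' (ν := volume.restrict (Icc a b)))
    _ ≤ ENNReal.ofReal ((b - a) * K ^ 2) * ENNReal.ofReal (b - a) := by
        gcongr; exact lintegral_timeIntegral_sq_le hZ hab h
    _ = _ := by
        rw [← ENNReal.ofReal_mul (mul_nonneg (by linarith) (sq_nonneg _))]
        congr 1; ring

/-- If all values of a measurable process on `[a,b]` are known at some time, then so is its
time integral over `[a,b]`, up to null sets. -/
theorem aeStronglyMeasurable_timeIntegral {Ω : Type u} {G mΩ : MeasurableSpace Ω} {μ : Measure Ω}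
    [IsFiniteMeasure μ] {Z : ℝ → Ω → ℝ} {a b K : ℝ} (hG : G ≤ mΩ)
    (hZ : Measurable (Function.uncurry Z)) (hab : a ≤ b)
    (h : ∀ u ∈ Icc a b, L2Bound μ (Z u) K)
    (hZG : ∀ u ∈ Icc a b, AEStronglyMeasurable[G] (Z u) μ) :
    AEStronglyMeasurable[G] (fun ω => ∫ u in a..b, Z u ω) μ := by
  -- `Z` is jointly measurable only for the large σ-algebra, and each `Z u` is known to `G` only up
  -- to a null set depending on `u`, so Fubini over `G` is not available. Instead, the residual Y =
  -- J - μ[J | G] is orthogonal to everything in L² known to `G`: to each `Z u`, hence by Fubini to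
  -- `J`, and to μ[J | G]. So it is orthogonal to itself.
  set J : Ω → ℝ := fun ω => ∫ u in a..b, Z u ω with hJ
  have hJ2 : L2Bound μ J ((b - a) * K) := L2Bound.timeIntegral hZ hab h
  have hY2 := hJ2.sub (hJ2.condExp G)
  set Y : Ω → ℝ := J - μ[J | G] with hY
  have hYG : μ[Y | G] =ᵐ[μ] 0 := by
    refine (condExp_sub hJ2.integrable integrable_condExp G).trans ?_
    rw [condExp_of_stronglyMeasurable hG stronglyMeasurable_condExp integrable_condExp]
    simp
  have orth : ∀ U : Ω → ℝ, MemLp U 2 μ → AEStronglyMeasurable[G] U μ → ∫ ω, U ω * Y ω ∂μ = 0 :=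
    fun U hU hUG => integral_mul_eq_zero_of_condExp_eq_zero hG hU hUG hY2.memLp hYG
  have hJY : ∫ ω, J ω * Y ω ∂μ = 0 := by
    obtain ⟨Y', hY'm, hYY'⟩ := hY2.aesm
    have hYY'2 : MemLp Y' 2 μ := hY2.memLp.ae_eq hYY'
    have e1 : ∀ ω, J ω * Y' ω = ∫ u in Icc a b, Z u ω * Y' ω := fun ω => by
      rw [integral_mul_const]; simp only [hJ]; rw [intervalIntegral.integral_of_le hab, integral_Icc_eq_integral_Ioc]
    have e2 : ∫ ω, J ω * Y ω ∂μ = ∫ ω, J ω * Y' ω ∂μ :=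
      integral_congr_ae (by filter_upwards [hYY'] with ω hω; rw [hω])
    rw [e2]; simp_rw [e1]
    have hmeas : Measurable (Function.uncurry fun (ω : Ω) (u : ℝ) => Z u ω) :=
      hZ.comp measurable_swap
    have hI1 : Integrable (Function.uncurry fun (ω : Ω) (u : ℝ) => Z u ω * Y' ω)
        (μ.prod (volume.restrict (Icc a b))) := by
      have hA : MemLp (Function.uncurry fun (ω : Ω) (u : ℝ) => Z u ω) 2
          (μ.prod (volume.restrict (Icc a b))) := by
        refine ⟨hmeas.aestronglyMeasurable, ?_⟩
        have h3 := secondMoment_eq_eLpNorm_sq (μ := μ.prod (volume.restrict (Icc a b)))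
          (Function.uncurry fun (ω : Ω) (u : ℝ) => Z u ω)
        have h4 : secondMoment (μ.prod (volume.restrict (Icc a b)))
            (Function.uncurry fun (ω : Ω) (u : ℝ) => Z u ω) < ∞ := by
          rw [secondMoment, lintegral_prod _ (hmeas.pow_const 2).ennreal_ofReal.aemeasurable]
          exact (lintegral_timeIntegral_sq_le hZ hab h).trans_lt ENNReal.ofReal_lt_top
        rw [h3] at h4
        exact lt_top_iff_ne_top.2 fun h5 => by simp [h5] at h4
      have hB : MemLp (fun q : Ω × ℝ => Y' q.1) 2 (μ.prod (volume.restrict (Icc a b))) :=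
        hYY'2.comp_fst _
      exact hA.integrable_mul hB
    rw [integral_integral_swap hI1]
    refine (setIntegral_congr_fun measurableSet_Icc fun u hu => ?_).trans (integral_zero _ _)
    have := orth (Z u) (h u hu).memLp (hZG u hu)
    rw [← this]
    exact integral_congr_ae (by filter_upwards [hYY'] with ω hω; rw [hω])
  have hEY := orth (μ[J | G]) (hJ2.condExp G).memLp
    stronglyMeasurable_condExp.aestronglyMeasurable
  have hYY : ∫ ω, Y ω ^ 2 ∂μ = 0 := by
    have : ∀ ω, Y ω ^ 2 = J ω * Y ω - (μ[J | G]) ω * Y ω := fun ω => by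
      rw [hY]; simp only [Pi.sub_apply]; ring
    simp_rw [this]
    refine (integral_sub (hJ2.memLp.integrable_mul hY2.memLp)
      ((hJ2.condExp G).memLp.integrable_mul hY2.memLp)).trans ?_
    simp only [Pi.mul_apply]
    rw [hJY, hEY, sub_zero]
  have := (integral_eq_zero_iff_of_nonneg (fun ω => sq_nonneg _) hY2.memLp.integrable_sq).1 hYY
  refine aeStronglyMeasurable_of_condExp_ae_eq ?_
  filter_upwards [this] with ω hω
  have h2 : Y ω = 0 := by simpa using hω
  rw [hY] at h2; simp only [Pi.sub_apply] at h2; linarith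

end TimeIntegral

/-! ### Square integrable martingales and the Itô isometry. -/

section SqMartingale

variable {Ω : Type u} {mΩ : MeasurableSpace Ω} {μ : Measure Ω} {T : ℝ} {F : Filtration ℝ mΩ}
  {M M' : ℝ → Ω → ℝ}

theorem isSqMartingale_condExp [IsFiniteMeasure μ] {Z : Ω → ℝ} (hZ : MemLp Z 2 μ) :
    IsSqMartingale T F μ (fun t => μ[Z | F t]) :=
  ⟨martingale_condExp Z (filtrationOn T F) μ, fun _ _ => hZ.condExp (by norm_num)⟩

namespace IsSqMartingale

theorem add (h : IsSqMartingale T F μ M) (h' : IsSqMartingale T F μ M') :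
    IsSqMartingale T F μ (M + M') :=
  ⟨h.1.add h'.1, fun t ht => (h.2 t ht).add (h'.2 t ht)⟩

theorem sub (h : IsSqMartingale T F μ M) (h' : IsSqMartingale T F μ M') :
    IsSqMartingale T F μ (M - M') :=
  ⟨h.1.sub h'.1, fun t ht => (h.2 t ht).sub (h'.2 t ht)⟩

theorem smul (h : IsSqMartingale T F μ M) (c : ℝ) : IsSqMartingale T F μ (c • M) :=
  ⟨h.1.smul c, fun t ht => (h.2 t ht).const_smul c⟩

theorem zero : IsSqMartingale T F μ (0 : ℝ → Ω → ℝ) :=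
  ⟨martingale_zero ℝ (filtrationOn T F) μ, fun _ _ => MemLp.zero⟩

theorem sum {ι : Type*} (s : Finset ι) {M : ι → ℝ → Ω → ℝ}
    (h : ∀ i ∈ s, IsSqMartingale T F μ (M i)) : IsSqMartingale T F μ (∑ i ∈ s, M i) := by
  classical
  induction s using Finset.induction_on with
  | empty => simpa using zero
  | insert a s ha ih =>
    rw [Finset.sum_insert ha]
    exact (h a (by simp)).add (ih fun i hi => h i (by simp [hi]))

theorem stronglyMeasurable (h : IsSqMartingale T F μ M) {t : ℝ} (ht : t ∈ Icc 0 T) :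
    StronglyMeasurable[F t] (M t) :=
  h.1.stronglyMeasurable ⟨t, ht⟩

theorem measurable (h : IsSqMartingale T F μ M) {t : ℝ} (ht : t ∈ Icc 0 T) : Measurable (M t) :=
  ((h.stronglyMeasurable ht).mono (F.le t)).measurable

theorem condExp_ae_eq (h : IsSqMartingale T F μ M) {s t : ℝ} (hs : s ∈ Icc 0 T) (ht : t ∈ Icc 0 T)
    (hst : s ≤ t) : μ[M t | F s] =ᵐ[μ] M s :=
  h.1.condExp_ae_eq (i := ⟨s, hs⟩) (j := ⟨t, ht⟩) hst

theorem integrable (h : IsSqMartingale T F μ M) {t : ℝ} (ht : t ∈ Icc 0 T) : Integrable (M t) μ :=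
  h.1.integrable ⟨t, ht⟩

theorem l2Bound (h : IsSqMartingale T F μ M) {K : ℝ} (hK : L2Bound μ (M T) K) {t : ℝ}
    (ht : t ∈ Icc 0 T) : L2Bound μ (M t) K :=
  (hK.condExp (F t)).congr (h.condExp_ae_eq ht ⟨ht.1.trans ht.2, le_rfl⟩ ht.2)

variable [IsFiniteMeasure μ]

theorem integral_mul_increment (h : IsSqMartingale T F μ M) {s t : ℝ} (hs : s ∈ Icc 0 T)
    (ht : t ∈ Icc 0 T) (hst : s ≤ t) {U : Ω → ℝ} (hU : MemLp U 2 μ)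
    (hUs : AEStronglyMeasurable[F s] U μ) : ∫ ω, U ω * (M t ω - M s ω) ∂μ = 0 := by
  refine integral_mul_eq_zero_of_condExp_eq_zero (F.le s) hU hUs ((h.2 t ht).sub (h.2 s hs)) ?_
  refine (condExp_sub (h.integrable ht) (h.integrable hs) _).trans ?_
  filter_upwards [h.condExp_ae_eq hs ht hst, h.condExp_ae_eq hs hs le_rfl] with ω h1 h2
  simp [h1, h2]

theorem integral_increment_sq (h : IsSqMartingale T F μ M) {s t : ℝ} (hs : s ∈ Icc 0 T)
    (ht : t ∈ Icc 0 T) (hst : s ≤ t) :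
    ∫ ω, (M t ω - M s ω) ^ 2 ∂μ = ∫ ω, M t ω ^ 2 ∂μ - ∫ ω, M s ω ^ 2 ∂μ := by
  have h0 := h.integral_mul_increment hs ht hst (h.2 s hs)
    (h.stronglyMeasurable hs).aestronglyMeasurable
  have e : ∀ ω, (M t ω - M s ω) ^ 2
      = M t ω ^ 2 - M s ω ^ 2 - 2 * (M s ω * (M t ω - M s ω)) := fun ω => by ring
  simp_rw [e]
  have i1 := (h.2 t ht).integrable_sq
  have i2 := (h.2 s hs).integrable_sq
  have i3 : Integrable (fun ω => 2 * (M s ω * (M t ω - M s ω))) μ :=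
    ((h.2 s hs).integrable_mul ((h.2 t ht).sub (h.2 s hs))).const_mul 2
  have i12 : Integrable (fun ω => M t ω ^ 2 - M s ω ^ 2) μ := i1.sub i2
  rw [integral_sub i12 i3, integral_sub i1 i2, integral_const_mul, h0]
  ring

/-- The energy of a square integrable martingale is nondecreasing. -/
theorem integral_sq_mono (h : IsSqMartingale T F μ M) {s t : ℝ} (hs : s ∈ Icc 0 T)
    (ht : t ∈ Icc 0 T) (hst : s ≤ t) : ∫ ω, M s ω ^ 2 ∂μ ≤ ∫ ω, M t ω ^ 2 ∂μ := by
  have := h.integral_increment_sq hs ht hst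
  have h2 : 0 ≤ ∫ ω, (M t ω - M s ω) ^ 2 ∂μ := integral_nonneg fun ω => sq_nonneg _
  linarith

/-- Elementary Itô isometry, as an inequality. -/
theorem integral_sum_increment_sq_le (h : IsSqMartingale T F μ M) {τ : ℕ → ℝ} (hτ : Monotone τ)
    {c : ℕ → ℝ} {K : ℝ} (n : ℕ) (hτT : ∀ k ≤ n, τ k ∈ Icc 0 T) (hc : ∀ k < n, |c k| ≤ K) :
    AEStronglyMeasurable[F (τ n)]
        (fun ω => ∑ k ∈ Finset.range n, c k * (M (τ (k + 1)) ω - M (τ k) ω)) μ ∧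
      MemLp (fun ω => ∑ k ∈ Finset.range n, c k * (M (τ (k + 1)) ω - M (τ k) ω)) 2 μ ∧
      ∫ ω, (∑ k ∈ Finset.range n, c k * (M (τ (k + 1)) ω - M (τ k) ω)) ^ 2 ∂μ
        ≤ K ^ 2 * (∫ ω, M (τ n) ω ^ 2 ∂μ - ∫ ω, M (τ 0) ω ^ 2 ∂μ) := by
  -- The measurability of the partial sum at time `τ n` is carried along because it makes the cross
  -- term with the next increment vanish.
  induction n with
  | zero => simp [aestronglyMeasurable_const, MemLp.zero']
  | succ n ih =>
    obtain ⟨ih1, ih2, ih3⟩ := ih (fun k hk => hτT k (by omega)) (fun k hk => hc k (by omega))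
    have hn := hτT n (by omega)
    have hn1 := hτT (n + 1) le_rfl
    have hle : τ n ≤ τ (n + 1) := hτ (Nat.le_succ n)
    simp only [Finset.sum_range_succ]
    have hinc : MemLp (fun ω => c n * (M (τ (n + 1)) ω - M (τ n) ω)) 2 μ :=
      ((h.2 _ hn1).sub (h.2 _ hn)).const_mul (c n)
    refine ⟨(ih1.mono (F.mono hle)).add (AEStronglyMeasurable.const_mul
      ((h.stronglyMeasurable hn1).aestronglyMeasurable.sub
        ((h.stronglyMeasurable hn).mono (F.mono hle)).aestronglyMeasurable) _),
      ih2.add hinc, ?_⟩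
    have h0 := h.integral_mul_increment hn hn1 hle ih2 ih1
    have h1 := h.integral_increment_sq hn hn1 hle
    have h2 := h.integral_sq_mono hn hn1 hle
    set P : Ω → ℝ := fun ω => ∑ k ∈ Finset.range n, c k * (M (τ (k + 1)) ω - M (τ k) ω)
    have e : ∀ ω, (P ω + c n * (M (τ (n + 1)) ω - M (τ n) ω)) ^ 2
        = P ω ^ 2 + (2 * c n) * (P ω * (M (τ (n + 1)) ω - M (τ n) ω))
          + c n ^ 2 * (M (τ (n + 1)) ω - M (τ n) ω) ^ 2 := fun ω => by ring
    have hd := (h.2 _ hn1).sub (h.2 _ hn)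
    have i2 : Integrable (fun ω => (2 * c n) * (P ω * (M (τ (n + 1)) ω - M (τ n) ω))) μ :=
      (ih2.integrable_mul hd).const_mul _
    have i3 : Integrable (fun ω => c n ^ 2 * (M (τ (n + 1)) ω - M (τ n) ω) ^ 2) μ :=
      hd.integrable_sq.const_mul _
    have i12 : Integrable (fun ω => P ω ^ 2 + (2 * c n) * (P ω * (M (τ (n + 1)) ω - M (τ n) ω))) μ :=
      ih2.integrable_sq.add i2
    have hcn : c n ^ 2 ≤ K ^ 2 := by
      rw [← sq_abs]; exact pow_le_pow_left₀ (abs_nonneg _) (hc n (by omega)) 2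
    calc ∫ ω, (P ω + c n * (M (τ (n + 1)) ω - M (τ n) ω)) ^ 2 ∂μ
        = ∫ ω, P ω ^ 2 ∂μ + c n ^ 2 * (∫ ω, M (τ (n + 1)) ω ^ 2 ∂μ - ∫ ω, M (τ n) ω ^ 2 ∂μ) := by
          simp_rw [e]
          rw [integral_add i12 i3, integral_add ih2.integrable_sq i2,
            integral_const_mul, integral_const_mul, h0, h1]
          ring
      _ ≤ K ^ 2 * (∫ ω, M (τ n) ω ^ 2 ∂μ - ∫ ω, M (τ 0) ω ^ 2 ∂μ)
          + K ^ 2 * (∫ ω, M (τ (n + 1)) ω ^ 2 ∂μ - ∫ ω, M (τ n) ω ^ 2 ∂μ) := by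
          gcongr
      _ = _ := by ring

end IsSqMartingale

end SqMartingale

/-! ### Riemann sums on equidistant grids. -/

section RiemannSum

variable {Ω : Type u} {mΩ : MeasurableSpace Ω} {μ : Measure Ω} {T : ℝ} {F : Filtration ℝ mΩ}
  {M : ℝ → Ω → ℝ} {f g : ℝ → ℝ} {t : ℝ}

theorem gridPoint_mem {t : ℝ} (ht : 0 ≤ t) {k n : ℕ} (hkn : k ≤ n) :
    (k : ℝ) * t / n ∈ Icc 0 t := by
  refine ⟨by positivity, ?_⟩
  -- For `n = 0` the quotient is 0 by convention, which also lies in the interval.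
  rcases Nat.eq_zero_or_pos n with rfl | hn
  · simpa using ht
  rw [div_le_iff₀ (by positivity), mul_comm]
  gcongr

theorem gridPoint_mono {t : ℝ} (ht : 0 ≤ t) (n : ℕ) : Monotone fun k : ℕ => (k : ℝ) * t / n :=
  fun j k hjk => by dsimp only; gcongr

/-- With the cast outside the sum `k + 1`, both grid points are values of one sequence k ↦ kt/n, as
telescoping and the discrete Itô isometry require. -/
theorem riemannSum_eq (f : ℝ → ℝ) (M : ℝ → Ω → ℝ) (t : ℝ) (n : ℕ) (ω : Ω) :
    riemannSum f M t n ω = ∑ k ∈ Finset.range n, f ((k : ℝ) * t / n)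
      * (M (((k + 1 : ℕ) : ℝ) * t / n) ω - M ((k : ℝ) * t / n) ω) := by
  simp [riemannSum]

theorem riemannSum_congr (ht : 0 ≤ t) (hfg : ∀ s ∈ Icc 0 t, f s = g s) (n : ℕ) :
    riemannSum f M t n = riemannSum g M t n := by
  funext ω
  refine Finset.sum_congr rfl fun k hk => ?_
  rw [hfg _ (gridPoint_mem ht (Finset.mem_range.1 hk).le)]

variable [IsFiniteMeasure μ]

/-- In the discrete Itô isometry the energy increments telescope to at most 𝔼[M_t²]. The bound does
not depend on `n` and survives the passage to the limit. -/
theorem riemannSum_props (h : IsSqMartingale T F μ M) (ht : t ∈ Icc 0 T)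
    {K m : ℝ} (hK : 0 ≤ K) (hf : ∀ s ∈ Icc 0 t, |f s| ≤ K) (hm : L2Bound μ (M t) m) (n : ℕ) :
    AEStronglyMeasurable[F t] (riemannSum f M t n) μ ∧ L2Bound μ (riemannSum f M t n) (K * m) := by
  have hmem : ∀ k ≤ n, (k : ℝ) * t / n ∈ Icc 0 T := fun k hk =>
    ⟨(gridPoint_mem ht.1 hk).1, (gridPoint_mem ht.1 hk).2.trans ht.2⟩
  obtain ⟨h1, h2, h3⟩ := h.integral_sum_increment_sq_le (gridPoint_mono ht.1 n)
    (c := fun k => f ((k : ℝ) * t / n)) (K := K) n hmem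
    (fun k hk => hf _ (gridPoint_mem ht.1 hk.le))
  have e : riemannSum f M t n = fun ω => ∑ k ∈ Finset.range n, f ((k : ℝ) * t / n)
      * (M (((k + 1 : ℕ) : ℝ) * t / n) ω - M ((k : ℝ) * t / n) ω) := funext (riemannSum_eq f M t n)
  rw [e]
  have hn := gridPoint_mem ht.1 (le_refl n)
  refine ⟨h1.mono (F.mono hn.2), L2Bound.of_integral_sq_le h2 (mul_nonneg hK hm.nonneg) ?_⟩
  refine h3.trans ?_
  rw [mul_pow]
  refine mul_le_mul_of_nonneg_left ?_ (sq_nonneg _)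
  have h4 := h.integral_sq_mono (hmem n le_rfl) ht hn.2
  have h5 : 0 ≤ ∫ ω, M (((0 : ℕ) : ℝ) * t / n) ω ^ 2 ∂μ := integral_nonneg fun ω => sq_nonneg _
  have h6 := hm.integral_sq_le
  linarith

end RiemannSum

/-! ### Stochastic integrals as limits in L². -/

section StochInt

variable {Ω : Type u} {mΩ : MeasurableSpace Ω} {μ : Measure Ω} {T : ℝ} {F : Filtration ℝ mΩ}
  {M M' : ℝ → Ω → ℝ} {f g : ℝ → ℝ} {t : ℝ} {J J' : Ω → ℝ}

/-- `J` is a version of the stochastic integral `∫_0^t f(s) dM_s`. -/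
structure HasStochInt (μ : Measure Ω) (f : ℝ → ℝ) (M : ℝ → Ω → ℝ) (t : ℝ) (J : Ω → ℝ) : Prop where
  memLp : MemLp J 2 μ
  tendsto : Tendsto (fun n => eLpNorm (riemannSum f M t n - J) 2 μ) atTop (𝓝 0)

theorem stochInt_congr (ht : 0 ≤ t) (hfg : ∀ s ∈ Icc 0 t, f s = g s) :
    stochInt μ f M t = stochInt μ g M t := by
  have e : riemannSum f M t = riemannSum g M t := funext (riemannSum_congr ht hfg)
  unfold stochInt
  rw [e]

namespace HasStochInt

/-- The value picked by choice is known only through its defining property; exhibiting any version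
makes that property available. -/
theorem stochInt (h : HasStochInt μ f M t J) : HasStochInt μ f M t (stochInt μ f M t) := by
  have h' : ∃ J : Ω → ℝ, MemLp J 2 μ ∧
      Tendsto (fun n => eLpNorm (riemannSum f M t n - J) 2 μ) atTop (𝓝 0) := ⟨J, h.1, h.2⟩
  rw [_root_.stochInt, dif_pos h']
  exact ⟨h'.choose_spec.1, h'.choose_spec.2⟩

theorem congr_ae (h : HasStochInt μ f M t J) (hJ : J =ᵐ[μ] J') : HasStochInt μ f M t J' := by
  refine ⟨h.1.ae_eq hJ, h.2.congr fun n => eLpNorm_congr_ae ?_⟩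
  filter_upwards [hJ] with ω hω
  simp [hω]

theorem congr (h : HasStochInt μ f M t J) (ht : 0 ≤ t) (hfg : ∀ s ∈ Icc 0 t, f s = g s) :
    HasStochInt μ g M t J :=
  ⟨h.1, h.2.congr fun n => by rw [riemannSum_congr ht hfg]⟩

theorem aesm_sub (hM : IsSqMartingale T F μ M) (ht : t ∈ Icc 0 T) (hJ : MemLp J 2 μ) (n : ℕ) :
    AEStronglyMeasurable (riemannSum f M t n - J) μ := by
  refine AEStronglyMeasurable.sub ?_ hJ.1
  have hmem : ∀ k ≤ n, (k : ℝ) * t / n ∈ Icc 0 T := fun k hk =>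
    ⟨(gridPoint_mem ht.1 hk).1, (gridPoint_mem ht.1 hk).2.trans ht.2⟩
  rw [show riemannSum f M t n = _ from funext (riemannSum_eq f M t n)]
  refine Measurable.aestronglyMeasurable (Finset.measurable_sum _ fun k hk => ?_)
  have hk' := Finset.mem_range.1 hk
  exact ((hM.measurable (hmem _ hk')).sub (hM.measurable (hmem _ hk'.le))).const_mul _

/-- The difference of two stochastic integrals is bounded by means of the difference of the
integrands and of the difference of the integrators. -/
theorem l2Bound_sub [IsFiniteMeasure μ] (hM : IsSqMartingale T F μ M) (hM' : IsSqMartingale T F μ M')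
    (ht : t ∈ Icc 0 T) (h : HasStochInt μ f M t J) (h' : HasStochInt μ g M' t J')
    {K L m m' : ℝ} (hK0 : 0 ≤ K) (hK : ∀ s ∈ Icc 0 t, |f s| ≤ K) (hL0 : 0 ≤ L)
    (hL : ∀ s ∈ Icc 0 t, |f s - g s| ≤ L) (hm : L2Bound μ (M t - M' t) m)
    (hm' : L2Bound μ (M' t) m') : L2Bound μ (J - J') (K * m + L * m') := by
  -- The splitting ∫ f dM - ∫ g dM' = ∫ f d(M - M') + ∫ (f - g) dM' is exact for Riemann sums.
  refine L2Bound.of_tendsto (R := fun n => riemannSum f (M - M') t n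
    + riemannSum (fun s => f s - g s) M' t n) (fun n => ?_) (h.1.1.sub h'.1.1) ?_
  · exact (riemannSum_props (hM.sub hM') ht hK0 hK hm n).2.add
      (riemannSum_props hM' ht hL0 hL hm' n).2
  · refine tendsto_of_tendsto_of_tendsto_of_le_of_le tendsto_const_nhds
      (by simpa using h.2.add h'.2) (fun n => zero_le) fun n => ?_
    have e : riemannSum f (M - M') t n + riemannSum (fun s => f s - g s) M' t n - (J - J')
        = (riemannSum f M t n - J) - (riemannSum g M' t n - J') := by
      funext ω
      simp only [Pi.sub_apply, Pi.add_apply, riemannSum]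
      rw [← Finset.sum_add_distrib]
      have : ∀ a b c d : ℝ, a - b - (c - d) = (a - c) - (b - d) := fun a b c d => by ring
      rw [this, ← Finset.sum_sub_distrib]
      congr 1
      exact Finset.sum_congr rfl fun k _ => by ring
    dsimp only
    rw [e]
    exact eLpNorm_sub_le (aesm_sub hM ht h.1 n) (aesm_sub hM' ht h'.1 n) (by norm_num)

theorem l2Bound [IsFiniteMeasure μ] (hM : IsSqMartingale T F μ M) (ht : t ∈ Icc 0 T) (h : HasStochInt μ f M t J)
    {K m : ℝ} (hK0 : 0 ≤ K) (hK : ∀ s ∈ Icc 0 t, |f s| ≤ K) (hm : L2Bound μ (M t) m) :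
    L2Bound μ J (K * m) :=
  L2Bound.of_tendsto (fun n => (riemannSum_props hM ht hK0 hK hm n).2) h.1.1 h.2

theorem ae_eq (hM : IsSqMartingale T F μ M) (ht : t ∈ Icc 0 T) (h : HasStochInt μ f M t J)
    (h' : HasStochInt μ f M t J') : J =ᵐ[μ] J' := by
  have h0 : eLpNorm (J' - J) 2 μ ≤ 0 := by
    refine ge_of_tendsto' (x := atTop) (f := fun n => eLpNorm (riemannSum f M t n - J) 2 μ
      + eLpNorm (riemannSum f M t n - J') 2 μ) (by simpa using h.2.add h'.2) fun n => ?_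
    have e : J' - J = (riemannSum f M t n - J) - (riemannSum f M t n - J') := by simp
    nth_rewrite 1 [e]
    exact eLpNorm_sub_le (aesm_sub hM ht h.1 n) (aesm_sub hM ht h'.1 n) (by norm_num)
  have h1 := (eLpNorm_eq_zero_iff (h'.1.sub h.1).1 (by norm_num)).1 (le_antisymm h0 bot_le)
  filter_upwards [h1] with ω hω
  exact (sub_eq_zero.1 hω).symm

/-- Riemann sums with a common integrand are linear in the integrator, so they cancel before the
limit is taken. This removes the individual parts from the average position. -/
theorem sum_of_forall_riemannSum_eq_zero {ι : Type*} (s : Finset ι) {M : ι → ℝ → Ω → ℝ}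
    {J : ι → Ω → ℝ} (hM : ∀ i ∈ s, IsSqMartingale T F μ (M i)) (ht : t ∈ Icc 0 T)
    (h : ∀ i ∈ s, HasStochInt μ f (M i) t (J i)) (h0 : ∀ u ω, ∑ i ∈ s, M i u ω = 0) :
    ∑ i ∈ s, J i =ᵐ[μ] 0 := by
  have h1 : eLpNorm (∑ i ∈ s, J i) 2 μ ≤ 0 := by
    refine ge_of_tendsto' (x := atTop)
      (f := fun n => ∑ i ∈ s, eLpNorm (riemannSum f (M i) t n - J i) 2 μ)
      (by simpa using tendsto_finsetSum s fun i hi => (h i hi).2) fun n => ?_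
    have e : ∑ i ∈ s, J i = -∑ i ∈ s, (riemannSum f (M i) t n - J i) := by
      funext ω
      have h3 : ∑ i ∈ s, riemannSum f (M i) t n ω = 0 := by
        simp only [riemannSum]
        rw [Finset.sum_comm]
        refine Finset.sum_eq_zero fun k _ => ?_
        rw [← Finset.mul_sum, Finset.sum_sub_distrib, h0, h0]; simp
      simp [Finset.sum_apply, h3]
    rw [e, eLpNorm_neg]
    exact eLpNorm_sum_le (fun i hi => aesm_sub (hM i hi) ht (h i hi).1 n) (by norm_num)
  exact (eLpNorm_eq_zero_iff (Finset.sum_induction _ (fun Z => AEStronglyMeasurable Z μ)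
    (fun _ _ => AEStronglyMeasurable.add) aestronglyMeasurable_zero fun i hi => (h i hi).1.1)
    (by norm_num)).1 (le_antisymm h1 bot_le)

end HasStochInt

end StochInt

/-! ### Jointly measurable versions of martingales. -/

section Modification

variable {Ω : Type u} {mΩ : MeasurableSpace Ω} {μ : Measure Ω} {T : ℝ} {F : Filtration ℝ mΩ}
  {M : ℝ → Ω → ℝ}

/-- The series of the squared errors has finite expectation, so it converges almost surely and its
terms tend to zero. -/
theorem ae_tendsto_of_secondMoment_le {X : ℕ → Ω → ℝ} {Y : Ω → ℝ} {ε : ℕ → ℝ≥0∞}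
    (hX : ∀ n, Measurable (X n)) (hY : Measurable Y) (hε : ∑' n, ε n ≠ ∞)
    (h : ∀ n, secondMoment μ (X n - Y) ≤ ε n) :
    ∀ᵐ ω ∂μ, Tendsto (fun n => X n ω) atTop (𝓝 (Y ω)) := by
  have hm : ∀ n, Measurable fun ω => ENNReal.ofReal ((X n - Y) ω ^ 2) := fun n =>
    (((hX n).sub hY).pow_const 2).ennreal_ofReal
  have h1 : ∫⁻ ω, ∑' n, ENNReal.ofReal ((X n - Y) ω ^ 2) ∂μ ≠ ∞ := by
    rw [lintegral_tsum fun n => (hm n).aemeasurable]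
    exact ne_top_of_le_ne_top hε (ENNReal.tsum_le_tsum h)
  filter_upwards [ae_lt_top (Measurable.tsum hm) h1] with ω hω
  have h2 := ENNReal.tendsto_atTop_zero_of_tsum_ne_top hω.ne
  have h3 := (ENNReal.tendsto_toReal ENNReal.zero_ne_top).comp h2
  have h4 : Tendsto (fun n => (X n ω - Y ω) ^ 2) atTop (𝓝 0) := by
    refine (h3.congr fun n => ?_)
    simp [ENNReal.toReal_ofReal (sq_nonneg _)]
  have h5 : Tendsto (fun n => |X n ω - Y ω|) atTop (𝓝 0) := by
    have := (Real.continuous_sqrt.tendsto 0).comp h4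
    simpa [Function.comp_def, Real.sqrt_sq_eq_abs] using this
  exact tendsto_iff_norm_sub_tendsto_zero.2 h5

/-- A square integrable martingale has a jointly measurable version, whatever its paths. -/
theorem IsSqMartingale.exists_measurable_modification [IsFiniteMeasure μ] (hT : 0 ≤ T)
    (h : IsSqMartingale T F μ M) : ∃ V : ℝ → Ω → ℝ, Measurable (Function.uncurry V) ∧
      ∀ t ∈ Icc 0 T, V t =ᵐ[μ] M t := by
  -- The squared L² distance of two values of the martingale is the difference of their energies.
  -- Times with the same value of ⌊4ⁿ A⌋ thus have values within squared distance 4⁻ⁿ. Replacing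
  -- each time by a representative of its level gives a process with countably many values of the
  -- time, hence jointly measurable, and the errors are summable.
  set A : ℝ → ℝ := fun t => ∫ ω, M (projIcc 0 T hT t) ω ^ 2 ∂μ with hA
  have hAmono : Monotone A := fun s t hst =>
    h.integral_sq_mono (projIcc 0 T hT s).2 (projIcc 0 T hT t).2 (monotone_projIcc hT hst)
  set idx : ℕ → ℝ → ℤ := fun n t => ⌊(4 : ℝ) ^ n * A t⌋ with hidx
  have hidxm : ∀ n, Measurable (idx n) := fun n =>
    Int.measurable_floor.comp (hAmono.measurable.const_mul _)
  have hrep : ∀ (n : ℕ) (j : ℤ), ∃ r ∈ Icc 0 T, ∀ t ∈ Icc 0 T, idx n t = j → idx n r = j := by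
    intro n j
    by_cases hj : ∃ t ∈ Icc 0 T, idx n t = j
    · obtain ⟨t, ht, htj⟩ := hj
      exact ⟨t, ht, fun _ _ _ => htj⟩
    -- A level that is not attained gets the dummy representative 0.
    · exact ⟨0, ⟨le_rfl, hT⟩, fun t ht htj => absurd ⟨t, ht, htj⟩ hj⟩
  choose rep hrepT hrepj using hrep
  have hXm : ∀ n, Measurable fun q : ℝ × Ω => M (rep n (idx n q.1)) q.2 := by
    intro n
    have h1 : Measurable fun q : ℤ × Ω => M (rep n q.1) q.2 :=
      measurable_from_prod_countable_right fun j => h.measurable (hrepT n j)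
    exact h1.comp (((hidxm n).comp measurable_fst).prodMk measurable_snd)
  -- The upper limit is jointly measurable whether or not the sequence converges, and equals the
  -- limit wherever it does.
  refine ⟨fun t ω => limsup (fun n => M (rep n (idx n t)) ω) atTop, ?_, ?_⟩
  · exact Measurable.limsup (f := fun n (q : ℝ × Ω) => M (rep n (idx n q.1)) q.2) hXm
  · intro t ht
    have hε : ∑' n : ℕ, ENNReal.ofReal ((1 / 4 : ℝ) ^ n) ≠ ∞ :=
      (summable_geometric_of_lt_one (by norm_num) (by norm_num)).tsum_ofReal_ne_top
    have := ae_tendsto_of_secondMoment_le (μ := μ) (X := fun n => M (rep n (idx n t))) (Y := M t)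
      (fun n => h.measurable (hrepT n _)) (h.measurable ht) hε fun n => ?_
    · filter_upwards [this] with ω hω
      exact hω.limsup_eq
    set r := rep n (idx n t)
    have hr : r ∈ Icc 0 T := hrepT n _
    have hrt : idx n r = idx n t := hrepj n (idx n t) t ht rfl
    have hclose : |A r - A t| ≤ (1 / 4 : ℝ) ^ n := by
      have h1 := Int.abs_sub_lt_one_of_floor_eq_floor hrt
      rw [← mul_sub, abs_mul, abs_of_pos (by positivity)] at h1
      rw [one_div, inv_pow, ← one_div, le_div_iff₀ (by positivity), mul_comm]
      exact h1.le
    have hAv : ∀ s ∈ Icc 0 T, A s = ∫ ω, M s ω ^ 2 ∂μ := fun s hs => by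
      simp only [hA]; rw [projIcc_of_mem hT hs]
    rw [((h.2 r hr).sub (h.2 t ht)).secondMoment_eq]
    refine ENNReal.ofReal_le_ofReal (le_trans ?_ hclose)
    rw [hAv r hr, hAv t ht]
    rcases le_total r t with hle | hle
    · have := h.integral_increment_sq hr ht hle
      rw [abs_sub_comm, ← this]
      refine (le_of_eq ?_).trans (le_abs_self _)
      exact integral_congr_ae (ae_of_all _ fun ω => by simp only [Pi.sub_apply]; ring)
    · have := h.integral_increment_sq ht hr hle
      rw [← this]
      exact le_abs_self _

end Modification

/-! ### Deterministic integration by parts and measurability of primitives. -/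

section Calculus

/-- Interchange of the order of integration in a triangle. -/
theorem integral_mul_primitive {c k : ℝ → ℝ} {t : ℝ} (hc : Continuous c)
    (hk : IntervalIntegrable k volume 0 t) :
    ∫ u in (0 : ℝ)..t, c u * ∫ s in (0 : ℝ)..u, k s = ∫ s in (0 : ℝ)..t, (∫ u in s..t, c u) * k s := by
  set C : ℝ → ℝ := fun u => ∫ s in (0 : ℝ)..u, c s with hC
  set P : ℝ → ℝ := fun u => ∫ s in (0 : ℝ)..u, k s with hP
  have hci : ∀ a b, IntervalIntegrable c volume a b := fun a b => hc.intervalIntegrable a b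
  have hCd : ∀ u, HasDerivAt C (c u) u := fun u => hc.integral_hasStrictDerivAt 0 u |>.hasDerivAt
  -- `k` is merely integrable, so its primitive is differentiable only almost everywhere;
  -- integration by parts is applied to absolutely continuous functions.
  have hCac : AbsolutelyContinuousOnInterval C 0 t :=
    (hci 0 t).absolutelyContinuousOnInterval_intervalIntegral (by simp)
  have hPac : AbsolutelyContinuousOnInterval P 0 t :=
    hk.absolutelyContinuousOnInterval_intervalIntegral (by simp)
  have hCcont : Continuous C := continuous_iff_continuousAt.2 fun u => (hCd u).continuousAt
  have h1 := hCac.integral_deriv_mul_eq_sub hPac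
  have h2 : ∫ u in (0 : ℝ)..t, deriv C u * P u + C u * deriv P u
      = ∫ u in (0 : ℝ)..t, c u * P u + C u * k u := by
    refine intervalIntegral.integral_congr_ae ?_
    filter_upwards [hk.ae_hasDerivAt_integral] with u hu hut
    rw [(hCd u).deriv, (hu (uIoc_subset_uIcc hut) 0 (by simp)).deriv]
  have i1 : IntervalIntegrable (fun u => c u * P u) volume 0 t :=
    (hc.continuousOn.mul hPac.continuousOn).intervalIntegrable
  have i2 : IntervalIntegrable (fun u => C u * k u) volume 0 t :=
    hk.continuousOn_mul hCcont.continuousOn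
  rw [h2, intervalIntegral.integral_add i1 i2] at h1
  have h3 : ∀ s, ∫ u in s..t, c u = C t - C s := fun s =>
    (intervalIntegral.integral_interval_sub_left (hci 0 t) (hci 0 s)).symm
  simp_rw [h3, sub_mul]
  rw [intervalIntegral.integral_sub (hk.const_mul _) i2, intervalIntegral.integral_const_mul]
  have hP0 : P 0 = 0 := by simp [hP]
  rw [hP0, mul_zero, sub_zero] at h1
  change ∫ u in (0 : ℝ)..t, c u * P u = C t * P t - _
  linarith

/-- A continuously differentiable function on `[0,T]` extends to the real line. -/
theorem exists_extension_hasDerivAt {T : ℝ} (hT : 0 ≤ T) {f f' : ℝ → ℝ}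
    (hf : ∀ s ∈ Icc 0 T, HasDerivAt f (f' s) s) (hf' : ContinuousOn f' (Icc 0 T)) :
    ∃ g g' : ℝ → ℝ, Continuous g' ∧ (∀ s, HasDerivAt g (g' s) s) ∧ ∀ s ∈ Icc 0 T, g s = f s := by
  set g' : ℝ → ℝ := fun s => f' (projIcc 0 T hT s) with hg'
  have hg'c : Continuous g' := by
    have := continuousOn_iff_continuous_domRestrict.1 hf'
    exact this.comp continuous_projIcc
  refine ⟨fun s => f 0 + ∫ u in (0 : ℝ)..s, g' u, g', hg'c,
    fun s => ((hg'c.integral_hasStrictDerivAt 0 s).hasDerivAt.const_add _), fun s hs => ?_⟩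
  have h1 : ∫ u in (0 : ℝ)..s, g' u = ∫ u in (0 : ℝ)..s, f' u := by
    refine intervalIntegral.integral_congr fun u hu => ?_
    rw [uIcc_of_le hs.1] at hu
    simp only [hg']
    rw [projIcc_of_mem hT ⟨hu.1, hu.2.trans hs.2⟩]
  dsimp only
  rw [h1, intervalIntegral.integral_eq_sub_of_hasDerivAt (f := f)]
  · ring
  · intro u hu
    rw [uIcc_of_le hs.1] at hu
    exact hf u ⟨hu.1, hu.2.trans hs.2⟩
  · refine ContinuousOn.intervalIntegrable ?_
    rw [uIcc_of_le hs.1]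
    exact hf'.mono (Icc_subset_Icc_right hs.2)

end Calculus

/-- The primitive of a jointly measurable process is jointly measurable. -/
theorem measurable_primitive {Ω : Type u} [MeasurableSpace Ω] {Z : ℝ → Ω → ℝ}
    (hZ : Measurable (Function.uncurry Z)) (a : ℝ) :
    Measurable fun q : ℝ × Ω => ∫ u in a..q.1, Z u q.2 := by
  have h1 : StronglyMeasurable (Function.uncurry fun (q : ℝ × Ω) (u : ℝ) => Z u q.2) :=
    (hZ.comp (measurable_snd.prodMk (measurable_snd.comp measurable_fst))).stronglyMeasurable
  -- The moving endpoint is absorbed into the indicator of a measurable set of pairs of times, which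
  -- leaves an integral over the whole line with a parameter.
  have h2 : ∀ S : Set (ℝ × ℝ), MeasurableSet S →
      Measurable fun q : ℝ × Ω => ∫ u, S.indicator (fun r => Z r.2 q.2) (q.1, u) := by
    intro S hS
    have h3 : StronglyMeasurable (Function.uncurry fun (q : ℝ × Ω) (u : ℝ) =>
        S.indicator (fun r => Z r.2 q.2) (q.1, u)) := by
      have : (Function.uncurry fun (q : ℝ × Ω) (u : ℝ) => S.indicator (fun r => Z r.2 q.2) (q.1, u))
          = ((fun x : (ℝ × Ω) × ℝ => (x.1.1, x.2)) ⁻¹' S).indicator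
            (Function.uncurry fun (q : ℝ × Ω) (u : ℝ) => Z u q.2) := rfl
      rw [this]
      exact h1.indicator (((measurable_fst.comp measurable_fst).prodMk measurable_snd) hS)
    exact h3.integral_prod_right.measurable
  have hS1 : MeasurableSet {r : ℝ × ℝ | a < r.2 ∧ r.2 ≤ r.1} :=
    (measurableSet_lt measurable_const measurable_snd).inter
      (measurableSet_le measurable_snd measurable_fst)
  have hS2 : MeasurableSet {r : ℝ × ℝ | r.1 < r.2 ∧ r.2 ≤ a} :=
    (measurableSet_lt measurable_fst measurable_snd).inter
      (measurableSet_le measurable_snd measurable_const)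
  have e : (fun q : ℝ × Ω => ∫ u in a..q.1, Z u q.2)
      = (fun q => ∫ u, {r : ℝ × ℝ | a < r.2 ∧ r.2 ≤ r.1}.indicator (fun r => Z r.2 q.2) (q.1, u))
        - fun q => ∫ u, {r : ℝ × ℝ | r.1 < r.2 ∧ r.2 ≤ a}.indicator
          (fun r => Z r.2 q.2) (q.1, u) := by
    funext q
    simp only [intervalIntegral, Pi.sub_apply]
    rw [← integral_indicator measurableSet_Ioc, ← integral_indicator measurableSet_Ioc]
    rfl
  rw [e]
  exact (h2 _ hS1).sub (h2 _ hS2)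

/-! ### Stochastic integrals of continuously differentiable functions. -/

section IntegrationByParts

variable {Ω : Type u} {mΩ : MeasurableSpace Ω} {μ : Measure Ω} {T : ℝ} {F : Filtration ℝ mΩ}
  {M V : ℝ → Ω → ℝ} {f f' : ℝ → ℝ} {t : ℝ}

/-- Integration by parts for Riemann sums. -/
theorem riemannSum_sub_eq (hf' : Continuous f') (hf : ∀ s, HasDerivAt f (f' s) s)
    (ht : 0 ≤ t) {n : ℕ} (hn : 0 < n) {ω : Ω} (hV : IntervalIntegrable (fun u => V u ω) volume 0 t) :
    riemannSum f V t n ω - (f t * V t ω - f 0 * V 0 ω - ∫ u in (0 : ℝ)..t, f' u * V u ω)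
      = ∑ k ∈ Finset.range n, ∫ u in ((k : ℝ) * t / n)..(((k + 1 : ℕ) : ℝ) * t / n),
          f' u * (V u ω - V (((k + 1 : ℕ) : ℝ) * t / n) ω) := by
  set τ : ℕ → ℝ := fun k => (k : ℝ) * t / n with hτ
  have hτ0 : τ 0 = 0 := by simp [hτ]
  have hτn : τ n = t := by simp only [hτ]; field_simp
  have hi : ∀ k < n, IntervalIntegrable (fun u => V u ω) volume (τ k) (τ (k + 1)) := by
    intro k hk
    refine hV.mono_set ?_
    rw [uIcc_of_le (gridPoint_mono ht n (Nat.le_succ k)), uIcc_of_le ht]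
    exact Icc_subset_Icc (gridPoint_mem ht hk.le).1 (gridPoint_mem ht hk).2
  have hi' : ∀ k < n, IntervalIntegrable (fun u => f' u * V u ω) volume (τ k) (τ (k + 1)) :=
    fun k hk => (hi k hk).continuousOn_mul hf'.continuousOn
  -- Summation by parts leaves the increments of `f`, which are integrals of `f'`, against `V` at
  -- the right end of each cell.
  have e1 : ∀ k < n, ∫ u in (τ k)..(τ (k + 1)), f' u * (V u ω - V (τ (k + 1)) ω)
      = (∫ u in (τ k)..(τ (k + 1)), f' u * V u ω) - (f (τ (k + 1)) - f (τ k)) * V (τ (k + 1)) ω := by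
    intro k hk
    simp_rw [mul_sub]
    rw [intervalIntegral.integral_sub (hi' k hk) ((hf'.intervalIntegrable _ _).mul_const _),
      intervalIntegral.integral_mul_const,
      intervalIntegral.integral_eq_sub_of_hasDerivAt (fun u _ => hf u) (hf'.intervalIntegrable _ _)]
  have e2 : f t * V t ω - f 0 * V 0 ω
      = ∑ k ∈ Finset.range n, (f (τ (k + 1)) * V (τ (k + 1)) ω - f (τ k) * V (τ k) ω) := by
    rw [Finset.sum_range_sub (fun k => f (τ k) * V (τ k) ω), hτ0, hτn]
  have e3 := intervalIntegral.sum_integral_adjacent_intervals hi'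
  rw [hτ0, hτn] at e3
  rw [riemannSum_eq, Finset.sum_congr rfl fun k hk => e1 k (Finset.mem_range.1 hk), ← e3, e2,
    ← Finset.sum_sub_distrib, ← Finset.sum_sub_distrib]
  exact Finset.sum_congr rfl fun k _ => by ring

theorem IsSqMartingale.l2Bound_increment [IsFiniteMeasure μ] (h : IsSqMartingale T F μ M) {s t : ℝ} (hs : s ∈ Icc 0 T)
    (ht : t ∈ Icc 0 T) (hst : s ≤ t) :
    L2Bound μ (M t - M s) (√(∫ ω, M t ω ^ 2 ∂μ - ∫ ω, M s ω ^ 2 ∂μ)) := by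
  refine L2Bound.of_integral_sq_le ((h.2 t ht).sub (h.2 s hs)) (Real.sqrt_nonneg _) ?_
  rw [Real.sq_sqrt (sub_nonneg.2 (h.integral_sq_mono hs ht hst)),
    ← h.integral_increment_sq hs ht hst]
  rfl

theorem MeasureTheory.MemLp.exists_l2Bound {Z : Ω → ℝ} (h : MemLp Z 2 μ) : ∃ K, L2Bound μ Z K :=
  ⟨_, ENNReal.toReal_nonneg, h.1, (ENNReal.ofReal_toReal h.2.ne).symm.le⟩

variable [IsFiniteMeasure μ]

/-- The stochastic integral of a continuously differentiable function exists, and is given by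
integration by parts with the help of a measurable version of the martingale. -/
theorem IsSqMartingale.hasStochInt (h : IsSqMartingale T F μ M)
    (hVm : Measurable (Function.uncurry V)) (hV : ∀ t ∈ Icc 0 T, V t =ᵐ[μ] M t)
    (hf' : Continuous f') (hf : ∀ s, HasDerivAt f (f' s) s) (ht : t ∈ Icc 0 T) :
    HasStochInt μ f M t
      (fun ω => f t * V t ω - f 0 * V 0 ω - ∫ u in (0 : ℝ)..t, f' u * V u ω) := by
  have hT : 0 ≤ T := ht.1.trans ht.2
  obtain ⟨m, hm⟩ := (h.2 T ⟨hT, le_rfl⟩).exists_l2Bound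
  have hVb : ∀ u ∈ Icc 0 T, L2Bound μ (V u) m := fun u hu => (h.l2Bound hm hu).congr (hV u hu).symm
  have hsub : ∀ u ∈ Icc 0 t, u ∈ Icc 0 T := fun u hu => ⟨hu.1, hu.2.trans ht.2⟩
  obtain ⟨D, hD⟩ : ∃ D, ∀ u ∈ Icc 0 t, |f' u| ≤ D :=
    isCompact_Icc.exists_bound_of_continuousOn hf'.continuousOn
  have hD0 : 0 ≤ D := (abs_nonneg _).trans (hD 0 ⟨le_rfl, ht.1⟩)
  have hfVm : Measurable (Function.uncurry fun (u : ℝ) ω => f' u * V u ω) :=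
    (hf'.measurable.comp measurable_fst).mul hVm
  have hJ : MemLp (fun ω => f t * V t ω - f 0 * V 0 ω - ∫ u in (0 : ℝ)..t, f' u * V u ω) 2 μ :=
    (((hVb t ht).memLp.const_mul _).sub ((hVb 0 ⟨le_rfl, hT⟩).memLp.const_mul _)).sub
      (L2Bound.timeIntegral (K := D * m) hfVm ht.1 fun u hu =>
        (hVb u (hsub u hu)).smul_le (hD u hu)).memLp
  refine ⟨hJ, ?_⟩
  set a : ℝ := ∫ ω, M t ω ^ 2 ∂μ with ha
  -- On the cell k the error has norm at most (t/n) D √(A(k+1) - A(k)), where A(k) is the energy at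
  -- the k-th grid point. Cauchy–Schwarz over the cells and telescoping of the energies give the
  -- total t D √a / √n.
  have key : ∀ n : ℕ, 0 < n → eLpNorm (riemannSum f M t n
      - fun ω => f t * V t ω - f 0 * V 0 ω - ∫ u in (0 : ℝ)..t, f' u * V u ω) 2 μ
        ≤ ENNReal.ofReal (t * D * √a * (√n)⁻¹) := by
    intro n hn
    set τ : ℕ → ℝ := fun k => (k : ℝ) * t / n with hτ
    have hτmem : ∀ k ≤ n, τ k ∈ Icc 0 t := fun k hk => gridPoint_mem ht.1 hk
    have hτmono : Monotone τ := gridPoint_mono ht.1 n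
    set A : ℕ → ℝ := fun k => ∫ ω, M (τ k) ω ^ 2 ∂μ with hA
    have hAmono : ∀ k < n, 0 ≤ A (k + 1) - A k := fun k hk =>
      sub_nonneg.2 (h.integral_sq_mono (hsub _ (hτmem k hk.le)) (hsub _ (hτmem _ hk))
        (hτmono (Nat.le_succ k)))
    have hstep : ∀ k, τ (k + 1) - τ k = t / n := fun k => by
      simp only [hτ]; push_cast; ring
    have e : riemannSum f M t n
        - (fun ω => f t * V t ω - f 0 * V 0 ω - ∫ u in (0 : ℝ)..t, f' u * V u ω)
        =ᵐ[μ] ∑ k ∈ Finset.range n, fun ω => ∫ u in (τ k)..(τ (k + 1)),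
          f' u * (V u ω - V (τ (k + 1)) ω) := by
      have hVall : ∀ᵐ ω ∂μ, ∀ k : ℕ, k ≤ n → V (τ k) ω = M (τ k) ω :=
        ae_all_iff.2 fun k => by
          by_cases hk : k ≤ n
          · filter_upwards [hV _ (hsub _ (hτmem k hk))] with ω hω _ using hω
          · exact ae_of_all _ fun ω hk' => absurd hk' hk
      filter_upwards [hVall, ae_intervalIntegrable_path hVm ht.1 fun u hu => hVb u (hsub u hu)]
        with ω h1 h2
      have h3 : riemannSum f M t n ω = riemannSum f V t n ω := by
        rw [riemannSum_eq, riemannSum_eq]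
        refine Finset.sum_congr rfl fun k hk => ?_
        have hk' := Finset.mem_range.1 hk
        rw [← h1 k hk'.le, ← h1 (k + 1) hk']
      rw [Pi.sub_apply, h3, riemannSum_sub_eq hf' hf ht.1 hn h2, Finset.sum_apply]
    have hb : L2Bound μ (∑ k ∈ Finset.range n, fun ω => ∫ u in (τ k)..(τ (k + 1)),
          f' u * (V u ω - V (τ (k + 1)) ω))
        (∑ k ∈ Finset.range n, t / n * (D * √(A (k + 1) - A k))) := by
      refine L2Bound.sum _ fun k hk => ?_
      have hk' := Finset.mem_range.1 hk
      rw [← hstep k]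
      refine L2Bound.timeIntegral ?_ (hτmono (Nat.le_succ k)) fun u hu => ?_
      · refine (hf'.measurable.comp measurable_fst).mul (hVm.sub ?_)
        exact hVm.comp (measurable_const.prodMk measurable_snd)
      · have hut : u ∈ Icc 0 t := ⟨(hτmem k hk'.le).1.trans hu.1, hu.2.trans (hτmem _ hk').2⟩
        have hk1 := hsub _ (hτmem _ hk')
        have h5 := h.l2Bound_increment (hsub u hut) hk1 hu.2
        have h6 : L2Bound μ (V u - V (τ (k + 1))) (√(A (k + 1) - A k)) := by
          refine (h5.neg.congr ?_).mono (Real.sqrt_le_sqrt ?_)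
          · filter_upwards [hV u (hsub u hut), hV _ hk1] with ω h7 h8
            simp only [Pi.neg_apply, Pi.sub_apply, h7, h8]; ring
          · have := h.integral_sq_mono (hsub _ (hτmem k hk'.le)) (hsub u hut) hu.1
            simp only [hA]; linarith
        exact h6.smul_le (hD u hut)
    rw [eLpNorm_congr_ae e]
    refine hb.le.trans (ENNReal.ofReal_le_ofReal ?_)
    have hcs : ∑ k ∈ Finset.range n, √(A (k + 1) - A k) ≤ √n * √a := by
      rw [← Real.sqrt_mul (by positivity)]
      refine Real.le_sqrt_of_sq_le ?_
      refine sq_sum_le_card_mul_sum_sq.trans ?_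
      rw [Finset.card_range]
      refine mul_le_mul_of_nonneg_left ?_ (by positivity)
      rw [Finset.sum_congr rfl fun k hk => Real.sq_sqrt (hAmono k (Finset.mem_range.1 hk)),
        Finset.sum_range_sub]
      have h8 : A n = a := by
        simp only [hA, hτ, ha]
        rw [show (n : ℝ) * t / n = t by field_simp]
      have h9 : 0 ≤ A 0 := integral_nonneg fun ω => sq_nonneg _
      linarith
    rw [← Finset.mul_sum, ← Finset.mul_sum]
    have hn0 : (0 : ℝ) < √n := Real.sqrt_pos.2 (by exact_mod_cast hn)
    calc t / n * (D * ∑ k ∈ Finset.range n, √(A (k + 1) - A k))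
        ≤ t / n * (D * (√n * √a)) := by
          have := ht.1
          gcongr
      _ = t * D * √a * (√n)⁻¹ := by
          have h10 : (n : ℝ) = √n * √n := (Real.mul_self_sqrt (by positivity)).symm
          nth_rewrite 1 [h10]
          field_simp
  have hlim : Tendsto (fun n : ℕ => ENNReal.ofReal (t * D * √a * (√n)⁻¹)) atTop (𝓝 0) := by
    rw [← ENNReal.ofReal_zero]
    refine ENNReal.tendsto_ofReal ?_
    have h11 : Tendsto (fun n : ℕ => (√(n : ℝ))⁻¹) atTop (𝓝 0) :=
      tendsto_inv_atTop_zero.comp (Real.tendsto_sqrt_atTop.comp tendsto_natCast_atTop_atTop)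
    simpa using h11.const_mul (t * D * √a)
  refine tendsto_of_tendsto_of_tendsto_of_le_of_le' tendsto_const_nhds hlim
    (Eventually.of_forall fun n => zero_le) ?_
  filter_upwards [eventually_gt_atTop 0] with n hn using key n hn

/-- For `h` continuously differentiable on `[0,T]`, there is a jointly measurable version `L` of
`∫_0^t h(s) dM_s`, and stochastic integrals of functions `h(s) ∫_s^t c(u) du` are time integrals
of it. -/
theorem IsSqMartingale.exists_stochInt_process (hT : 0 ≤ T) (hM : IsSqMartingale T F μ M)
    {h₀ h' : ℝ → ℝ} (hh : ∀ s ∈ Icc 0 T, HasDerivAt h₀ (h' s) s) (hh' : ContinuousOn h' (Icc 0 T)) :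
    ∃ L : ℝ → Ω → ℝ, Measurable (Function.uncurry L) ∧
      (∀ t ∈ Icc 0 T, HasStochInt μ h₀ M t (L t)) ∧
      (∀ t ∈ Icc 0 T, AEStronglyMeasurable[F t] (L t) μ) ∧
      ∀ c : ℝ → ℝ, Continuous c → ∀ t ∈ Icc 0 T,
        HasStochInt μ (fun s => h₀ s * ∫ u in s..t, c u) M t
          (fun ω => ∫ u in (0 : ℝ)..t, c u * L u ω) := by
  obtain ⟨V, hVm, hV⟩ := hM.exists_measurable_modification hT
  obtain ⟨g, g', hg', hg, hgh⟩ := exists_extension_hasDerivAt hT hh hh'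
  have hgc : Continuous g := continuous_iff_continuousAt.2 fun s => (hg s).continuousAt
  obtain ⟨m, hm⟩ := (hM.2 T ⟨hT, le_rfl⟩).exists_l2Bound
  have hVb : ∀ u ∈ Icc 0 T, L2Bound μ (V u) m := fun u hu => (hM.l2Bound hm hu).congr (hV u hu).symm
  have hgVm : Measurable (Function.uncurry fun (u : ℝ) ω => g' u * V u ω) :=
    (hg'.measurable.comp measurable_fst).mul hVm
  have hVad : ∀ u ∈ Icc 0 T, ∀ t, u ≤ t → AEStronglyMeasurable[F t] (V u) μ := fun u hu t hut =>
    ((hM.stronglyMeasurable hu).mono (F.mono hut)).aestronglyMeasurable.congr (hV u hu).symm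
  obtain ⟨D, hD⟩ : ∃ D, ∀ u ∈ Icc 0 T, |g' u| ≤ D :=
    isCompact_Icc.exists_bound_of_continuousOn hg'.continuousOn
  refine ⟨fun t ω => g t * V t ω - g 0 * V 0 ω - ∫ u in (0 : ℝ)..t, g' u * V u ω, ?_,
    fun t ht => (hM.hasStochInt hVm hV hg' hg ht).congr ht.1
      fun s hs => hgh s ⟨hs.1, hs.2.trans ht.2⟩, fun t ht => ?_, fun c hc t ht => ?_⟩
  · refine (((hgc.measurable.comp measurable_fst).mul hVm).sub
      ((hVm.comp (measurable_const.prodMk measurable_snd)).const_mul _)).sub ?_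
    exact measurable_primitive hgVm 0
  · refine (AEStronglyMeasurable.sub ((hVad t ht t le_rfl).const_mul _)
      ((hVad 0 ⟨le_rfl, hT⟩ t ht.1).const_mul _)).sub ?_
    exact aeStronglyMeasurable_timeIntegral (F.le t) (K := D * m) hgVm ht.1
      (fun u hu => (hVb u ⟨hu.1, hu.2.trans ht.2⟩).smul_le (hD u ⟨hu.1, hu.2.trans ht.2⟩))
      fun u hu => (hVad u ⟨hu.1, hu.2.trans ht.2⟩ t hu.2).const_mul _
  -- The stochastic Fubini theorem becomes pathwise: both sides are written by integration by parts,
  -- the boundary term at s = t vanishes, and what remains is the interchange of integrals in a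
  -- triangle.
  · have hd : ∀ s, HasDerivAt (fun s => g s * ∫ u in s..t, c u)
        (g' s * (∫ u in s..t, c u) + g s * -c s) s := fun s =>
      (hg s).mul (intervalIntegral.integral_hasDerivAt_left (hc.intervalIntegrable _ _)
        (hc.stronglyMeasurableAtFilter _ _) hc.continuousAt)
    have hCc : Continuous fun s => ∫ u in s..t, c u := by
      have : (fun s => ∫ u in s..t, c u) = fun s => -∫ u in t..s, c u := by
        funext s; rw [intervalIntegral.integral_symm]
      rw [this]
      exact (intervalIntegral.continuous_primitive (fun a b => hc.intervalIntegrable a b) t).neg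
    have hst := hM.hasStochInt (f' := fun s => g' s * (∫ u in s..t, c u) + g s * -c s) hVm hV
      ((hg'.mul hCc).add (hgc.mul hc.neg)) hd ht
    refine (hst.congr_ae ?_).congr ht.1 fun s hs => by rw [hgh s ⟨hs.1, hs.2.trans ht.2⟩]
    filter_upwards [ae_intervalIntegrable_path hVm ht.1
      fun u hu => hVb u ⟨hu.1, hu.2.trans ht.2⟩] with ω hω
    have hgV := hω.continuousOn_mul hg'.continuousOn
    have i1 : IntervalIntegrable (fun u => c u * (g u * V u ω)) volume 0 t :=
      (hω.continuousOn_mul hgc.continuousOn).continuousOn_mul hc.continuousOn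
    have i2 : IntervalIntegrable (fun u => c u * (g 0 * V 0 ω)) volume 0 t :=
      (hc.intervalIntegrable _ _).mul_const _
    have i3 : IntervalIntegrable (fun u => c u * ∫ s in (0 : ℝ)..u, g' s * V s ω) volume 0 t :=
      (hc.continuousOn.mul
        (hgV.absolutelyContinuousOnInterval_intervalIntegral (by simp)).continuousOn).intervalIntegrable
    have i4 : IntervalIntegrable (fun u => (∫ v in u..t, c v) * (g' u * V u ω)) volume 0 t :=
      hgV.continuousOn_mul hCc.continuousOn
    simp_rw [mul_sub]
    rw [intervalIntegral.integral_sub (i1.sub i2) i3, intervalIntegral.integral_sub i1 i2,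
      integral_mul_primitive hc hgV, intervalIntegral.integral_mul_const]
    have e : ∀ u, (g' u * (∫ v in u..t, c v) + g u * -c u) * V u ω
        = (∫ v in u..t, c v) * (g' u * V u ω) - c u * (g u * V u ω) := fun u => by ring
    simp_rw [e]
    rw [intervalIntegral.integral_sub i4 i1]
    simp only [intervalIntegral.integral_same]
    ring

end IntegrationByParts

/-! ### The exponential kernel and its dependence on the rate. -/

section Kernel

/-- The kernel `∫_0^x e^{-κ v} dv`, to which all the kernels of the games reduce after a change
of time. -/
def expKer (κ x : ℝ) : ℝ := ∫ v in (0 : ℝ)..x, Real.exp (-κ * v)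

theorem hasDerivAt_expKer (κ x : ℝ) : HasDerivAt (expKer κ) (Real.exp (-κ * x)) x :=
  (Continuous.integral_hasStrictDerivAt (by fun_prop) 0 x).hasDerivAt

@[simp] theorem expKer_zero (κ : ℝ) : expKer κ 0 = 0 := by simp [expKer]

theorem continuous_expKer (κ : ℝ) : Continuous (expKer κ) :=
  continuous_iff_continuousAt.2 fun x => (hasDerivAt_expKer κ x).continuousAt

theorem expKer_mono (κ : ℝ) : Monotone (expKer κ) :=
  monotone_of_hasDerivAt_nonneg (hasDerivAt_expKer κ) fun _ => (Real.exp_pos _).le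

theorem expKer_nonneg (κ : ℝ) {x : ℝ} (hx : 0 ≤ x) : 0 ≤ expKer κ x := by
  simpa using expKer_mono κ hx

/-- For v ≤ u, write e^u - e^v = e^u (1 - e^{v-u}) and use 1 + x ≤ e^x. -/
theorem abs_exp_sub_exp_le {u v R : ℝ} (hu : u ≤ R) (hv : v ≤ R) :
    |Real.exp u - Real.exp v| ≤ |u - v| * Real.exp R := by
  wlog huv : v ≤ u generalizing u v
  · rw [abs_sub_comm, abs_sub_comm u]
    exact this hv hu (not_le.1 huv).le
  rw [abs_of_nonneg (sub_nonneg.2 (Real.exp_le_exp.2 huv)), abs_of_nonneg (sub_nonneg.2 huv)]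
  have h1 : Real.exp u - Real.exp v = Real.exp u * (1 - Real.exp (v - u)) := by
    rw [mul_sub, ← Real.exp_add]; ring_nf
  have h2 := Real.add_one_le_exp (v - u)
  have h3 := Real.exp_le_exp.2 hu
  rw [h1, mul_comm]
  exact mul_le_mul (by linarith) h3 (Real.exp_pos _).le (by linarith)

variable {a κ κ' x X : ℝ}

theorem neg_mul_le_of_abs_le (hκ : |κ| ≤ a) (hx : 0 ≤ x) (hxX : x ≤ X) : -κ * x ≤ a * X :=
  mul_le_mul ((neg_le_abs κ).trans hκ) hxX hx ((abs_nonneg κ).trans hκ)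

theorem abs_exp_mul_sub_le (hκ : |κ| ≤ a) (hκ' : |κ'| ≤ a) (hx : 0 ≤ x) (hxX : x ≤ X) :
    |Real.exp (-κ * x) - Real.exp (-κ' * x)| ≤ |κ - κ'| * (X * Real.exp (a * X)) := by
  refine (abs_exp_sub_exp_le (neg_mul_le_of_abs_le hκ hx hxX)
    (neg_mul_le_of_abs_le hκ' hx hxX)).trans ?_
  rw [← mul_assoc, show -κ * x - -κ' * x = -((κ - κ') * x) by ring, abs_neg, abs_mul,
    abs_of_nonneg hx]
  gcongr

theorem abs_expKer_le (hκ : |κ| ≤ a) (hx : 0 ≤ x) (hxX : x ≤ X) :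
    |expKer κ x| ≤ X * Real.exp (a * X) := by
  have h : ‖expKer κ x‖ ≤ Real.exp (a * X) * |x - 0| := by
    refine intervalIntegral.norm_integral_le_of_norm_le_const fun v hv => ?_
    rw [uIoc_of_le hx] at hv
    rw [Real.norm_eq_abs, abs_of_pos (Real.exp_pos _)]
    exact Real.exp_le_exp.2 (neg_mul_le_of_abs_le hκ hv.1.le (hv.2.trans hxX))
  rw [Real.norm_eq_abs, sub_zero, abs_of_nonneg hx] at h
  refine h.trans ?_
  rw [mul_comm]; gcongr

theorem abs_expKer_sub_le (hκ : |κ| ≤ a) (hκ' : |κ'| ≤ a) (hx : 0 ≤ x) (hxX : x ≤ X) :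
    |expKer κ x - expKer κ' x| ≤ |κ - κ'| * (X ^ 2 * Real.exp (a * X)) := by
  have hi : ∀ κ, IntervalIntegrable (fun v => Real.exp (-κ * v)) volume 0 x := fun κ =>
    Continuous.intervalIntegrable (by fun_prop) _ _
  have h : ‖expKer κ x - expKer κ' x‖ ≤ (|κ - κ'| * (X * Real.exp (a * X))) * |x - 0| := by
    rw [expKer, expKer, ← intervalIntegral.integral_sub (hi κ) (hi κ')]
    refine intervalIntegral.norm_integral_le_of_norm_le_const fun v hv => ?_
    rw [uIoc_of_le hx] at hv
    exact abs_exp_mul_sub_le hκ hκ' hv.1.le (hv.2.trans hxX)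
  rw [Real.norm_eq_abs, sub_zero, abs_of_nonneg hx] at h
  refine h.trans ?_
  have hX : 0 ≤ X := hx.trans hxX
  calc |κ - κ'| * (X * Real.exp (a * X)) * x ≤ |κ - κ'| * (X * Real.exp (a * X)) * X := by gcongr
    _ = _ := by ring

end Kernel

/-! ### Change of time by the primitive of a weight. -/

section Weight

variable {w : ℝ → ℝ}

/-- The primitive of a weight that vanishes at `0`. -/
def primitive (w : ℝ → ℝ) (t : ℝ) : ℝ := ∫ u in (0 : ℝ)..t, w u

@[simp] theorem primitive_zero (w : ℝ → ℝ) : primitive w 0 = 0 := by simp [primitive]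

theorem hasDerivAt_primitive (hw : Continuous w) (t : ℝ) : HasDerivAt (primitive w) (w t) t :=
  (hw.integral_hasStrictDerivAt 0 t).hasDerivAt

theorem continuous_primitive (hw : Continuous w) : Continuous (primitive w) :=
  continuous_iff_continuousAt.2 fun x => (hasDerivAt_primitive hw x).continuousAt

theorem integral_eq_primitive_sub (hw : Continuous w) (s t : ℝ) :
    ∫ u in s..t, w u = primitive w t - primitive w s :=
  (intervalIntegral.integral_interval_sub_left (hw.intervalIntegrable _ _)
    (hw.intervalIntegrable _ _)).symm

theorem primitive_mono (hw : Continuous w) (hw0 : ∀ u, 0 ≤ w u) : Monotone (primitive w) :=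
  monotone_of_hasDerivAt_nonneg (hasDerivAt_primitive hw) hw0

theorem integral_exp_mul_weight (hw : Continuous w) (κ s t : ℝ) :
    ∫ u in s..t, Real.exp (-κ * (primitive w t - primitive w u)) * w u
      = expKer κ (primitive w t - primitive w s) := by
  have hd : ∀ u, HasDerivAt (fun u => -expKer κ (primitive w t - primitive w u))
      (Real.exp (-κ * (primitive w t - primitive w u)) * w u) u := fun u => by
    have := ((hasDerivAt_expKer κ (primitive w t - primitive w u)).comp u
      ((hasDerivAt_primitive hw u).const_sub (primitive w t))).neg
    refine this.congr_deriv ?_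
    ring
  have hc := continuous_primitive hw
  rw [intervalIntegral.integral_eq_sub_of_hasDerivAt (fun u _ => hd u)
    (Continuous.intervalIntegrable (by fun_prop) _ _)]
  simp

/-- The factorisation behind the trading rates: up to the factor e^{-κW_s}, the kernel E_κ(W_t -
W_s) is the integral over [s, t] of a function of the integration variable alone, so t enters only
as an endpoint. -/
theorem integral_weight_mul_exp (hw : Continuous w) (κ s t : ℝ) :
    ∫ u in s..t, w u * Real.exp (-κ * primitive w u)
      = Real.exp (-κ * primitive w s) * expKer κ (primitive w t - primitive w s) := by
  have hd : ∀ u, HasDerivAt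
      (fun u => Real.exp (-κ * primitive w s) * expKer κ (primitive w u - primitive w s))
      (w u * Real.exp (-κ * primitive w u)) u := fun u => by
    have := ((hasDerivAt_expKer κ (primitive w u - primitive w s)).comp u
      ((hasDerivAt_primitive hw u).sub_const (primitive w s))).const_mul
      (Real.exp (-κ * primitive w s))
    refine this.congr_deriv ?_
    rw [← mul_assoc, ← Real.exp_add]
    ring_nf
  have hc := continuous_primitive hw
  rw [intervalIntegral.integral_eq_sub_of_hasDerivAt (fun u _ => hd u)
    (Continuous.intervalIntegrable (by fun_prop) _ _)]
  simp

end Weight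

/-! ### Lipschitz dependence of coefficients on the perturbation. -/

section Lip

/-- A coefficient `q` that depends on a small parameter `ε` is bounded by `K` and differs from
its limit `q₀` by at most `K ε`. -/
structure Lip (ε K q q₀ : ℝ) : Prop where
  nonneg : 0 ≤ K
  bound : |q₀| ≤ K
  diff : |q - q₀| ≤ K * ε

namespace Lip

variable {a ε K L q q₀ r r₀ : ℝ}

theorem const (hε : 0 ≤ ε) (hq : |q| ≤ K) : Lip ε K q q :=
  ⟨(abs_nonneg q).trans hq, hq, by
    simpa using mul_nonneg ((abs_nonneg q).trans hq) hε⟩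

theorem abs_le (h : Lip ε K q q₀) (hεa : ε ≤ a) : |q| ≤ K * (1 + a) := by
  have h1 : |q| ≤ |q - q₀| + |q₀| := by simpa using abs_add_le (q - q₀) q₀
  nlinarith [h.1, h.2, h.3, mul_le_mul_of_nonneg_left hεa h.1]

/-- The constant adds 1 + a, from the size of the perturbed factor q, and 1, from that of the limit
r₀. -/
theorem mul (h : Lip ε K q q₀) (h' : Lip ε L r r₀) (hε : 0 ≤ ε) (hεa : ε ≤ a) :
    Lip ε (K * L * (2 + a)) (q * r) (q₀ * r₀) := by
  have hKL := mul_nonneg h.1 h'.1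
  have ha := hε.trans hεa
  refine ⟨by positivity, ?_, ?_⟩
  · rw [abs_mul]
    calc |q₀| * |r₀| ≤ K * L := mul_le_mul h.2 h'.2 (abs_nonneg _) h.1
      _ ≤ K * L * (2 + a) := le_mul_of_one_le_right hKL (by linarith)
  · have e : q * r - q₀ * r₀ = q * (r - r₀) + (q - q₀) * r₀ := by ring
    rw [e]
    refine (abs_add_le _ _).trans ?_
    rw [abs_mul, abs_mul]
    calc |q| * |r - r₀| + |q - q₀| * |r₀| ≤ K * (1 + a) * (L * ε) + K * ε * L :=
          add_le_add (mul_le_mul (h.abs_le hεa) h'.3 (abs_nonneg _)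
            (mul_nonneg h.1 (by linarith)))
            (mul_le_mul h.3 h'.2 (abs_nonneg _) (mul_nonneg h.1 hε))
      _ = _ := by ring

theorem add (h : Lip ε K q q₀) (h' : Lip ε L r r₀) : Lip ε (K + L) (q + r) (q₀ + r₀) := by
  refine ⟨add_nonneg h.1 h'.1, (abs_add_le _ _).trans (add_le_add h.2 h'.2), ?_⟩
  rw [show q + r - (q₀ + r₀) = (q - q₀) + (r - r₀) by ring, add_mul]
  exact (abs_add_le _ _).trans (add_le_add h.3 h'.3)

/-- The difference of the reciprocals is (q₀ - q)/(q q₀) with a denominator at least 1; the added 1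
bounds the limit itself. -/
theorem inv (h : Lip ε K q q₀) (hε : 0 ≤ ε) (hq : 1 ≤ q) (hq₀ : 1 ≤ q₀) : Lip ε (1 + K) q⁻¹ q₀⁻¹ := by
  have h1 : q⁻¹ ≤ 1 := inv_le_one_of_one_le₀ hq
  have h2 : q₀⁻¹ ≤ 1 := inv_le_one_of_one_le₀ hq₀
  have h1' : 0 ≤ q⁻¹ := by positivity
  have h2' : 0 ≤ q₀⁻¹ := by positivity
  refine ⟨by linarith [h.1], ?_, ?_⟩
  · rw [abs_of_nonneg h2']; linarith [h.1]
  · have e : q⁻¹ - q₀⁻¹ = -(q - q₀) * (q⁻¹ * q₀⁻¹) := by field_simp; ring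
    rw [e, abs_mul, abs_neg, abs_of_nonneg (mul_nonneg h1' h2')]
    have h3 : q⁻¹ * q₀⁻¹ ≤ 1 := mul_le_one₀ h1 h2' h2
    have h4 : |q - q₀| * (q⁻¹ * q₀⁻¹) ≤ K * ε :=
      (mul_le_of_le_one_right (abs_nonneg _) h3).trans h.3
    linarith

end Lip

variable {a κ₀ ε x X : ℝ}

/-- Sizes and differences of the exponential and of its primitive need the factors 1, X and X² in
front of e^{aX}; their sum serves all cases. -/
theorem lip_exp (hκ₀ : |κ₀| ≤ a) (hκ : |κ₀ - ε| ≤ a) (hε : 0 ≤ ε) (hx : 0 ≤ x) (hxX : x ≤ X) :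
    Lip ε ((1 + X + X ^ 2) * Real.exp (a * X)) (Real.exp (-(κ₀ - ε) * x)) (Real.exp (-κ₀ * x)) := by
  have hX := hx.trans hxX
  have hE := Real.exp_pos (a * X)
  refine ⟨by positivity, ?_, (abs_exp_mul_sub_le hκ hκ₀ hx hxX).trans ?_⟩
  · rw [abs_of_pos (Real.exp_pos _)]
    refine (Real.exp_le_exp.2 (neg_mul_le_of_abs_le hκ₀ hx hxX)).trans ?_
    exact le_mul_of_one_le_left hE.le (by nlinarith)
  · rw [sub_sub_cancel_left, abs_neg, abs_of_nonneg hε, mul_comm]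
    gcongr
    nlinarith

theorem lip_expKer (hκ₀ : |κ₀| ≤ a) (hκ : |κ₀ - ε| ≤ a) (hε : 0 ≤ ε) (hx : 0 ≤ x) (hxX : x ≤ X) :
    Lip ε ((1 + X + X ^ 2) * Real.exp (a * X)) (expKer (κ₀ - ε) x) (expKer κ₀ x) := by
  have hX := hx.trans hxX
  have hE := Real.exp_pos (a * X)
  refine ⟨by positivity, (abs_expKer_le hκ₀ hx hxX).trans ?_,
    (abs_expKer_sub_le hκ hκ₀ hx hxX).trans ?_⟩
  · gcongr; nlinarith
  · rw [sub_sub_cancel_left, abs_neg, abs_of_nonneg hε, mul_comm]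
    gcongr
    nlinarith

/-- The Lipschitz estimate for the reciprocals `1 / (1 + (ε + θ) Δ)`. -/
theorem Lip.inv_one_add_mul {θ K Δ Δ₀ : ℝ} (h : Lip ε K Δ Δ₀) (hε : 0 ≤ ε) (hεa : ε ≤ a)
    (hθ : 0 ≤ θ) (hΔ : 0 ≤ Δ) (hΔ₀ : 0 ≤ Δ₀) :
    Lip ε (1 + (1 + (1 + θ) * K * (2 + a))) (1 + (ε + θ) * Δ)⁻¹ (1 + θ * Δ₀)⁻¹ := by
  have h1 : Lip ε (1 + θ) (ε + θ) θ := by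
    refine ⟨by linarith, ?_, ?_⟩
    · rw [abs_of_nonneg hθ]; linarith
    · rw [add_sub_cancel_right, abs_of_nonneg hε]; nlinarith
  have h2 : Lip ε 1 1 1 := Lip.const hε (by simp)
  refine (h2.add (h1.mul h hε hεa)).inv hε ?_ ?_
  · have := mul_nonneg (add_nonneg hε hθ) hΔ; linarith
  · have := mul_nonneg hθ hΔ₀; linarith

end Lip

/-! ### Random variables close to their mean-field limits. -/

section Pair

/-- A random variable `Z` that depends on the game with finitely many players, together with its
mean-field limit `Z₀`: the limit is bounded by `K r` and the difference by `K δ`, in `L²`. -/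
structure LipPair {Ω : Type u} {mΩ : MeasurableSpace Ω} (μ : Measure Ω) (r δ K : ℝ)
    (Z Z₀ : Ω → ℝ) : Prop where
  nonneg : 0 ≤ K
  bound : L2Bound μ Z₀ (K * r)
  diff : L2Bound μ (Z - Z₀) (K * δ)

namespace LipPair

variable {Ω : Type u} {mΩ : MeasurableSpace Ω} {μ : Measure Ω} {a ε r δ K L : ℝ}
  {Z Z₀ Y Y₀ : Ω → ℝ}

theorem of_l2Bound (h : L2Bound μ Z r) (hδ : 0 ≤ δ) : LipPair μ r δ 1 Z Z :=
  ⟨zero_le_one, by simpa using h, by simpa using L2Bound.zero.mono hδ⟩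

theorem add (h : LipPair μ r δ K Z Z₀) (h' : LipPair μ r δ L Y Y₀) :
    LipPair μ r δ (K + L) (Z + Y) (Z₀ + Y₀) := by
  refine ⟨add_nonneg h.1 h'.1, ?_, ?_⟩
  · rw [add_mul]; exact h.2.add h'.2
  · rw [add_mul, add_sub_add_comm]; exact h.3.add h'.3

theorem neg (h : LipPair μ r δ K Z Z₀) : LipPair μ r δ K (-Z) (-Z₀) := by
  refine ⟨h.1, h.2.neg, ?_⟩
  rw [neg_sub_neg, ← neg_sub]; exact h.3.neg

theorem sub (h : LipPair μ r δ K Z Z₀) (h' : LipPair μ r δ L Y Y₀) :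
    LipPair μ r δ (K + L) (Z - Y) (Z₀ - Y₀) := by
  rw [sub_eq_add_neg, sub_eq_add_neg]; exact h.add h'.neg

/-- In qZ - q₀Z₀ = q(Z - Z₀) + (q - q₀)Z₀ the second term is of order ε r, which `hδ` absorbs into
the error scale δ. -/
theorem smul (h : LipPair μ r δ K Z Z₀) {q q₀ : ℝ} (hq : Lip ε L q q₀) (hε : 0 ≤ ε) (hεa : ε ≤ a)
    (hr : 0 ≤ r) (hδ : ε * r ≤ δ) : LipPair μ r δ (L * K * (2 + a)) (q • Z) (q₀ • Z₀) := by
  have hLK := mul_nonneg hq.1 h.1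
  have ha := hε.trans hεa
  refine ⟨by positivity, (h.2.smul_le hq.2).mono ?_, ?_⟩
  · rw [← mul_assoc]
    exact mul_le_mul_of_nonneg_right (le_mul_of_one_le_right hLK (by linarith)) hr
  · have e : q • Z - q₀ • Z₀ = q • (Z - Z₀) + (q - q₀) • Z₀ := by
      rw [smul_sub, sub_smul]; abel
    rw [e]
    refine ((h.3.smul_le (hq.abs_le hεa)).add (h.2.smul_le hq.3)).mono ?_
    have := mul_le_mul_of_nonneg_left hδ hLK
    nlinarith

theorem condExp [IsFiniteMeasure μ] (h : LipPair μ r δ K Z Z₀) (hZ : MemLp Z 2 μ)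
    (m : MeasurableSpace Ω) : LipPair μ r δ K (μ[Z | m]) (μ[Z₀ | m]) :=
  ⟨h.1, h.2.condExp m, (h.3.condExp m).congr
    (condExp_sub (hZ.integrable (by norm_num)) h.2.integrable m)⟩

theorem timeIntegral [IsFiniteMeasure μ] {Z Z₀ : ℝ → Ω → ℝ} {t T : ℝ} (ht : t ∈ Icc 0 T)
    (hZm : Measurable (Function.uncurry Z)) (hZ₀m : Measurable (Function.uncurry Z₀))
    (hr : 0 ≤ r) (hδ : 0 ≤ δ) (h : ∀ u ∈ Icc 0 t, LipPair μ r δ K (Z u) (Z₀ u)) :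
    LipPair μ r δ (T * K) (fun ω => ∫ u in (0 : ℝ)..t, Z u ω) (fun ω => ∫ u in (0 : ℝ)..t, Z₀ u ω) := by
  have hK := (h 0 ⟨le_rfl, ht.1⟩).1
  have hT := ht.1.trans ht.2
  refine ⟨mul_nonneg hT hK, (L2Bound.timeIntegral hZ₀m ht.1 fun u hu => (h u hu).2).mono ?_, ?_⟩
  · rw [sub_zero, ← mul_assoc]
    have := ht.2
    gcongr
  · have h1 := L2Bound.timeIntegral (hZm.sub hZ₀m) ht.1 fun u hu => (h u hu).3
    refine (h1.congr ?_).mono ?_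
    · have hZb : ∀ u ∈ Icc 0 t, L2Bound μ (Z u) (K * δ + K * r) := fun u hu => by
        simpa using (h u hu).3.add (h u hu).2
      filter_upwards [ae_intervalIntegrable_path hZm ht.1 hZb,
        ae_intervalIntegrable_path hZ₀m ht.1 fun u hu => (h u hu).2] with ω h2 h3
      exact intervalIntegral.integral_sub h2 h3
    · rw [sub_zero, ← mul_assoc]
      have := ht.2
      gcongr

/-- The stochastic counterpart of multiplication by a coefficient: the integrand plays the
coefficient and the integrator at time t the random variable. -/
theorem stochInt [IsFiniteMeasure μ] {T t : ℝ} {F : Filtration ℝ mΩ} {M M₀ : ℝ → Ω → ℝ}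
    {f f₀ : ℝ → ℝ} (hM : IsSqMartingale T F μ M) (hM₀ : IsSqMartingale T F μ M₀)
    (ht : t ∈ Icc 0 T) (hZ : HasStochInt μ f M t Z) (hZ₀ : HasStochInt μ f₀ M₀ t Z₀)
    (hf : ∀ s ∈ Icc 0 t, Lip ε L (f s) (f₀ s)) (h : LipPair μ r δ K (M t) (M₀ t))
    (hε : 0 ≤ ε) (hεa : ε ≤ a) (hr : 0 ≤ r) (hδ : ε * r ≤ δ) :
    LipPair μ r δ (L * K * (2 + a)) Z Z₀ := by
  have hL := (hf 0 ⟨le_rfl, ht.1⟩).1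
  have hLK := mul_nonneg hL h.1
  have ha := hε.trans hεa
  refine ⟨by positivity, (hZ₀.l2Bound hM₀ ht hL (fun s hs => (hf s hs).2) h.2).mono ?_, ?_⟩
  · rw [← mul_assoc]
    exact mul_le_mul_of_nonneg_right (le_mul_of_one_le_right hLK (by linarith)) hr
  · refine (HasStochInt.l2Bound_sub hM hM₀ ht hZ hZ₀ (K := L * (1 + a)) (L := L * ε)
      (by positivity) (fun s hs => (hf s hs).abs_le hεa) (by positivity)
      (fun s hs => (hf s hs).3) h.3 h.2).mono ?_
    have := mul_le_mul_of_nonneg_left hδ hLK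
    nlinarith

end LipPair

end Pair

/-! ### Kernel integrals as time integrals. -/

section KernelProcess

variable {Ω : Type u} {mΩ : MeasurableSpace Ω} {μ : Measure Ω} [IsFiniteMeasure μ] {T : ℝ}
  {F : Filtration ℝ mΩ} {M : ℝ → Ω → ℝ} {w : ℝ → ℝ}

/-- Stochastic integrals of the kernels of the games, as time integrals of a jointly measurable
process. -/
theorem IsSqMartingale.exists_kernel_process (hT : 0 ≤ T) (hM : IsSqMartingale T F μ M)
    (hw : Continuous w) (hw0 : ∀ u, 0 ≤ w u) (κ ρ : ℝ) {θ : ℝ} (hθ : 0 ≤ θ) :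
    ∃ L : ℝ → Ω → ℝ, Measurable (Function.uncurry L) ∧
      (∀ t ∈ Icc 0 T, HasStochInt μ (fun s => ρ * Real.exp (κ * primitive w s)
        * (1 + θ * expKer κ (primitive w T - primitive w s))⁻¹) M t (L t)) ∧
      (∀ t ∈ Icc 0 T, AEStronglyMeasurable[F t] (L t) μ) ∧
      ∀ t ∈ Icc 0 T, HasStochInt μ (fun s => ρ * expKer κ (primitive w t - primitive w s)
        * (1 + θ * expKer κ (primitive w T - primitive w s))⁻¹) M t
          (fun ω => ∫ u in (0 : ℝ)..t, w u * Real.exp (-κ * primitive w u) * L u ω) := by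
  have hWc := continuous_primitive hw
  have hKc := continuous_expKer κ
  have hpos : ∀ s ∈ Icc 0 T, 1 + θ * expKer κ (primitive w T - primitive w s) ≠ 0 := fun s hs => by
    have := mul_nonneg hθ (expKer_nonneg κ (sub_nonneg.2 (primitive_mono hw hw0 hs.2)))
    linarith
  have hd : ∀ s ∈ Icc 0 T, HasDerivAt (fun s => ρ * Real.exp (κ * primitive w s)
      * (1 + θ * expKer κ (primitive w T - primitive w s))⁻¹)
      (ρ * (Real.exp (κ * primitive w s) * (κ * w s))
          * (1 + θ * expKer κ (primitive w T - primitive w s))⁻¹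
        + ρ * Real.exp (κ * primitive w s)
          * (-(θ * (Real.exp (-κ * (primitive w T - primitive w s)) * -w s))
            / (1 + θ * expKer κ (primitive w T - primitive w s)) ^ 2)) s := fun s hs => by
    have hW := hasDerivAt_primitive hw s
    have h1 := ((hasDerivAt_expKer κ (primitive w T - primitive w s)).comp s
      (hW.const_sub (primitive w T))).const_mul θ |>.const_add 1
    exact ((hW.const_mul κ).exp.const_mul ρ).mul (h1.inv (hpos s hs))
  obtain ⟨L, hLm, hL, hLad, hLc⟩ := hM.exists_stochInt_process hT hd (by
    have h2 : Continuous fun s => 1 + θ * expKer κ (primitive w T - primitive w s) := by fun_prop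
    refine ContinuousOn.add (ContinuousOn.mul (by fun_prop) (h2.continuousOn.inv₀ hpos))
      (ContinuousOn.mul (by fun_prop) (ContinuousOn.div (by fun_prop) (by fun_prop) fun s hs => ?_))
    exact pow_ne_zero 2 (hpos s hs))
  refine ⟨L, hLm, hL, hLad, fun t ht => ?_⟩
  -- The factor e^{κW_s} in the integrand of `L` compensates e^{-κW_s} from the factorised kernel.
  refine (hLc (fun u => w u * Real.exp (-κ * primitive w u)) (by fun_prop) t ht).congr ht.1
    fun s hs => ?_
  rw [integral_weight_mul_exp hw]
  have : Real.exp (κ * primitive w s) * Real.exp (-κ * primitive w s) = 1 := by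
    rw [← Real.exp_add]; simp
  linear_combination (ρ * (1 + θ * expKer κ (primitive w T - primitive w s))⁻¹
    * expKer κ (primitive w t - primitive w s)) * this

end KernelProcess

/-! ### The kernels of the games in terms of the clocks. -/

namespace Coefficients

variable (p : Coefficients)

/-- The reciprocal `1 / (k α)` of a multiple of the liquidity function, extended to the real line. -/
def weight (k u : ℝ) : ℝ := (p.α (projIcc 0 p.T p.T_pos.le u) * k)⁻¹

theorem zero_mem : (0 : ℝ) ∈ Icc 0 p.T := ⟨le_rfl, p.T_pos.le⟩

theorem T_mem : p.T ∈ Icc 0 p.T := ⟨p.T_pos.le, le_rfl⟩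

theorem one_add_half_b_pos : 0 < 1 + p.b / 2 := by
  have := p.b_nonneg; positivity

variable {p} {k : ℝ}

theorem weight_of_mem {u : ℝ} (hu : u ∈ Icc 0 p.T) : p.weight k u = (p.α u * k)⁻¹ := by
  rw [weight, projIcc_of_mem _ hu]

theorem weight_pos (hk : 0 < k) (u : ℝ) : 0 < p.weight k u :=
  inv_pos.2 (mul_pos (p.α_pos _ (projIcc 0 p.T p.T_pos.le u).2) hk)

theorem continuous_weight (hk : 0 < k) : Continuous (p.weight k) := by
  have h1 : Continuous fun u => p.α (projIcc 0 p.T p.T_pos.le u) :=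
    (continuousOn_iff_continuous_domRestrict.1 p.α_cont).comp continuous_projIcc
  exact (h1.mul continuous_const).inv₀ fun u =>
    (mul_pos (p.α_pos _ (projIcc 0 p.T p.T_pos.le u).2) hk).ne'

theorem exists_weight_le (k : ℝ) (hk : 0 < k) : ∃ B, ∀ u, |p.weight k u| ≤ B := by
  obtain ⟨B, hB⟩ := isCompact_Icc.exists_bound_of_continuousOn
    ((continuous_weight (p := p) hk).continuousOn (s := Icc 0 p.T))
  refine ⟨B, fun u => ?_⟩
  have := hB _ (projIcc 0 p.T p.T_pos.le u).2
  rwa [weight, projIcc_val, ← weight] at this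

/-- One computation for both clocks: k = 1 + b/2 gives 1/β and k = 1 gives 1/α, and y leaves room
for the number of players. -/
theorem integral_div_mul_eq {s t x y c : ℝ} (hk : 0 < k) (hs : s ∈ Icc 0 p.T) (ht : t ∈ Icc 0 p.T)
    (hxy : ∀ u ∈ Icc 0 p.T, x / (y * (p.α u * k)) = c * (p.α u * k)⁻¹) :
    ∫ u in s..t, x / (y * (p.α u * k))
      = c * (primitive (p.weight k) t - primitive (p.weight k) s) := by
  rw [← integral_eq_primitive_sub (continuous_weight hk), ← intervalIntegral.integral_const_mul]
  refine intervalIntegral.integral_congr fun u hu => ?_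
  have hu' : u ∈ Icc 0 p.T := uIcc_subset_Icc hs ht hu
  rw [weight_of_mem hu', hxy u hu']

theorem integral_div_eq_expKer {s t κ : ℝ} {f g : ℝ → ℝ} (hk : 0 < k) (hs : s ∈ Icc 0 p.T)
    (ht : t ∈ Icc 0 p.T) (hg : ∀ u ∈ Icc 0 p.T, g u = p.α u * k)
    (hf : ∀ u ∈ Icc 0 p.T,
      f u = Real.exp (-κ * (primitive (p.weight k) t - primitive (p.weight k) u))) :
    ∫ u in s..t, f u / g u
      = expKer κ (primitive (p.weight k) t - primitive (p.weight k) s) := by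
  rw [← integral_exp_mul_weight (continuous_weight hk)]
  refine intervalIntegral.integral_congr fun u hu => ?_
  have hu' : u ∈ Icc 0 p.T := uIcc_subset_Icc hs ht hu
  rw [weight_of_mem hu', hf u hu', hg u hu', div_eq_mul_inv]

/-- The primitive of `1 / β`. -/
def clock (p : Coefficients) (t : ℝ) : ℝ := primitive (p.weight (1 + p.b / 2)) t

/-- The primitive of `1 / α`. -/
def clockTilde (p : Coefficients) (t : ℝ) : ℝ := primitive (p.weight 1) t

variable {N : ℕ} {s t : ℝ}

theorem etaN_eq (hN : 1 ≤ N) (hs : s ∈ Icc 0 p.T) (ht : t ∈ Icc 0 p.T) :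
    p.etaN N s t = Real.exp (-(p.a - p.a / N) * (p.clock t - p.clock s)) := by
  have hN' : (N : ℝ) ≠ 0 := by positivity
  rw [etaN]
  simp only [effCost]
  rw [integral_div_mul_eq (c := p.a - p.a / N) p.one_add_half_b_pos hs ht fun u hu => ?_,
    neg_mul]
  · rfl
  · have h1 := (p.α_pos u hu).ne'
    have h2 := p.one_add_half_b_pos.ne'
    field_simp

theorem DeltaN_eq (hN : 1 ≤ N) (hs : s ∈ Icc 0 p.T) (ht : t ∈ Icc 0 p.T) :
    p.DeltaN N s t = expKer (p.a - p.a / N) (p.clock t - p.clock s) :=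
  integral_div_eq_expKer p.one_add_half_b_pos hs ht (fun _ _ => rfl) fun _ hu => etaN_eq hN hu ht

theorem eta_eq (hs : s ∈ Icc 0 p.T) (ht : t ∈ Icc 0 p.T) :
    p.eta s t = Real.exp (-p.a * (p.clock t - p.clock s)) := by
  rw [eta]
  have h := integral_div_mul_eq (p := p) (x := p.a) (y := 1) (c := p.a) p.one_add_half_b_pos hs ht
    fun u hu => by rw [one_mul, div_eq_mul_inv]
  simp only [one_mul] at h
  simp only [effCost]
  rw [h, neg_mul]; rfl

theorem Delta_eq (hs : s ∈ Icc 0 p.T) (ht : t ∈ Icc 0 p.T) :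
    p.Delta s t = expKer p.a (p.clock t - p.clock s) :=
  integral_div_eq_expKer p.one_add_half_b_pos hs ht (fun _ _ => rfl) fun _ hu => eta_eq hu ht

/-- The exponent grows here, so the rate is negative; it is kept as 0 - a/N to fit the pattern κ₀ -
ε of the perturbation estimates. -/
theorem etaTildeN_eq (hN : 1 ≤ N) (hs : s ∈ Icc 0 p.T) (ht : t ∈ Icc 0 p.T) :
    p.etaTildeN N s t = Real.exp (-(0 - p.a / N) * (p.clockTilde t - p.clockTilde s)) := by
  have hN' : (N : ℝ) ≠ 0 := by positivity
  have h := integral_div_mul_eq (p := p) (x := p.a) (y := N) (c := p.a / N) one_pos hs ht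
    fun u hu => by
      have h1 := (p.α_pos u hu).ne'
      field_simp
  simp only [mul_one] at h
  rw [etaTildeN, h]
  congr 1
  simp [clockTilde]

theorem DeltaTildeN_eq (hN : 1 ≤ N) (hs : s ∈ Icc 0 p.T) (ht : t ∈ Icc 0 p.T) :
    p.DeltaTildeN N s t = expKer (0 - p.a / N) (p.clockTilde t - p.clockTilde s) :=
  integral_div_eq_expKer one_pos hs ht (fun _ _ => (mul_one _).symm)
    fun _ hu => etaTildeN_eq hN hu ht

theorem DeltaTilde_eq (hs : s ∈ Icc 0 p.T) (ht : t ∈ Icc 0 p.T) :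
    p.DeltaTilde s t = expKer 0 (p.clockTilde t - p.clockTilde s) :=
  integral_div_eq_expKer one_pos hs ht (fun _ _ => (mul_one _).symm) fun _ _ => by simp

theorem clock_mono (p : Coefficients) : Monotone p.clock :=
  primitive_mono (continuous_weight p.one_add_half_b_pos)
    fun u => (weight_pos p.one_add_half_b_pos u).le

theorem clockTilde_mono (p : Coefficients) : Monotone p.clockTilde :=
  primitive_mono (continuous_weight one_pos) fun u => (weight_pos one_pos u).le

theorem continuous_clock (p : Coefficients) : Continuous p.clock :=
  continuous_primitive (continuous_weight p.one_add_half_b_pos)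

@[simp] theorem clock_zero (p : Coefficients) : p.clock 0 = 0 := primitive_zero _

end Coefficients

/-! ### The price and its weighted time integrals. -/

namespace Market

section Data

variable {Ω : Type u} [mΩ : MeasurableSpace Ω] {m : Market Ω} {p : Coefficients} {μ : Measure Ω}

/-- The fundamental price, frozen outside `[0,T]`. -/
def frozenPrice (m : Market Ω) (p : Coefficients) (t : ℝ) (ω : Ω) : ℝ :=
  m.S (projIcc 0 p.T p.T_pos.le t) ω

theorem frozenPrice_of_mem {t : ℝ} (ht : t ∈ Icc 0 p.T) : m.frozenPrice p t = m.S t := by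
  funext ω
  rw [frozenPrice, projIcc_of_mem _ ht]

/-- The weighted time integral `∫_0^t e^{-κ ∫_s^t du/β(u)} S_s ds / β(s)` of the price. -/
def integratedPrice (m : Market Ω) (p : Coefficients) (κ t : ℝ) (ω : Ω) : ℝ :=
  ∫ s in (0 : ℝ)..t, (Real.exp (-κ * (p.clock t - p.clock s)) * p.weight (1 + p.b / 2) s)
    * m.frozenPrice p s ω

theorem IN_eq {N : ℕ} (hN : 1 ≤ N) {t : ℝ} (ht : t ∈ Icc 0 p.T) :
    m.IN p N t = m.integratedPrice p (p.a - p.a / N) t := by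
  funext ω
  refine intervalIntegral.integral_congr fun s hs => ?_
  have hs' : s ∈ Icc 0 p.T := uIcc_subset_Icc p.zero_mem ht hs
  rw [Coefficients.etaN_eq hN hs' ht, frozenPrice_of_mem hs', Coefficients.weight_of_mem hs',
    div_eq_mul_inv, Coefficients.effCost]

theorem I_eq {t : ℝ} (ht : t ∈ Icc 0 p.T) : m.I p t = m.integratedPrice p p.a t := by
  funext ω
  refine intervalIntegral.integral_congr fun s hs => ?_
  have hs' : s ∈ Icc 0 p.T := uIcc_subset_Icc p.zero_mem ht hs
  rw [Coefficients.eta_eq hs' ht, frozenPrice_of_mem hs', Coefficients.weight_of_mem hs',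
    div_eq_mul_inv, Coefficients.effCost]

/-- Factoring out e^{-κW_t} leaves a primitive of a jointly measurable process, from which joint
measurability in (t, ω) follows. -/
theorem integratedPrice_eq (κ t : ℝ) (ω : Ω) : m.integratedPrice p κ t ω
    = Real.exp (-κ * p.clock t) * ∫ s in (0 : ℝ)..t,
      (p.weight (1 + p.b / 2) s * Real.exp (κ * p.clock s)) * m.frozenPrice p s ω := by
  rw [integratedPrice, ← intervalIntegral.integral_const_mul]
  refine intervalIntegral.integral_congr fun s _ => ?_
  rw [mul_sub, Real.exp_sub, neg_mul, neg_mul, Real.exp_neg (κ * p.clock s), div_inv_eq_mul]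
  ring

/-- The `L²` norm of the supremum of the price. -/
def priceBound (m : Market Ω) (p : Coefficients) (μ : Measure Ω) : ℝ :=
  √(momentOfSup p.T μ m.S).toReal

namespace Assumption

theorem measurable_frozenPrice (h : m.Assumption p μ) :
    Measurable (Function.uncurry (m.frozenPrice p)) :=
  h.S_measurable.comp (((continuous_projIcc (h := p.T_pos.le)).measurable.comp measurable_fst).prodMk measurable_snd)

theorem aesm_price (h : m.Assumption p μ) {s t : ℝ} (hs : s ∈ Icc 0 p.T) (hst : s ≤ t) :
    AEStronglyMeasurable[m.F0 t] (m.frozenPrice p s) μ := by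
  rw [frozenPrice_of_mem hs]
  exact ((h.S_adapted ⟨s, hs⟩).mono (m.F0.mono hst)).aestronglyMeasurable

theorem ofReal_priceBound_sq (h : m.Assumption p μ) :
    ENNReal.ofReal (m.priceBound p μ ^ 2) = momentOfSup p.T μ m.S := by
  rw [priceBound, Real.sq_sqrt ENNReal.toReal_nonneg, ENNReal.ofReal_toReal h.S_sup.ne]

theorem l2Bound_price (h : m.Assumption p μ) (t : ℝ) :
    L2Bound μ (m.frozenPrice p t) (m.priceBound p μ) := by
  refine L2Bound.of_secondMoment_le ?_ (Real.sqrt_nonneg _) ?_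
  · exact (h.measurable_frozenPrice.comp (measurable_const.prodMk measurable_id)).aestronglyMeasurable
  · rw [h.ofReal_priceBound_sq]
    refine lintegral_mono fun ω => ?_
    exact le_iSup₂_of_le (f := fun t (_ : t ∈ Icc 0 p.T) => ENNReal.ofReal (m.S t ω ^ 2))
      (projIcc 0 p.T p.T_pos.le t : ℝ) (projIcc 0 p.T p.T_pos.le t).2 le_rfl

theorem measurable_integrand (h : m.Assumption p μ) {f : ℝ → ℝ} (hf : Continuous f) :
    Measurable (Function.uncurry fun s ω => f s * m.frozenPrice p s ω) :=
  (hf.measurable.comp measurable_fst).mul h.measurable_frozenPrice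

theorem measurable_integratedPrice (h : m.Assumption p μ) (κ : ℝ) :
    Measurable (Function.uncurry (m.integratedPrice p κ)) := by
  have hw := Coefficients.continuous_weight (p := p) p.one_add_half_b_pos
  have hc := p.continuous_clock
  have h1 : (Function.uncurry (m.integratedPrice p κ)) = fun q : ℝ × Ω =>
      Real.exp (-κ * p.clock q.1) * ∫ s in (0 : ℝ)..q.1,
      (p.weight (1 + p.b / 2) s * Real.exp (κ * p.clock s)) * m.frozenPrice p s q.2 := by
    funext q
    exact integratedPrice_eq κ q.1 q.2
  rw [h1]
  refine Measurable.mul ?_ (measurable_primitive (h.measurable_integrand (by fun_prop)) 0)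
  have : Continuous fun t => Real.exp (-κ * p.clock t) := by fun_prop
  exact this.measurable.comp measurable_fst

variable [IsFiniteMeasure μ]

theorem exists_l2Bound_integratedPrice (h : m.Assumption p μ) (κ : ℝ) :
    ∃ K, ∀ t ∈ Icc 0 p.T, L2Bound μ (m.integratedPrice p κ t) K := by
  have hw := Coefficients.continuous_weight (p := p) p.one_add_half_b_pos
  have hc := p.continuous_clock
  have hf : Continuous fun s => p.weight (1 + p.b / 2) s * Real.exp (κ * p.clock s) := by fun_prop
  have he : Continuous fun t => Real.exp (-κ * p.clock t) := by fun_prop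
  obtain ⟨D, hD⟩ := isCompact_Icc.exists_bound_of_continuousOn (hf.continuousOn (s := Icc 0 p.T))
  obtain ⟨E, hE⟩ := isCompact_Icc.exists_bound_of_continuousOn (he.continuousOn (s := Icc 0 p.T))
  have hD0 : 0 ≤ D := (norm_nonneg _).trans (hD 0 p.zero_mem)
  have hE0 : 0 ≤ E := (norm_nonneg _).trans (hE 0 p.zero_mem)
  have hs : 0 ≤ m.priceBound p μ := Real.sqrt_nonneg _
  refine ⟨E * (p.T * (D * m.priceBound p μ)), fun t ht => ?_⟩
  have h1 := L2Bound.timeIntegral (h.measurable_integrand hf) ht.1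
    fun u hu => (h.l2Bound_price u).smul_le (hD u ⟨hu.1, hu.2.trans ht.2⟩)
  have e : m.integratedPrice p κ t = Real.exp (-κ * p.clock t) • fun ω => ∫ s in (0 : ℝ)..t,
      (p.weight (1 + p.b / 2) s * Real.exp (κ * p.clock s)) * m.frozenPrice p s ω :=
    funext fun ω => integratedPrice_eq κ t ω
  rw [e]
  refine (h1.smul_le (hE t ht)).mono ?_
  have := ht.2
  rw [sub_zero]
  gcongr

theorem memLp_integratedPrice (h : m.Assumption p μ) (κ : ℝ) {t : ℝ} (ht : t ∈ Icc 0 p.T) :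
    MemLp (m.integratedPrice p κ t) 2 μ := by
  obtain ⟨K, hK⟩ := h.exists_l2Bound_integratedPrice κ
  exact (hK t ht).memLp

theorem aesm_integratedPrice (h : m.Assumption p μ) (κ : ℝ) {t : ℝ} (ht : t ∈ Icc 0 p.T) :
    AEStronglyMeasurable[m.F0 t] (m.integratedPrice p κ t) μ := by
  have hw := Coefficients.continuous_weight (p := p) p.one_add_half_b_pos
  have hc := p.continuous_clock
  have hf : Continuous fun s => Real.exp (-κ * (p.clock t - p.clock s)) * p.weight (1 + p.b / 2) s := by
    fun_prop
  obtain ⟨D, hD⟩ := isCompact_Icc.exists_bound_of_continuousOn (hf.continuousOn (s := Icc 0 t))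
  exact aeStronglyMeasurable_timeIntegral (m.F0.le t) (h.measurable_integrand hf) ht.1
    (fun u hu => (h.l2Bound_price u).smul_le (hD u hu))
    fun u hu => (h.aesm_price ⟨hu.1, hu.2.trans ht.2⟩ hu.2).const_mul _

end Assumption

end Data

end Market

/-! ### The aggregate position and its trading rate, common to both games. -/

namespace Market

variable {Ω : Type u} [mΩ : MeasurableSpace Ω] {m : Market Ω} {p : Coefficients} {μ : Measure Ω}
  {Y : ℝ → Ω → ℝ} {κ ε θ : ℝ}

/-- The martingale `𝔼[I_T | F_t]`. -/
def priceForecast (m : Market Ω) (p : Coefficients) (μ : Measure Ω) (κ t : ℝ) : Ω → ℝ :=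
  μ[m.integratedPrice p κ p.T | m.F t]

/-- The martingale `θ Ĩ + λ Y + S̃` that drives the aggregate position. -/
def driver (m : Market Ω) (p : Coefficients) (μ : Measure Ω) (κ θ : ℝ) (Y : ℝ → Ω → ℝ) :
    ℝ → Ω → ℝ :=
  θ • m.priceForecast p μ κ + p.lam • Y + m.Stilde p μ

/-- The kernel `Δ_{s,t} / (1 + θ Δ_{s,T})`. -/
def aggregateKernel (p : Coefficients) (κ θ t s : ℝ) : ℝ :=
  1 * expKer κ (p.clock t - p.clock s) * (1 + θ * expKer κ (p.clock p.T - p.clock s))⁻¹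

/-- The random variable `Ĩ_0 - S̃_0 Δ_{0,T}`. -/
def initialTrade (m : Market Ω) (p : Coefficients) (μ : Measure Ω) (κ : ℝ) : Ω → ℝ :=
  m.priceForecast p μ κ 0 - expKer κ (p.clock p.T) • m.Stilde p μ 0

/-- The common form of the aggregate positions of both games. -/
def aggregate (m : Market Ω) (p : Coefficients) (μ : Measure Ω) (κ ε θ : ℝ) (Y : ℝ → Ω → ℝ)
    (t : ℝ) : Ω → ℝ :=
  Y 0 + ((1 + ε * expKer κ (p.clock t)) * (1 + ε * expKer κ (p.clock p.T))⁻¹)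
      • m.initialTrade p μ κ
    - (m.integratedPrice p κ t - expKer κ (p.clock t) • m.Stilde p μ 0)
    + stochInt μ (aggregateKernel p κ θ t) (m.driver p μ κ θ Y) t

/-- The common form of the trading rates of the aggregate positions; `L` is a version of the
process `∫_0^t e^{κ ∫_0^s du/β(u)} / (1 + θ Δ_{s,T}) dM_s`. -/
def aggregateRate (m : Market Ω) (p : Coefficients) (μ : Measure Ω) (κ ε : ℝ) (L : ℝ → Ω → ℝ)
    (t : ℝ) : Ω → ℝ :=
  (p.weight (1 + p.b / 2) t * Real.exp (-κ * p.clock t))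
      • ((ε * (1 + ε * expKer κ (p.clock p.T))⁻¹) • m.initialTrade p μ κ + m.Stilde p μ 0 + L t)
    - p.weight (1 + p.b / 2) t • (m.frozenPrice p t - κ • m.integratedPrice p κ t)

/-- This is the linear equation dI = (S - κI) dW in integrated form. The double integral in κ ∫ I dW
is reduced by interchanging the order, since κ ∫_s^t e^{-κW_u} dW_u = e^{-κW_s} - e^{-κW_t}. -/
theorem integratedPrice_eq_integral {t : ℝ} {ω : Ω}
    (hS : IntervalIntegrable (fun u => m.frozenPrice p u ω) volume 0 t)
    (hI : IntervalIntegrable (fun u => m.integratedPrice p κ u ω) volume 0 t) :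
    ∫ u in (0 : ℝ)..t, p.weight (1 + p.b / 2) u
      * (m.frozenPrice p u ω - κ * m.integratedPrice p κ u ω) = m.integratedPrice p κ t ω := by
  have hw := Coefficients.continuous_weight (p := p) p.one_add_half_b_pos
  have hc := p.continuous_clock
  set w := p.weight (1 + p.b / 2) with hwdef
  have hk : IntervalIntegrable (fun s => (w s * Real.exp (κ * p.clock s)) * m.frozenPrice p s ω)
      volume 0 t := hS.continuousOn_mul (by fun_prop)
  have hcc : Continuous fun u => κ * (w u * Real.exp (-κ * p.clock u)) := by fun_prop
  have hprim : ∀ s, ∫ u in s..t, κ * (w u * Real.exp (-κ * p.clock u))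
      = Real.exp (-κ * p.clock s) - Real.exp (-κ * p.clock t) := fun s => by
    have hd : ∀ u, HasDerivAt (fun u => -Real.exp (-κ * p.clock u))
        (κ * (w u * Real.exp (-κ * p.clock u))) u := fun u => by
      refine ((hasDerivAt_primitive hw u).const_mul (-κ)).exp.neg.congr_deriv ?_
      change -(Real.exp (-κ * p.clock u) * (-κ * w u)) = _
      ring
    rw [intervalIntegral.integral_eq_sub_of_hasDerivAt (fun u _ => hd u)
      (hcc.intervalIntegrable _ _)]
    ring
  have h1 := integral_mul_primitive hcc hk
  simp_rw [hprim] at h1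
  have e1 : ∀ u, κ * (w u * Real.exp (-κ * p.clock u))
      * ∫ s in (0 : ℝ)..u, (w s * Real.exp (κ * p.clock s)) * m.frozenPrice p s ω
      = κ * (w u * m.integratedPrice p κ u ω) := fun u => by
    rw [integratedPrice_eq]; ring
  have e2 : ∀ s, (Real.exp (-κ * p.clock s) - Real.exp (-κ * p.clock t))
      * ((w s * Real.exp (κ * p.clock s)) * m.frozenPrice p s ω)
      = w s * m.frozenPrice p s ω - Real.exp (-κ * p.clock t)
        * ((w s * Real.exp (κ * p.clock s)) * m.frozenPrice p s ω) := fun s => by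
    have : Real.exp (-κ * p.clock s) * Real.exp (κ * p.clock s) = 1 := by
      rw [← Real.exp_add]; simp
    linear_combination (w s * m.frozenPrice p s ω) * this
  have iS : IntervalIntegrable (fun u => w u * m.frozenPrice p u ω) volume 0 t :=
    hS.continuousOn_mul hw.continuousOn
  have iI : IntervalIntegrable (fun u => κ * (w u * m.integratedPrice p κ u ω)) volume 0 t :=
    (hI.continuousOn_mul hw.continuousOn).const_mul _
  simp_rw [e1, e2] at h1
  rw [intervalIntegral.integral_sub iS (hk.const_mul _), intervalIntegral.integral_const_mul (Real.exp _),
    ← integratedPrice_eq] at h1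
  have e3 : ∀ u, w u * (m.frozenPrice p u ω - κ * m.integratedPrice p κ u ω)
      = w u * m.frozenPrice p u ω - κ * (w u * m.integratedPrice p κ u ω) := fun u => by ring
  simp_rw [e3]
  rw [intervalIntegral.integral_sub iS iI, h1]
  ring

theorem stronglyMeasurable_initialTrade (κ : ℝ) :
    StronglyMeasurable[m.F 0] (m.initialTrade p μ κ) :=
  stronglyMeasurable_condExp.sub (stronglyMeasurable_condExp.const_smul _)

namespace Assumption

variable [IsFiniteMeasure μ]

theorem isSqMartingale_priceForecast (h : m.Assumption p μ) (κ : ℝ) :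
    IsSqMartingale p.T m.F μ (m.priceForecast p μ κ) :=
  isSqMartingale_condExp (h.memLp_integratedPrice κ p.T_mem)

theorem isSqMartingale_Stilde (h : m.Assumption p μ) :
    IsSqMartingale p.T m.F μ (m.Stilde p μ) := by
  refine isSqMartingale_condExp ?_
  rw [← frozenPrice_of_mem p.T_mem]
  exact (h.l2Bound_price _).memLp

theorem isSqMartingale_driver (h : m.Assumption p μ) (hY : IsSqMartingale p.T m.F μ Y) (κ θ : ℝ) :
    IsSqMartingale p.T m.F μ (m.driver p μ κ θ Y) :=
  (((h.isSqMartingale_priceForecast κ).smul θ).add (hY.smul _)).add h.isSqMartingale_Stilde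

theorem memLp_initialTrade (h : m.Assumption p μ) (κ : ℝ) : MemLp (m.initialTrade p μ κ) 2 μ :=
  ((h.isSqMartingale_priceForecast κ).2 0 p.zero_mem).sub
    ((h.isSqMartingale_Stilde.2 0 p.zero_mem).const_smul _)

theorem measurable_aggregateRate (h : m.Assumption p μ) (κ ε : ℝ) {L : ℝ → Ω → ℝ}
    (hL : Measurable (Function.uncurry L)) :
    Measurable (Function.uncurry (m.aggregateRate p μ κ ε L)) := by
  have hw := Coefficients.continuous_weight (p := p) p.one_add_half_b_pos
  have hc := p.continuous_clock
  have hce : Continuous fun t => p.weight (1 + p.b / 2) t * Real.exp (-κ * p.clock t) := by fun_prop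
  have hA : Measurable fun q : ℝ × Ω => m.initialTrade p μ κ q.2 :=
    ((stronglyMeasurable_initialTrade κ).mono (m.F.le 0)).measurable.comp measurable_snd
  have hS : Measurable fun q : ℝ × Ω => m.Stilde p μ 0 q.2 :=
    (h.isSqMartingale_Stilde.measurable p.zero_mem).comp measurable_snd
  have e1 : Measurable fun q : ℝ × Ω =>
      p.weight (1 + p.b / 2) q.1 * Real.exp (-κ * p.clock q.1) := hce.measurable.comp measurable_fst
  have e2 : Measurable fun q : ℝ × Ω => p.weight (1 + p.b / 2) q.1 :=
    hw.measurable.comp measurable_fst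
  have e : Function.uncurry (m.aggregateRate p μ κ ε L) = fun q : ℝ × Ω =>
      p.weight (1 + p.b / 2) q.1 * Real.exp (-κ * p.clock q.1)
        * (ε * (1 + ε * expKer κ (p.clock p.T))⁻¹ * m.initialTrade p μ κ q.2 + m.Stilde p μ 0 q.2
          + Function.uncurry L q)
      - p.weight (1 + p.b / 2) q.1 * (Function.uncurry (m.frozenPrice p) q
        - κ * Function.uncurry (m.integratedPrice p κ) q) := by
    funext ⟨t, ω⟩
    simp only [Function.uncurry, aggregateRate, Pi.sub_apply, Pi.smul_apply, Pi.add_apply,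
      smul_eq_mul]
  rw [e]
  exact (e1.mul (((hA.const_mul _).add hS).add hL)).sub
    (e2.mul (h.measurable_frozenPrice.sub ((h.measurable_integratedPrice κ).const_mul κ)))

/-- The aggregate position has a trading rate, which is of the form `aggregateRate`. -/
theorem exists_isTradingRate (h : m.Assumption p μ) (hY : IsSqMartingale p.T m.F μ Y) (κ : ℝ)
    (hθ : 0 ≤ θ) (ε : ℝ) : ∃ L : ℝ → Ω → ℝ,
      (∀ t ∈ Icc 0 p.T, HasStochInt μ (fun s => 1 * Real.exp (κ * p.clock s)
        * (1 + θ * expKer κ (p.clock p.T - p.clock s))⁻¹) (m.driver p μ κ θ Y) t (L t)) ∧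
      (∀ t ∈ Icc 0 p.T, HasStochInt μ (aggregateKernel p κ θ t) (m.driver p μ κ θ Y) t
        (stochInt μ (aggregateKernel p κ θ t) (m.driver p μ κ θ Y) t)) ∧
      m.IsTradingRate p μ (m.aggregate p μ κ ε θ Y) (m.aggregateRate p μ κ ε L) := by
  have hM := h.isSqMartingale_driver hY κ θ
  have hw := Coefficients.continuous_weight (p := p) p.one_add_half_b_pos
  have hc := p.continuous_clock
  have hKc := continuous_expKer κ
  -- The scaling parameter ρ is 1 here, which explains the factor 1 in `aggregateKernel`.
  obtain ⟨L, hLm, hL, hLad, hLk⟩ := hM.exists_kernel_process p.T_pos.le hw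
    (fun u => (Coefficients.weight_pos p.one_add_half_b_pos u).le) κ 1 hθ
  have hker : ∀ t ∈ Icc 0 p.T, HasStochInt μ (aggregateKernel p κ θ t) (m.driver p μ κ θ Y) t
      (fun ω => ∫ u in (0 : ℝ)..t, p.weight (1 + p.b / 2) u * Real.exp (-κ * p.clock u) * L u ω) :=
    hLk
  refine ⟨L, hL, fun t ht => (hker t ht).stochInt, ?_⟩
  set w := p.weight (1 + p.b / 2) with hwdef
  -- uniform bounds
  obtain ⟨B, hB⟩ : ∃ B, ∀ t ∈ Icc 0 p.T, L2Bound μ (L t) B := by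
    obtain ⟨mT, hmT⟩ := (hM.2 p.T p.T_mem).exists_l2Bound
    have hcont : ContinuousOn (fun s => 1 * Real.exp (κ * p.clock s)
        * (1 + θ * expKer κ (p.clock p.T - p.clock s))⁻¹) (Icc 0 p.T) := by
      have h2 : Continuous fun s => 1 + θ * expKer κ (p.clock p.T - p.clock s) := by fun_prop
      refine ContinuousOn.mul (by fun_prop) (h2.continuousOn.inv₀ fun s hs => ?_)
      have := mul_nonneg hθ (expKer_nonneg κ (sub_nonneg.2 (p.clock_mono hs.2)))
      linarith
    obtain ⟨D, hD⟩ := isCompact_Icc.exists_bound_of_continuousOn hcont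
    exact ⟨D * mT, fun t ht => (hL t ht).l2Bound hM ht ((norm_nonneg _).trans (hD 0 p.zero_mem))
      (fun s hs => hD s ⟨hs.1, hs.2.trans ht.2⟩) (hM.l2Bound hmT ht)⟩
  obtain ⟨KI, hKI⟩ := h.exists_l2Bound_integratedPrice κ
  obtain ⟨KA, hKA⟩ := (h.memLp_initialTrade κ).exists_l2Bound
  obtain ⟨KS, hKS⟩ := (h.isSqMartingale_Stilde.2 0 p.zero_mem).exists_l2Bound
  have hce : Continuous fun t => w t * Real.exp (-κ * p.clock t) := by fun_prop
  have hmeas : Measurable (Function.uncurry (m.aggregateRate p μ κ ε L)) :=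
    h.measurable_aggregateRate κ ε hLm
  have hmeas' : Measurable fun q : Icc (0 : ℝ) p.T × Ω => m.aggregateRate p μ κ ε L q.1 q.2 :=
    hmeas.comp (f := fun q : Icc (0 : ℝ) p.T × Ω => ((q.1 : ℝ), q.2))
      ((measurable_subtype_coe.comp measurable_fst).prodMk measurable_snd)
  refine ⟨hmeas', ?_, ?_, ?_⟩
  · intro t ht
    have hF0 := m.F.mono ht.1
    refine AEStronglyMeasurable.sub (AEStronglyMeasurable.const_smul (AEStronglyMeasurable.add
      (AEStronglyMeasurable.add (AEStronglyMeasurable.const_smul ?_ _) ?_) (hLad t ht)) _)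
      (AEStronglyMeasurable.const_smul (AEStronglyMeasurable.sub ?_
        (AEStronglyMeasurable.const_smul ?_ _)) _)
    · exact ((stronglyMeasurable_initialTrade κ).mono hF0).aestronglyMeasurable
    · exact ((h.isSqMartingale_Stilde.stronglyMeasurable p.zero_mem).mono hF0).aestronglyMeasurable
    · exact (h.aesm_price ht le_rfl).mono (h.F0_le t ht)
    · exact (h.aesm_integratedPrice κ ht).mono (h.F0_le t ht)
  · obtain ⟨D, hD⟩ := isCompact_Icc.exists_bound_of_continuousOn (hce.continuousOn (s := Icc 0 p.T))
    obtain ⟨D', hD'⟩ := isCompact_Icc.exists_bound_of_continuousOn (hw.continuousOn (s := Icc 0 p.T))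
    have hb : ∃ K, ∀ t ∈ Icc 0 p.T, L2Bound μ (m.aggregateRate p μ κ ε L t) K :=
      ⟨_, fun t ht => ((((hKA.smul _).add hKS).add (hB t ht)).smul_le (hD t ht)).sub
        (((h.l2Bound_price t).sub ((hKI t ht).smul κ)).smul_le (hD' t ht))⟩
    obtain ⟨K, hK⟩ := hb
    exact (lintegral_timeIntegral_sq_le hmeas p.T_pos.le hK).trans_lt ENNReal.ofReal_lt_top
  · intro t ht
    have hsub : ∀ u ∈ Icc 0 t, u ∈ Icc 0 p.T := fun u hu => ⟨hu.1, hu.2.trans ht.2⟩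
    filter_upwards [(hker t ht).stochInt.ae_eq hM ht (hker t ht),
      (hker 0 p.zero_mem).stochInt.ae_eq hM p.zero_mem (hker 0 p.zero_mem),
      ae_intervalIntegrable_path hLm ht.1 fun u hu => hB u (hsub u hu),
      ae_intervalIntegrable_path h.measurable_frozenPrice ht.1 fun u _ => h.l2Bound_price u,
      ae_intervalIntegrable_path (h.measurable_integratedPrice κ) ht.1
        fun u hu => hKI u (hsub u hu)] with ω h1 h2 h3 h4 h5
    have hI0 : m.integratedPrice p κ 0 ω = 0 := by simp [integratedPrice]
    have i1 : ∀ z : ℝ, IntervalIntegrable (fun u => w u * Real.exp (-κ * p.clock u) * z) volume 0 t :=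
      fun z => (hce.intervalIntegrable _ _).mul_const z
    have i2 : IntervalIntegrable (fun u => w u * Real.exp (-κ * p.clock u) * L u ω) volume 0 t :=
      h3.continuousOn_mul hce.continuousOn
    have i3 : IntervalIntegrable (fun u => w u
        * (m.frozenPrice p u ω - κ * m.integratedPrice p κ u ω)) volume 0 t :=
      (h4.sub (h5.const_mul κ)).continuousOn_mul hw.continuousOn
    -- The rate is split so that its integral can be read off: the constants integrate to multiples
    -- of E_κ(W_t), the part with `L` to the stochastic integral, and the rest to the integrated
    -- price.
    have e1 : ∀ u, m.aggregateRate p μ κ ε L u ω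
        = w u * Real.exp (-κ * p.clock u) * (ε * (1 + ε * expKer κ (p.clock p.T))⁻¹
            * m.initialTrade p μ κ ω + m.Stilde p μ 0 ω)
          + w u * Real.exp (-κ * p.clock u) * L u ω
          - w u * (m.frozenPrice p u ω - κ * m.integratedPrice p κ u ω) := fun u => by
      simp only [aggregateRate, Pi.sub_apply, Pi.smul_apply, Pi.add_apply, smul_eq_mul, ← hwdef]
      ring
    have e2 : ∫ u in (0 : ℝ)..t, w u * Real.exp (-κ * p.clock u) = expKer κ (p.clock t) := by
      have := integral_weight_mul_exp hw κ 0 t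
      rw [primitive_zero, mul_zero, Real.exp_zero, one_mul, sub_zero] at this
      exact this
    simp_rw [e1]
    rw [intervalIntegral.integral_sub ((i1 _).add i2) i3, intervalIntegral.integral_add (i1 _) i2,
      intervalIntegral.integral_mul_const, e2, integratedPrice_eq_integral h4 h5, ← h1]
    simp only [aggregate, Pi.sub_apply, Pi.smul_apply, Pi.add_apply, smul_eq_mul, hI0, h2,
      intervalIntegral.integral_same, Coefficients.clock_zero, expKer_zero]
    ring

end Assumption

end Market

/-! ### Lipschitz constants of the kernels, uniform in time. -/

theorem lip_exp_pos {a κ₀ ε x X : ℝ} (hκ₀ : |κ₀| ≤ a) (hκ : |κ₀ - ε| ≤ a) (hε : 0 ≤ ε) (hx : 0 ≤ x)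
    (hxX : x ≤ X) :
    Lip ε ((1 + X + X ^ 2) * Real.exp (a * X)) (Real.exp ((κ₀ - ε) * x)) (Real.exp (κ₀ * x)) := by
  have hX := hx.trans hxX
  have hE := Real.exp_pos (a * X)
  refine ⟨by positivity, ?_, ?_⟩
  · rw [abs_of_pos (Real.exp_pos _)]
    have h1 : κ₀ * x ≤ a * X := by
      simpa using neg_mul_le_of_abs_le (κ := -κ₀) (by rwa [abs_neg]) hx hxX
    refine (Real.exp_le_exp.2 h1).trans (le_mul_of_one_le_left hE.le (by nlinarith))
  -- The earlier estimate only involves absolute values of the rates, so it applies with the signs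
  -- reversed.
  · have h1 := abs_exp_mul_sub_le (a := a) (κ := -(κ₀ - ε)) (κ' := -κ₀) (by rwa [abs_neg])
      (by rwa [abs_neg]) hx hxX
    rw [neg_neg, neg_neg, show -(κ₀ - ε) - -κ₀ = ε by ring, abs_of_nonneg hε] at h1
    refine h1.trans ?_
    rw [mul_comm]
    gcongr
    nlinarith

namespace Coefficients

variable (p : Coefficients)

theorem abs_a_le : |p.a| ≤ p.a := (abs_of_nonneg p.a_nonneg).le

theorem abs_a_sub_le {ε : ℝ} (hε : 0 ≤ ε) (hεa : ε ≤ p.a) : |p.a - ε| ≤ p.a := by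
  rw [abs_of_nonneg (sub_nonneg.2 hεa)]; linarith

variable {p}

theorem clock_sub_nonneg {s t : ℝ} (hst : s ≤ t) : 0 ≤ p.clock t - p.clock s :=
  sub_nonneg.2 (p.clock_mono hst)

theorem clock_sub_le {s t : ℝ} (hs : 0 ≤ s) (ht : t ≤ p.T) :
    p.clock t - p.clock s ≤ p.clock p.T := by
  have h1 := p.clock_mono hs
  have h2 := p.clock_mono ht
  rw [clock_zero] at h1
  linarith

theorem clockTilde_sub_nonneg {s t : ℝ} (hst : s ≤ t) : 0 ≤ p.clockTilde t - p.clockTilde s :=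
  sub_nonneg.2 (p.clockTilde_mono hst)

theorem clockTilde_sub_le {s t : ℝ} (hs : 0 ≤ s) (ht : t ≤ p.T) :
    p.clockTilde t - p.clockTilde s ≤ p.clockTilde p.T := by
  have h1 := p.clockTilde_mono hs
  have h2 := p.clockTilde_mono ht
  have h3 : p.clockTilde 0 = 0 := primitive_zero _
  rw [h3] at h1
  linarith

/-- All clock increments lie in [0, W_T], so W_T can serve as the bound X. -/
theorem exists_lip_expKer (p : Coefficients) : ∃ K, ∀ ε, 0 ≤ ε → ε ≤ p.a → ∀ s t, 0 ≤ s → s ≤ t →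
    t ≤ p.T → Lip ε K (expKer (p.a - ε) (p.clock t - p.clock s))
      (expKer p.a (p.clock t - p.clock s)) :=
  ⟨_, fun _ hε hεa _ _ hs hst ht => lip_expKer p.abs_a_le (p.abs_a_sub_le hε hεa) hε
    (clock_sub_nonneg hst) (clock_sub_le hs ht)⟩

theorem exists_lip_inv (p : Coefficients) : ∃ K, ∀ ε, 0 ≤ ε → ε ≤ p.a → ∀ s, 0 ≤ s → s ≤ p.T →
    Lip ε K (1 + (ε + p.lam) * expKer (p.a - ε) (p.clock p.T - p.clock s))⁻¹
      (1 + p.lam * expKer p.a (p.clock p.T - p.clock s))⁻¹ := by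
  obtain ⟨K, hK⟩ := p.exists_lip_expKer
  exact ⟨_, fun ε hε hεa s hs hsT => (hK ε hε hεa s p.T hs hsT le_rfl).inv_one_add_mul hε hεa
    p.lam_nonneg (expKer_nonneg _ (clock_sub_nonneg hsT)) (expKer_nonneg _ (clock_sub_nonneg hsT))⟩

theorem exists_lip_aggregateKernel (p : Coefficients) : ∃ K, ∀ ε, 0 ≤ ε → ε ≤ p.a →
    ∀ s t, 0 ≤ s → s ≤ t → t ≤ p.T →
    Lip ε K (Market.aggregateKernel p (p.a - ε) (ε + p.lam) t s)
      (Market.aggregateKernel p p.a p.lam t s) := by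
  obtain ⟨K, hK⟩ := p.exists_lip_expKer
  obtain ⟨K', hK'⟩ := p.exists_lip_inv
  -- The constant stays a metavariable, to be filled by unification with what the product rules
  -- yield. Created before the variables below are introduced, it cannot depend on them.
  apply Exists.intro
  intro ε hε hεa s t hs hst ht
  have h1 : Lip ε 1 1 1 := Lip.const hε (by simp)
  exact (h1.mul (hK ε hε hεa s t hs hst ht) hε hεa).mul (hK' ε hε hεa s hs (hst.trans ht)) hε hεa

theorem exists_lip_rateKernel (p : Coefficients) : ∃ K, ∀ ε, 0 ≤ ε → ε ≤ p.a →
    ∀ s, 0 ≤ s → s ≤ p.T →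
    Lip ε K (1 * Real.exp ((p.a - ε) * p.clock s)
        * (1 + (ε + p.lam) * expKer (p.a - ε) (p.clock p.T - p.clock s))⁻¹)
      (1 * Real.exp (p.a * p.clock s) * (1 + p.lam * expKer p.a (p.clock p.T - p.clock s))⁻¹) := by
  obtain ⟨K', hK'⟩ := p.exists_lip_inv
  apply Exists.intro
  intro ε hε hεa s hs hsT
  have h1 : Lip ε 1 1 1 := Lip.const hε (by simp)
  have h2 := lip_exp_pos p.abs_a_le (p.abs_a_sub_le hε hεa) hε
    (by simpa using clock_sub_nonneg (p := p) hs) (p.clock_mono hsT)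
  exact (h1.mul h2 hε hεa).mul (hK' ε hε hεa s hs hsT) hε hεa

/-- The kernel `λ Δ̃_{s,t} / (1 + θ Δ̃_{s,T})` of the individual part of the positions. -/
def individualKernel (p : Coefficients) (κ θ t s : ℝ) : ℝ :=
  p.lam * expKer κ (p.clockTilde t - p.clockTilde s)
    * (1 + θ * expKer κ (p.clockTilde p.T - p.clockTilde s))⁻¹

theorem exists_lip_individualKernel (p : Coefficients) : ∃ K, ∀ ε, 0 ≤ ε → ε ≤ p.a →
    ∀ s t, 0 ≤ s → s ≤ t → t ≤ p.T →
    Lip ε K (p.individualKernel (0 - ε) (ε + p.lam) t s) (p.individualKernel 0 p.lam t s) := by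
  apply Exists.intro
  intro ε hε hεa s t hs hst ht
  have h0 : |(0 : ℝ)| ≤ p.a := by simpa using p.a_nonneg
  have h0' : |0 - ε| ≤ p.a := by rw [zero_sub, abs_neg, abs_of_nonneg hε]; exact hεa
  have h1 : Lip ε p.lam p.lam p.lam := Lip.const hε (abs_of_nonneg p.lam_nonneg).le
  have h2 := lip_expKer h0 h0' hε (clockTilde_sub_nonneg hst) (clockTilde_sub_le hs ht)
  have hsT := clockTilde_sub_nonneg (p := p) (hst.trans ht)
  have h3 := (lip_expKer h0 h0' hε hsT (clockTilde_sub_le hs le_rfl)).inv_one_add_mul hε hεa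
    p.lam_nonneg (expKer_nonneg _ hsT) (expKer_nonneg _ hsT)
  exact (h1.mul h2 hε hεa).mul h3 hε hεa

end Coefficients

/-! ### Perturbation estimates for the aggregate position and its rate. -/

namespace Market

/-- The setting of the comparison of the game with finitely many players with the mean-field game:
`ε` stands for `a / N`, and `Y` for the average forecast. -/
structure Perturbation {Ω : Type u} [MeasurableSpace Ω] (m : Market Ω) (p : Coefficients)
    (μ : Measure Ω) (ε x y : ℝ) (Y : ℝ → Ω → ℝ) : Prop where
  assumption : m.Assumption p μ
  nonneg : 0 ≤ ε
  le : ε ≤ p.a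
  mart : IsSqMartingale p.T m.F μ Y
  bound : L2Bound μ (m.Xbar p.T) x
  diff : L2Bound μ (Y p.T - m.Xbar p.T) y

/-- The comparison of a random variable of the game with finitely many players with its mean-field
limit. -/
abbrev Close {Ω : Type u} [MeasurableSpace Ω] (m : Market Ω) (p : Coefficients)
    (μ : Measure Ω) (ε x y K : ℝ) (Z Z₀ : Ω → ℝ) : Prop :=
  LipPair μ (m.priceBound p μ + x) (ε * (m.priceBound p μ + x) + y) K Z Z₀

namespace Perturbation

section

variable {Ω : Type u} [MeasurableSpace Ω] {m : Market Ω} {p : Coefficients}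
    {μ : Measure Ω} {ε x y : ℝ} {Y : ℝ → Ω → ℝ}

theorem scale_nonneg (h : m.Perturbation p μ ε x y Y) : 0 ≤ m.priceBound p μ + x :=
  add_nonneg (Real.sqrt_nonneg _) h.bound.nonneg

theorem error_nonneg (h : m.Perturbation p μ ε x y Y) : 0 ≤ ε * (m.priceBound p μ + x) + y :=
  add_nonneg (mul_nonneg h.nonneg h.scale_nonneg) h.diff.nonneg

theorem le_error (h : m.Perturbation p μ ε x y Y) :
    ε * (m.priceBound p μ + x) ≤ ε * (m.priceBound p μ + x) + y :=
  le_add_of_nonneg_right h.diff.nonneg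

theorem smul (h : m.Perturbation p μ ε x y Y) {K L q q₀ : ℝ} {Z Z₀ : Ω → ℝ}
    (hZ : m.Close p μ ε x y K Z Z₀) (hq : Lip ε L q q₀) :
    m.Close p μ ε x y (L * K * (2 + p.a)) (q • Z) (q₀ • Z₀) :=
  LipPair.smul hZ hq h.nonneg h.le h.scale_nonneg h.le_error

theorem close_price (h : m.Perturbation p μ ε x y Y) (t : ℝ) :
    m.Close p μ ε x y 1 (m.frozenPrice p t) (m.frozenPrice p t) :=
  LipPair.of_l2Bound ((h.assumption.l2Bound_price t).mono (by linarith [h.bound.nonneg]))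
    h.error_nonneg

theorem close_Stilde (h : m.Perturbation p μ ε x y Y) (t : ℝ) [IsFiniteMeasure μ] :
    m.Close p μ ε x y 1 (m.Stilde p μ t) (m.Stilde p μ t) := by
  have := (h.close_price p.T).condExp (h.assumption.l2Bound_price p.T).memLp (m.F t)
  rwa [frozenPrice_of_mem p.T_mem] at this

/-- Conditional expectation carries the bounds at the horizon back to time t. This is where the
forecast error y, rather than ε, produces a difference. -/
theorem close_forecast (h : m.Perturbation p μ ε x y Y) {t : ℝ} (ht : t ∈ Icc 0 p.T) :
    m.Close p μ ε x y 1 (Y t) (m.Xbar t) := by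
  have hs : 0 ≤ m.priceBound p μ := Real.sqrt_nonneg _
  refine ⟨zero_le_one, ?_, ?_⟩
  · exact (h.assumption.Xbar_mart.l2Bound h.bound ht).mono (by linarith)
  · refine ((h.mart.sub h.assumption.Xbar_mart).l2Bound h.diff ht).mono ?_
    have := mul_nonneg h.nonneg h.scale_nonneg
    linarith

end

/-- The price is the same in both games, so only the exponential kernel is perturbed. -/
theorem exists_close_integratedPrice (p : Coefficients) : ∃ K, ∀ (Ω : Type u) [MeasurableSpace Ω]
    (μ : Measure Ω) [IsFiniteMeasure μ] (m : Market Ω) (ε x y : ℝ) (Y : ℝ → Ω → ℝ),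
    m.Perturbation p μ ε x y Y → ∀ t ∈ Icc 0 p.T,
      m.Close p μ ε x y K (m.integratedPrice p (p.a - ε) t) (m.integratedPrice p p.a t) := by
  obtain ⟨B, hB⟩ := Coefficients.exists_weight_le (p := p) _ p.one_add_half_b_pos
  have hw := Coefficients.continuous_weight (p := p) p.one_add_half_b_pos
  have hc := p.continuous_clock
  apply Exists.intro
  intro Ω _ μ _ m ε x y Y h t ht
  have key := fun (u : ℝ) (hu : u ∈ Icc 0 t) => h.smul (h.close_price u)
    ((lip_exp p.abs_a_le (p.abs_a_sub_le h.nonneg h.le) h.nonneg (Coefficients.clock_sub_nonneg hu.2)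
      (Coefficients.clock_sub_le (p := p) hu.1 ht.2)).mul (Lip.const h.nonneg (hB u)) h.nonneg h.le)
  exact LipPair.timeIntegral ht (h.assumption.measurable_integrand (by fun_prop))
    (h.assumption.measurable_integrand (by fun_prop)) h.scale_nonneg h.error_nonneg key

theorem exists_close_priceForecast (p : Coefficients) : ∃ K, ∀ (Ω : Type u) [MeasurableSpace Ω]
    (μ : Measure Ω) [IsFiniteMeasure μ] (m : Market Ω) (ε x y : ℝ) (Y : ℝ → Ω → ℝ),
    m.Perturbation p μ ε x y Y → ∀ t,
      m.Close p μ ε x y K (m.priceForecast p μ (p.a - ε) t) (m.priceForecast p μ p.a t) := by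
  obtain ⟨K, hK⟩ := exists_close_integratedPrice p
  exact ⟨K, fun Ω _ μ _ m ε x y Y h t => (hK Ω μ m ε x y Y h p.T p.T_mem).condExp
    (h.assumption.memLp_integratedPrice _ p.T_mem) (m.F t)⟩

theorem exists_close_initialTrade (p : Coefficients) : ∃ K, ∀ (Ω : Type u) [MeasurableSpace Ω]
    (μ : Measure Ω) [IsFiniteMeasure μ] (m : Market Ω) (ε x y : ℝ) (Y : ℝ → Ω → ℝ),
    m.Perturbation p μ ε x y Y →
      m.Close p μ ε x y K (m.initialTrade p μ (p.a - ε)) (m.initialTrade p μ p.a) := by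
  obtain ⟨K, hK⟩ := exists_close_priceForecast p
  obtain ⟨K', hK'⟩ := p.exists_lip_expKer
  apply Exists.intro
  intro Ω _ μ _ m ε x y Y h
  have h1 := hK' ε h.nonneg h.le 0 p.T le_rfl p.T_pos.le le_rfl
  rw [Coefficients.clock_zero, sub_zero] at h1
  exact (hK Ω μ m ε x y Y h 0).sub (h.smul (h.close_Stilde 0) h1)

theorem exists_close_driver (p : Coefficients) : ∃ K, ∀ (Ω : Type u) [MeasurableSpace Ω]
    (μ : Measure Ω) [IsFiniteMeasure μ] (m : Market Ω) (ε x y : ℝ) (Y : ℝ → Ω → ℝ),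
    m.Perturbation p μ ε x y Y → ∀ t ∈ Icc 0 p.T,
      m.Close p μ ε x y K (m.driver p μ (p.a - ε) (ε + p.lam) Y t)
        (m.driver p μ p.a p.lam m.Xbar t) := by
  obtain ⟨K, hK⟩ := exists_close_priceForecast p
  apply Exists.intro
  intro Ω _ μ _ m ε x y Y h t ht
  have h1 : Lip ε (1 + p.lam) (ε + p.lam) p.lam := by
    have := p.lam_nonneg
    refine ⟨by linarith, ?_, ?_⟩
    · rw [abs_of_nonneg this]; linarith
    · rw [add_sub_cancel_right, abs_of_nonneg h.nonneg]; nlinarith [h.nonneg]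
  have h2 : Lip ε p.lam p.lam p.lam := Lip.const h.nonneg (abs_of_nonneg p.lam_nonneg).le
  exact ((h.smul (hK Ω μ m ε x y Y h t) h1).add (h.smul (h.close_forecast ht) h2)).add
    (h.close_Stilde t)

/-- The aggregate positions of both games are close to each other. -/
theorem exists_close_aggregate (p : Coefficients) : ∃ K, ∀ (Ω : Type u) [MeasurableSpace Ω]
    (μ : Measure Ω) [IsFiniteMeasure μ] (m : Market Ω) (ε x y : ℝ) (Y : ℝ → Ω → ℝ),
    m.Perturbation p μ ε x y Y → ∀ t ∈ Icc 0 p.T,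
      m.Close p μ ε x y K (m.aggregate p μ (p.a - ε) ε (ε + p.lam) Y t)
        (m.aggregate p μ p.a 0 p.lam m.Xbar t) := by
  obtain ⟨KI, hKI⟩ := exists_close_integratedPrice p
  obtain ⟨KA, hKA⟩ := exists_close_initialTrade p
  obtain ⟨KD, hKD⟩ := exists_close_driver p
  obtain ⟨Ke, hKe⟩ := p.exists_lip_expKer
  obtain ⟨Kk, hKk⟩ := p.exists_lip_aggregateKernel
  apply Exists.intro
  intro Ω _ μ _ m ε x y Y h t ht
  have hθ := add_nonneg h.nonneg p.lam_nonneg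
  have hA := h.assumption
  have hε : Lip ε 1 ε 0 := ⟨zero_le_one, by simp, by simp [abs_of_nonneg h.nonneg]⟩
  have h1 : Lip ε 1 1 1 := Lip.const h.nonneg (by simp)
  have het : Lip ε Ke (expKer (p.a - ε) (p.clock t)) (expKer p.a (p.clock t)) := by
    simpa using hKe ε h.nonneg h.le 0 t le_rfl ht.1 ht.2
  have heT : Lip ε Ke (expKer (p.a - ε) (p.clock p.T)) (expKer p.a (p.clock p.T)) := by
    simpa using hKe ε h.nonneg h.le 0 p.T le_rfl p.T_pos.le le_rfl
  have hpos : ∀ κ, 0 ≤ expKer κ (p.clock p.T) := fun κ =>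
    expKer_nonneg κ (by simpa using Coefficients.clock_sub_nonneg p.T_pos.le)
  -- The coefficient of the initial trade tends to 1, as the explicit factor ε has the limit 0.
  have hq := (h1.add (hε.mul het h.nonneg h.le)).mul
    ((h1.add (hε.mul heT h.nonneg h.le)).inv h.nonneg
      (by have := mul_nonneg h.nonneg (hpos (p.a - ε)); linarith) (by simp)) h.nonneg h.le
  -- Only the existence of the stochastic integrals is taken from the construction of the rates.
  obtain ⟨L, -, hJ, -⟩ := hA.exists_isTradingRate h.mart (p.a - ε) hθ ε
  obtain ⟨L₀, -, hJ₀, -⟩ := hA.exists_isTradingRate hA.Xbar_mart p.a p.lam_nonneg 0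
  have hst := LipPair.stochInt (hA.isSqMartingale_driver h.mart (p.a - ε) (ε + p.lam))
    (hA.isSqMartingale_driver hA.Xbar_mart p.a p.lam) ht (hJ t ht) (hJ₀ t ht)
    (fun s hs => hKk ε h.nonneg h.le s t hs.1 hs.2 ht.2) (hKD Ω μ m ε x y Y h t ht)
    h.nonneg h.le h.scale_nonneg h.le_error
  exact (((h.close_forecast p.zero_mem).add (h.smul (hKA Ω μ m ε x y Y h) hq)).sub
    ((hKI Ω μ m ε x y Y h t ht).sub (h.smul (h.close_Stilde 0) het))).add hst

/-- The trading rates of both games are close to each other. -/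
theorem exists_close_aggregateRate (p : Coefficients) : ∃ K, ∀ (Ω : Type u) [MeasurableSpace Ω]
    (μ : Measure Ω) [IsFiniteMeasure μ] (m : Market Ω) (ε x y : ℝ) (Y : ℝ → Ω → ℝ),
    m.Perturbation p μ ε x y Y → ∀ L L₀ : ℝ → Ω → ℝ,
    (∀ t ∈ Icc 0 p.T, HasStochInt μ (fun s => 1 * Real.exp ((p.a - ε) * p.clock s)
        * (1 + (ε + p.lam) * expKer (p.a - ε) (p.clock p.T - p.clock s))⁻¹)
      (m.driver p μ (p.a - ε) (ε + p.lam) Y) t (L t)) →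
    (∀ t ∈ Icc 0 p.T, HasStochInt μ (fun s => 1 * Real.exp (p.a * p.clock s)
        * (1 + p.lam * expKer p.a (p.clock p.T - p.clock s))⁻¹)
      (m.driver p μ p.a p.lam m.Xbar) t (L₀ t)) →
    ∀ t ∈ Icc 0 p.T, m.Close p μ ε x y K (m.aggregateRate p μ (p.a - ε) ε L t)
        (m.aggregateRate p μ p.a 0 L₀ t) := by
  obtain ⟨KI, hKI⟩ := exists_close_integratedPrice p
  obtain ⟨KA, hKA⟩ := exists_close_initialTrade p
  obtain ⟨KD, hKD⟩ := exists_close_driver p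
  obtain ⟨Ke, hKe⟩ := p.exists_lip_expKer
  obtain ⟨Kk, hKk⟩ := p.exists_lip_rateKernel
  obtain ⟨B, hB⟩ := Coefficients.exists_weight_le (p := p) _ p.one_add_half_b_pos
  apply Exists.intro
  intro Ω _ μ _ m ε x y Y h L L₀ hL hL₀ t ht
  have hA := h.assumption
  have hε : Lip ε 1 ε 0 := ⟨zero_le_one, by simp, by simp [abs_of_nonneg h.nonneg]⟩
  have h1 : Lip ε 1 1 1 := Lip.const h.nonneg (by simp)
  have ha : Lip ε (1 + p.a) (p.a - ε) p.a := by
    have := p.a_nonneg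
    refine ⟨by linarith, ?_, ?_⟩
    · rw [abs_of_nonneg this]; linarith
    · rw [sub_sub_cancel_left, abs_neg, abs_of_nonneg h.nonneg]; nlinarith [h.nonneg]
  have hw := Lip.const h.nonneg (hB t)
  have hexp := lip_exp p.abs_a_le (p.abs_a_sub_le h.nonneg h.le) h.nonneg
    (by simpa using Coefficients.clock_sub_nonneg (p := p) ht.1) (p.clock_mono ht.2)
  have heT : Lip ε Ke (expKer (p.a - ε) (p.clock p.T)) (expKer p.a (p.clock p.T)) := by
    simpa using hKe ε h.nonneg h.le 0 p.T le_rfl p.T_pos.le le_rfl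
  have hpos : ∀ κ, 0 ≤ expKer κ (p.clock p.T) := fun κ =>
    expKer_nonneg κ (by simpa using Coefficients.clock_sub_nonneg p.T_pos.le)
  have hq := hε.mul ((h1.add (hε.mul heT h.nonneg h.le)).inv h.nonneg
      (by have := mul_nonneg h.nonneg (hpos (p.a - ε)); linarith) (by simp)) h.nonneg h.le
  have hst := LipPair.stochInt (hA.isSqMartingale_driver h.mart (p.a - ε) (ε + p.lam))
    (hA.isSqMartingale_driver hA.Xbar_mart p.a p.lam) ht (hL t ht) (hL₀ t ht)
    (fun s hs => hKk ε h.nonneg h.le s hs.1 (hs.2.trans ht.2)) (hKD Ω μ m ε x y Y h t ht)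
    h.nonneg h.le h.scale_nonneg h.le_error
  exact (h.smul (((h.smul (hKA Ω μ m ε x y Y h) hq).add (h.close_Stilde 0)).add hst)
    (hw.mul hexp h.nonneg h.le)).sub
    (h.smul ((h.close_price t).sub (h.smul (hKI Ω μ m ε x y Y h t ht) ha)) hw)

end Perturbation

end Market

/-! ### Consequences of immersion. -/

namespace Market

section Immersion

theorem _root_.integral_mul_condExp {Ω : Type u} {G mΩ : MeasurableSpace Ω} {μ : Measure Ω}
    [IsFiniteMeasure μ] {U Z : Ω → ℝ} (hG : G ≤ mΩ) (hU : MemLp U 2 μ)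
    (hUG : AEStronglyMeasurable[G] U μ) (hZ : MemLp Z 2 μ) :
    ∫ ω, U ω * (μ[Z | G]) ω ∂μ = ∫ ω, U ω * Z ω ∂μ := by
  have hc : MemLp (μ[Z | G]) 2 μ := hZ.condExp (by norm_num)
  have h0 : μ[Z - μ[Z | G] | G] =ᵐ[μ] 0 := by
    refine (condExp_sub (hZ.integrable (by norm_num)) integrable_condExp G).trans ?_
    rw [condExp_of_stronglyMeasurable hG stronglyMeasurable_condExp integrable_condExp]
    simp
  have h1 := integral_mul_eq_zero_of_condExp_eq_zero hG hU hUG (hZ.sub hc) h0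
  have e : ∀ ω, U ω * (Z - μ[Z | G]) ω = U ω * Z ω - U ω * (μ[Z | G]) ω := fun ω => by
    rw [Pi.sub_apply, mul_sub]
  simp_rw [e] at h1
  have i1 : Integrable (fun ω => U ω * Z ω) μ := hU.integrable_mul hZ
  have i2 : Integrable (fun ω => U ω * (μ[Z | G]) ω) μ := hU.integrable_mul hc
  rw [integral_sub i1 i2] at h1
  linarith

variable {Ω : Type u} [mΩ : MeasurableSpace Ω] {m : Market Ω} {p : Coefficients} {μ : Measure Ω}

theorem Immersed.condExp_ae_eq (h : m.Immersed p μ) {Z : Ω → ℝ} {t : ℝ} (ht : t ∈ Icc 0 p.T)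
    (hZ : AEStronglyMeasurable[m.F0 p.T] Z μ) (hZi : Integrable Z μ) :
    μ[Z | m.F t] =ᵐ[μ] μ[Z | m.F0 t] := by
  obtain ⟨Z', hZ', hZZ'⟩ := hZ
  exact (condExp_congr_ae hZZ').trans ((h t ht Z' hZ' (hZi.congr hZZ')).trans
    (condExp_congr_ae hZZ').symm)

theorem Assumption.aesm_Xbar (h : m.Assumption p μ) {s t : ℝ} (hs : s ∈ Icc 0 p.T) (hst : s ≤ t) :
    AEStronglyMeasurable[m.F0 t] (m.Xbar s) μ :=
  (stronglyMeasurable_condExp.mono (m.F0.mono hst)).aestronglyMeasurable.congr (h.condExp_X 0 s hs)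

variable [IsFiniteMeasure μ]

/-- Under immersion, the common information after time `s` does not help to predict what the
agents know at time `s`. -/
theorem Immersed.condExp_common (h : m.Immersed p μ) {Y : Ω → ℝ} {s t : ℝ} (hs : s ∈ Icc 0 p.T)
    (ht : t ∈ Icc 0 p.T) (hst : s ≤ t) (hY : MemLp Y 2 μ) (hYs : AEStronglyMeasurable[m.F s] Y μ) :
    μ[Y | m.F0 t] =ᵐ[μ] μ[Y | m.F0 s] := by
  have ht2 : MemLp (μ[Y | m.F0 t]) 2 μ := hY.condExp (by norm_num)
  have hs2 : MemLp (μ[Y | m.F0 s]) 2 μ := hY.condExp (by norm_num)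
  have hst0 := m.F0.mono hst
  -- Moving conditional expectations across the product, 𝔼[D μ[Y | F⁰_t]] = 𝔼[DY] = 𝔼[Y μ[D | F_s]].
  -- Immersion replaces F_s by F⁰_s, and two more moves give 𝔼[D μ[Y | F⁰_s]]. Hence 𝔼[D²] = 0.
  set D : Ω → ℝ := μ[Y | m.F0 t] - μ[Y | m.F0 s] with hD
  have hD2 : MemLp D 2 μ := ht2.sub hs2
  have hDm : StronglyMeasurable[m.F0 t] D :=
    stronglyMeasurable_condExp.sub (stronglyMeasurable_condExp.mono hst0)
  have hDs2 : MemLp (μ[D | m.F0 s]) 2 μ := hD2.condExp (by norm_num)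
  have e1 := integral_mul_condExp (m.F0.le t) hD2 hDm.aestronglyMeasurable hY
  have e2 := integral_mul_condExp (m.F.le s) hY hYs hD2
  have e3 : ∫ ω, Y ω * (μ[D | m.F s]) ω ∂μ = ∫ ω, Y ω * (μ[D | m.F0 s]) ω ∂μ := by
    refine integral_congr_ae ?_
    filter_upwards [h.condExp_ae_eq hs (hDm.mono (m.F0.mono ht.2)).aestronglyMeasurable
      (hD2.integrable (by norm_num))] with ω hω
    rw [hω]
  have e4 := integral_mul_condExp (m.F0.le s) hDs2 stronglyMeasurable_condExp.aestronglyMeasurable hY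
  have e5 := integral_mul_condExp (m.F0.le s) hs2 stronglyMeasurable_condExp.aestronglyMeasurable hD2
  have comm : ∀ U V : Ω → ℝ, ∫ ω, U ω * V ω ∂μ = ∫ ω, V ω * U ω ∂μ := fun U V => by
    simp_rw [mul_comm]
  have hDD : ∫ ω, D ω ^ 2 ∂μ = 0 := by
    have e : ∀ ω, D ω ^ 2 = D ω * (μ[Y | m.F0 t]) ω - D ω * (μ[Y | m.F0 s]) ω := fun ω => by
      rw [← mul_sub, sq]; rfl
    simp_rw [e]
    have i1 : Integrable (fun ω => D ω * (μ[Y | m.F0 t]) ω) μ := hD2.integrable_mul ht2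
    have i2 : Integrable (fun ω => D ω * (μ[Y | m.F0 s]) ω) μ := hD2.integrable_mul hs2
    rw [integral_sub i1 i2, e1, comm D Y, ← e2, e3,
      comm Y, ← e4, comm _ (μ[Y | m.F0 s]), e5, comm D, sub_self]
  have := (integral_eq_zero_iff_of_nonneg (fun ω => sq_nonneg _) hD2.integrable_sq).1 hDD
  filter_upwards [this] with ω hω
  have h2 : D ω = 0 := by simpa using hω
  rw [hD, Pi.sub_apply] at h2
  linarith

namespace Assumption

theorem condExp_Xcheck (h : m.Assumption p μ) (hI : m.Immersed p μ) (i : ℕ) {s t : ℝ}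
    (hs : s ∈ Icc 0 p.T) (ht : t ∈ Icc 0 p.T) (hst : s ≤ t) :
    μ[m.Xcheck i s | m.F0 t] =ᵐ[μ] 0 := by
  refine (hI.condExp_common hs ht hst ((h.Xcheck_mart i).2 s hs)
    ((h.Xcheck_mart i).stronglyMeasurable hs).aestronglyMeasurable).trans ?_
  refine (condExp_sub ((h.X_mart i).integrable hs) (h.Xbar_mart.integrable hs) _).trans ?_
  filter_upwards [h.condExp_X i s hs, condExp_of_aestronglyMeasurable' (m.F0.le s)
    (h.aesm_Xbar hs le_rfl) (h.Xbar_mart.integrable hs)] with ω h1 h2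
  simp [h1, h2]

theorem condExp_riemannSum_Xcheck (h : m.Assumption p μ) (hI : m.Immersed p μ) (i : ℕ) {t : ℝ}
    (ht : t ∈ Icc 0 p.T) (f : ℝ → ℝ) (n : ℕ) :
    μ[riemannSum f (m.Xcheck i) t n | m.F0 t] =ᵐ[μ] 0 := by
  have hmem : ∀ k : ℕ, k ≤ n → (k : ℝ) * t / n ∈ Icc 0 p.T := fun k hk =>
    ⟨(gridPoint_mem ht.1 hk).1, (gridPoint_mem ht.1 hk).2.trans ht.2⟩
  have e : riemannSum f (m.Xcheck i) t n = ∑ k ∈ Finset.range n, f ((k : ℝ) * t / n)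
      • (m.Xcheck i (((k + 1 : ℕ) : ℝ) * t / n) - m.Xcheck i ((k : ℝ) * t / n)) := by
    funext ω
    rw [riemannSum_eq, Finset.sum_apply]
    rfl
  rw [e]
  have hint : ∀ k ≤ n, Integrable (m.Xcheck i ((k : ℝ) * t / n)) μ := fun k hk =>
    (h.Xcheck_mart i).integrable (hmem k hk)
  have hz : ∀ k ≤ n, μ[m.Xcheck i ((k : ℝ) * t / n) | m.F0 t] =ᵐ[μ] 0 := fun k hk =>
    h.condExp_Xcheck hI i (hmem k hk) ht (gridPoint_mem ht.1 hk).2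
  refine (condExp_finsetSum (fun k hk => ?_) _).trans ?_
  · have hk' := Finset.mem_range.1 hk
    exact ((hint _ hk').sub (hint k hk'.le)).smul _
  · refine (eventuallyEq_sum (g := fun _ => 0) fun k hk => ?_).trans (by simp)
    have hk' := Finset.mem_range.1 hk
    refine (condExp_smul _ _ _).trans ?_
    filter_upwards [condExp_sub (hint _ hk') (hint k hk'.le) (m.F0 t), hz _ hk', hz k hk'.le]
      with ω h1 h2 h3
    rw [Pi.smul_apply, h1, Pi.sub_apply, h2, h3]
    simp

/-- The Riemann sums have zero conditional expectation, since X̌^i has at every grid point up to t;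
the conditional expectation is continuous in L². -/
theorem condExp_stochInt_Xcheck (h : m.Assumption p μ) (hI : m.Immersed p μ) (i : ℕ) {t : ℝ}
    (ht : t ∈ Icc 0 p.T) {f : ℝ → ℝ} {J : Ω → ℝ} (hJ : HasStochInt μ f (m.Xcheck i) t J) :
    μ[J | m.F0 t] =ᵐ[μ] 0 := by
  have h0 : eLpNorm (μ[J | m.F0 t]) 2 μ ≤ 0 := by
    refine ge_of_tendsto' hJ.2 fun n => ?_
    have hsub := HasStochInt.aesm_sub (f := f) (h.Xcheck_mart i) ht hJ.1 n
    have hmem : ∀ k : ℕ, k ≤ n → (k : ℝ) * t / n ∈ Icc 0 p.T := fun k hk =>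
      ⟨(gridPoint_mem ht.1 hk).1, (gridPoint_mem ht.1 hk).2.trans ht.2⟩
    have hR : Integrable (riemannSum f (m.Xcheck i) t n) μ := by
      rw [show riemannSum f (m.Xcheck i) t n = _ from funext (riemannSum_eq _ _ _ _)]
      refine integrable_finsetSum _ fun k hk => ?_
      have hk' := Finset.mem_range.1 hk
      exact (((h.Xcheck_mart i).integrable (hmem _ hk')).sub
        ((h.Xcheck_mart i).integrable (hmem k hk'.le))).const_mul _
    have e : μ[riemannSum f (m.Xcheck i) t n - J | m.F0 t] =ᵐ[μ] -μ[J | m.F0 t] := by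
      filter_upwards [condExp_sub hR (hJ.1.integrable (by norm_num)) (m.F0 t),
        h.condExp_riemannSum_Xcheck hI i ht f n] with ω h1 h2
      rw [h1, Pi.sub_apply, h2]; simp
    rw [← eLpNorm_neg, ← eLpNorm_congr_ae e]
    exact eLpNorm_condExp_le_eLpNorm _ (by norm_num)
  exact (eLpNorm_eq_zero_iff (hJ.1.condExp (by norm_num)).1 (by norm_num)).1
    (le_antisymm h0 bot_le)

/-- The forecast quantity is common, so by immersion conditioning on F_s amounts to conditioning on
F⁰_s. -/
theorem aesm_priceForecast (h : m.Assumption p μ) (hI : m.Immersed p μ) (κ : ℝ) {s t : ℝ}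
    (hs : s ∈ Icc 0 p.T) (hst : s ≤ t) :
    AEStronglyMeasurable[m.F0 t] (m.priceForecast p μ κ s) μ :=
  (stronglyMeasurable_condExp.mono (m.F0.mono hst)).aestronglyMeasurable.congr
    (hI.condExp_ae_eq hs (h.aesm_integratedPrice κ p.T_mem)
      ((h.memLp_integratedPrice κ p.T_mem).integrable (by norm_num))).symm

theorem aesm_Stilde (h : m.Assumption p μ) (hI : m.Immersed p μ) {s t : ℝ}
    (hs : s ∈ Icc 0 p.T) (hst : s ≤ t) :
    AEStronglyMeasurable[m.F0 t] (m.Stilde p μ s) μ := by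
  have h1 := h.aesm_price p.T_mem le_rfl
  have h2 := (h.l2Bound_price p.T).integrable
  rw [frozenPrice_of_mem p.T_mem] at h1 h2
  exact (stronglyMeasurable_condExp.mono (m.F0.mono hst)).aestronglyMeasurable.congr
    (hI.condExp_ae_eq hs h1 h2).symm

theorem aesm_driver (h : m.Assumption p μ) (hI : m.Immersed p μ) (κ θ : ℝ) {s t : ℝ}
    (hs : s ∈ Icc 0 p.T) (hst : s ≤ t) :
    AEStronglyMeasurable[m.F0 t] (m.driver p μ κ θ m.Xbar s) μ :=
  (((h.aesm_priceForecast hI κ hs hst).const_smul θ).add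
    ((h.aesm_Xbar hs hst).const_smul p.lam)).add (h.aesm_Stilde hI hs hst)

theorem aesm_aggregate (h : m.Assumption p μ) (hI : m.Immersed p μ) (κ ε : ℝ) {θ : ℝ} (hθ : 0 ≤ θ)
    {t : ℝ} (ht : t ∈ Icc 0 p.T) :
    AEStronglyMeasurable[m.F0 t] (m.aggregate p μ κ ε θ m.Xbar t) μ := by
  obtain ⟨-, -, hJ, -⟩ := h.exists_isTradingRate h.Xbar_mart κ hθ ε
  have hM := h.isSqMartingale_driver h.Xbar_mart κ θ
  have hmem : ∀ n k : ℕ, k ≤ n → (k : ℝ) * t / n ∈ Icc 0 p.T := fun n k hk =>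
    ⟨(gridPoint_mem ht.1 hk).1, (gridPoint_mem ht.1 hk).2.trans ht.2⟩
  have hS := h.aesm_Stilde hI p.zero_mem ht.1
  have hG : AEStronglyMeasurable[m.F0 t] (m.initialTrade p μ κ) μ :=
    (h.aesm_priceForecast hI κ p.zero_mem ht.1).sub (hS.const_smul _)
  have hA : AEStronglyMeasurable[m.F0 t] (m.Xbar 0
      + ((1 + ε * expKer κ (p.clock t)) * (1 + ε * expKer κ (p.clock p.T))⁻¹)
        • m.initialTrade p μ κ
      - (m.integratedPrice p κ t - expKer κ (p.clock t) • m.Stilde p μ 0)) μ :=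
    ((h.aesm_Xbar p.zero_mem ht.1).add (hG.const_smul _)).sub
      ((h.aesm_integratedPrice κ ht).sub (hS.const_smul _))
  have hB : AEStronglyMeasurable[m.F0 t]
      (stochInt μ (aggregateKernel p κ θ t) (m.driver p μ κ θ m.Xbar) t) μ := by
    refine aeStronglyMeasurable_of_tendsto_L2 (m.F0.le t) (fun n => ?_) (fun n => ?_) (hJ t ht).1
      (hJ t ht).2
    · have e : riemannSum (aggregateKernel p κ θ t) (m.driver p μ κ θ m.Xbar) t n
          = ∑ k ∈ Finset.range n, aggregateKernel p κ θ t ((k : ℝ) * t / n)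
            • (m.driver p μ κ θ m.Xbar (((k + 1 : ℕ) : ℝ) * t / n)
              - m.driver p μ κ θ m.Xbar ((k : ℝ) * t / n)) := by
        funext ω
        rw [riemannSum_eq, Finset.sum_apply]
        rfl
      rw [e]
      refine Finset.sum_induction _ (fun Z => AEStronglyMeasurable[m.F0 t] Z μ)
        (fun _ _ h1 h2 => h1.add h2) aestronglyMeasurable_zero fun k hk => ?_
      have hk' := Finset.mem_range.1 hk
      exact ((h.aesm_driver hI κ θ (hmem n _ hk') (gridPoint_mem ht.1 hk').2).sub
        (h.aesm_driver hI κ θ (hmem n k hk'.le) (gridPoint_mem ht.1 hk'.le).2)).const_smul _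
    · rw [show riemannSum (aggregateKernel p κ θ t) (m.driver p μ κ θ m.Xbar) t n = _ from
        funext (riemannSum_eq _ _ _ _)]
      refine memLp_finsetSum _ fun k hk => ?_
      have hk' := Finset.mem_range.1 hk
      exact ((hM.2 _ (hmem n _ hk')).sub (hM.2 _ (hmem n k hk'.le))).const_mul _
  exact hA.add hB

end Assumption

end Immersion

/-! ### The positions of both games in the common form. -/

section Identification

variable {Ω : Type u} [mΩ : MeasurableSpace Ω] {m : Market Ω} {p : Coefficients} {μ : Measure Ω}
  {N : ℕ} {t : ℝ}

theorem commonMart_eq : m.commonMart p μ = m.driver p μ p.a p.lam m.Xbar := by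
  funext t ω
  simp only [commonMart, driver, Itilde, priceForecast, Pi.add_apply, Pi.smul_apply, smul_eq_mul,
    I_eq p.T_mem]

theorem commonMartN_eq (hN : 1 ≤ N) :
    m.commonMartN p μ N = m.driver p μ (p.a - p.a / N) (p.a / N + p.lam) (m.XbarN N) := by
  funext t ω
  simp only [commonMartN, driver, ItildeN, priceForecast, Pi.add_apply, Pi.smul_apply, smul_eq_mul,
    IN_eq hN p.T_mem]

theorem aggregateMF_eq (ht : t ∈ Icc 0 p.T) :
    m.aggregateMF p μ t = m.aggregate p μ p.a 0 p.lam m.Xbar t := by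
  have hk : stochInt μ (fun s => p.Delta s t / (1 + p.lam * p.Delta s p.T)) (m.commonMart p μ) t
      = stochInt μ (aggregateKernel p p.a p.lam t) (m.driver p μ p.a p.lam m.Xbar) t := by
    rw [commonMart_eq]
    refine stochInt_congr ht.1 fun s hs => ?_
    have hs' : s ∈ Icc 0 p.T := ⟨hs.1, hs.2.trans ht.2⟩
    rw [Coefficients.Delta_eq hs' ht, Coefficients.Delta_eq hs' p.T_mem, aggregateKernel, one_mul,
      div_eq_mul_inv]
  funext ω
  simp only [aggregateMF, hk, aggregate, initialTrade, Itilde, priceForecast, I_eq p.T_mem, I_eq ht,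
    Coefficients.Delta_eq p.zero_mem ht, Coefficients.Delta_eq p.zero_mem p.T_mem,
    Coefficients.clock_zero, sub_zero, zero_mul, add_zero, inv_one, mul_one, one_smul,
    Pi.add_apply, Pi.sub_apply, Pi.smul_apply, smul_eq_mul]
  ring

theorem positionMF_eq (ht : t ∈ Icc 0 p.T) (i : ℕ) :
    m.positionMF p μ i t = m.aggregate p μ p.a 0 p.lam m.Xbar t + m.Xcheck i 0
      + stochInt μ (p.individualKernel 0 p.lam t) (m.Xcheck i) t := by
  have hk : stochInt μ (fun s => p.DeltaTilde s t * p.lam / (1 + p.lam * p.DeltaTilde s p.T))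
      (m.Xcheck i) t = stochInt μ (p.individualKernel 0 p.lam t) (m.Xcheck i) t := by
    refine stochInt_congr ht.1 fun s hs => ?_
    have hs' : s ∈ Icc 0 p.T := ⟨hs.1, hs.2.trans ht.2⟩
    rw [Coefficients.DeltaTilde_eq hs' ht, Coefficients.DeltaTilde_eq hs' p.T_mem,
      Coefficients.individualKernel, div_eq_mul_inv, mul_comm (expKer _ _) p.lam]
  rw [← aggregateMF_eq ht]
  funext ω
  simp only [positionMF, aggregateMF, hk, Xcheck, Pi.add_apply]
  ring

/-- Writing X^i_0 = X̄^N_0 + (X^i - X̄^N)_0 separates a part shared by all agents from a part driven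
by X^i - X̄^N alone, which averages to zero. -/
theorem positionN_eq (hN : 1 ≤ N) (ht : t ∈ Icc 0 p.T) (i : ℕ) :
    m.positionN p μ N i t
      = m.aggregate p μ (p.a - p.a / N) (p.a / N) (p.a / N + p.lam) (m.XbarN N) t
      + (m.X i - m.XbarN N) 0
      + stochInt μ (p.individualKernel (0 - p.a / N) (p.a / N + p.lam) t) (m.X i - m.XbarN N) t := by
  have hk : stochInt μ (fun s => p.DeltaN N s t / (1 + (p.a / N + p.lam) * p.DeltaN N s p.T))
      (m.commonMartN p μ N) t
      = stochInt μ (aggregateKernel p (p.a - p.a / N) (p.a / N + p.lam) t)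
        (m.driver p μ (p.a - p.a / N) (p.a / N + p.lam) (m.XbarN N)) t := by
    rw [commonMartN_eq hN]
    refine stochInt_congr ht.1 fun s hs => ?_
    have hs' : s ∈ Icc 0 p.T := ⟨hs.1, hs.2.trans ht.2⟩
    rw [Coefficients.DeltaN_eq hN hs' ht, Coefficients.DeltaN_eq hN hs' p.T_mem, aggregateKernel,
      one_mul, div_eq_mul_inv]
  have hk' : stochInt μ (fun s => p.DeltaTildeN N s t * p.lam
        / (1 + (p.a / N + p.lam) * p.DeltaTildeN N s p.T)) (fun s ω' => m.X i s ω' - m.XbarN N s ω') t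
      = stochInt μ (p.individualKernel (0 - p.a / N) (p.a / N + p.lam) t) (m.X i - m.XbarN N) t := by
    refine stochInt_congr (M := m.X i - m.XbarN N) ht.1 fun s hs => ?_
    have hs' : s ∈ Icc 0 p.T := ⟨hs.1, hs.2.trans ht.2⟩
    rw [Coefficients.DeltaTildeN_eq hN hs' ht, Coefficients.DeltaTildeN_eq hN hs' p.T_mem,
      Coefficients.individualKernel, div_eq_mul_inv, mul_comm p.lam]
  funext ω
  simp only [positionN, hk, hk', aggregate, initialTrade, ItildeN, priceForecast,
    IN_eq hN p.T_mem, IN_eq hN ht, Coefficients.DeltaN_eq hN p.zero_mem ht,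
    Coefficients.DeltaN_eq hN p.zero_mem p.T_mem, Coefficients.clock_zero, sub_zero, Pi.add_apply,
    Pi.sub_apply, Pi.smul_apply, smul_eq_mul]
  ring

end Identification

end Market

/-! ### Averages over the agents. -/

namespace Market

section Agents

variable {Ω : Type u} [mΩ : MeasurableSpace Ω] {m : Market Ω} {p : Coefficients} {μ : Measure Ω}

theorem IsTradingRate.congr {φ φ' ψ : ℝ → Ω → ℝ} (h : m.IsTradingRate p μ φ ψ)
    (hφ : ∀ t ∈ Icc 0 p.T, φ' t =ᵐ[μ] φ t) : m.IsTradingRate p μ φ' ψ where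
  measurable := h.measurable
  adapted := h.adapted
  sq_integrable := h.sq_integrable
  eq_integral t ht := by
    filter_upwards [hφ t ht, hφ 0 p.zero_mem, h.eq_integral t ht] with ω h1 h2 h3
    rw [h1, h2, h3]

theorem XbarN_eq (N : ℕ) : m.XbarN N = (1 / (N : ℝ)) • ∑ i ∈ Finset.range N, m.X i := by
  funext t ω
  simp [XbarN, Finset.sum_apply]

theorem XbarN_sub_Xbar {N : ℕ} (hN : 1 ≤ N) (t : ℝ) :
    m.XbarN N t - m.Xbar t = (N : ℝ)⁻¹ • fun ω => ∑ i ∈ Finset.range N, m.Xcheck i t ω := by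
  have hN' : (N : ℝ) ≠ 0 := by positivity
  funext ω
  simp only [XbarN, Xcheck, Pi.sub_apply, Pi.smul_apply, smul_eq_mul, Finset.sum_sub_distrib,
    Finset.sum_const, Finset.card_range, nsmul_eq_mul]
  field_simp

theorem sum_sub_XbarN {N : ℕ} (hN : 1 ≤ N) (t : ℝ) (ω : Ω) :
    ∑ i ∈ Finset.range N, (m.X i - m.XbarN N) t ω = 0 := by
  have hN' : (N : ℝ) ≠ 0 := by positivity
  simp only [XbarN, Pi.sub_apply, Finset.sum_sub_distrib, Finset.sum_const, Finset.card_range,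
    nsmul_eq_mul]
  field_simp
  ring

/-- The root mean square of the individual parts of the forecasts. -/
def spread (m : Market Ω) (p : Coefficients) (μ : Measure Ω) : ℝ :=
  √(∫ ω, m.Xcheck 0 p.T ω ^ 2 ∂μ)

theorem spread_nonneg : 0 ≤ m.spread p μ := Real.sqrt_nonneg _

namespace Assumption

theorem isSqMartingale_XbarN (h : m.Assumption p μ) (N : ℕ) :
    IsSqMartingale p.T m.F μ (m.XbarN N) := by
  rw [XbarN_eq]
  exact (IsSqMartingale.sum _ fun i _ => h.X_mart i).smul _

theorem integral_Xcheck_sq (h : m.Assumption p μ) (i : ℕ) :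
    ∫ ω, m.Xcheck i p.T ω ^ 2 ∂μ = m.spread p μ ^ 2 := by
  rw [spread, Real.sq_sqrt (integral_nonneg fun ω => sq_nonneg _), h.Xcheck_var i 0]

theorem l2Bound_Xcheck (h : m.Assumption p μ) (i : ℕ) {t : ℝ} (ht : t ∈ Icc 0 p.T) :
    L2Bound μ (m.Xcheck i t) (m.spread p μ) :=
  (h.Xcheck_mart i).l2Bound (L2Bound.of_integral_sq_le ((h.Xcheck_mart i).2 _ p.T_mem)
    spread_nonneg (h.integral_Xcheck_sq i).le) ht

theorem memLp_sum_Xcheck (h : m.Assumption p μ) (n : ℕ) :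
    MemLp (fun ω => ∑ i ∈ Finset.range n, m.Xcheck i p.T ω) 2 μ :=
  memLp_finsetSum _ fun i _ => (h.Xcheck_mart i).2 _ p.T_mem

/-- Pythagoras: orthogonality removes the cross terms. Dividing by N leaves the norm σ/√N, the
origin of the rate 1/N in the theorem. -/
theorem integral_sum_Xcheck_sq (h : m.Assumption p μ) (n : ℕ) :
    ∫ ω, (∑ i ∈ Finset.range n, m.Xcheck i p.T ω) ^ 2 ∂μ = n * m.spread p μ ^ 2 := by
  induction n with
  | zero => simp
  | succ n ih =>
    have hX := (h.Xcheck_mart n).2 _ p.T_mem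
    have i1 := (h.memLp_sum_Xcheck n).integrable_sq
    have i2 : ∀ i ∈ Finset.range n,
        Integrable (fun ω => m.Xcheck i p.T ω * m.Xcheck n p.T ω) μ := fun i _ =>
      ((h.Xcheck_mart i).2 _ p.T_mem).integrable_mul hX
    have i3 : Integrable (fun ω => m.Xcheck n p.T ω ^ 2) μ := hX.integrable_sq
    have i4 : Integrable (fun ω => 2 * ∑ i ∈ Finset.range n, m.Xcheck i p.T ω * m.Xcheck n p.T ω) μ :=
      (integrable_finsetSum _ i2).const_mul 2
    have e : ∀ ω, (∑ i ∈ Finset.range (n + 1), m.Xcheck i p.T ω) ^ 2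
        = (∑ i ∈ Finset.range n, m.Xcheck i p.T ω) ^ 2
          + 2 * ∑ i ∈ Finset.range n, m.Xcheck i p.T ω * m.Xcheck n p.T ω
          + m.Xcheck n p.T ω ^ 2 := fun ω => by
      rw [Finset.sum_range_succ, ← Finset.sum_mul]; ring
    simp_rw [e]
    have i5 : Integrable (fun ω => (∑ i ∈ Finset.range n, m.Xcheck i p.T ω) ^ 2
        + 2 * ∑ i ∈ Finset.range n, m.Xcheck i p.T ω * m.Xcheck n p.T ω) μ := i1.add i4
    rw [integral_add i5 i3, integral_add i1 i4, integral_const_mul,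
      integral_finsetSum _ i2, Finset.sum_eq_zero fun i hi =>
        h.Xcheck_orth i n (Finset.mem_range.1 hi).ne, ih, h.integral_Xcheck_sq]
    push_cast
    ring

theorem l2Bound_XbarN_sub (h : m.Assumption p μ) {N : ℕ} (hN : 1 ≤ N) {t : ℝ}
    (ht : t ∈ Icc 0 p.T) : L2Bound μ (m.XbarN N t - m.Xbar t) (m.spread p μ / √N) := by
  have hN' : (0 : ℝ) < N := by positivity
  refine IsSqMartingale.l2Bound (M := m.XbarN N - m.Xbar)
    ((h.isSqMartingale_XbarN N).sub h.Xbar_mart) ?_ ht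
  have h1 : L2Bound μ (fun ω => ∑ i ∈ Finset.range N, m.Xcheck i p.T ω) (√N * m.spread p μ) := by
    refine L2Bound.of_integral_sq_le (h.memLp_sum_Xcheck N)
      (mul_nonneg (Real.sqrt_nonneg _) spread_nonneg) ?_
    rw [h.integral_sum_Xcheck_sq, mul_pow, Real.sq_sqrt hN'.le]
  rw [Pi.sub_apply, XbarN_sub_Xbar hN]
  refine (h1.smul _).mono (le_of_eq ?_)
  rw [abs_of_pos (inv_pos.2 hN'), ← mul_assoc, div_eq_mul_inv, mul_comm (m.spread p μ)]
  congr 1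
  rw [inv_mul_eq_div, Real.sqrt_div_self]

theorem perturbation (h : m.Assumption p μ) {N : ℕ} (hN : 1 ≤ N) :
    m.Perturbation p μ (p.a / N) (√(∫ ω, m.Xbar p.T ω ^ 2 ∂μ)) (m.spread p μ / √N) (m.XbarN N) where
  assumption := h
  nonneg := by have := p.a_nonneg; positivity
  le := div_le_self p.a_nonneg (by exact_mod_cast hN)
  mart := h.isSqMartingale_XbarN N
  bound := L2Bound.of_integral_sq_le (h.Xbar_mart.2 _ p.T_mem) (Real.sqrt_nonneg _)
    (Real.sq_sqrt (integral_nonneg fun ω => sq_nonneg _)).ge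
  diff := h.l2Bound_XbarN_sub hN p.T_mem

variable [IsFiniteMeasure μ]

theorem hasStochInt_individualKernel {M : ℝ → Ω → ℝ} (hM : IsSqMartingale p.T m.F μ M) (κ : ℝ)
    {θ t : ℝ} (hθ : 0 ≤ θ) (ht : t ∈ Icc 0 p.T) :
    HasStochInt μ (p.individualKernel κ θ t) M t (stochInt μ (p.individualKernel κ θ t) M t) := by
  obtain ⟨L, -, -, -, hJ⟩ := hM.exists_kernel_process p.T_pos.le
    (Coefficients.continuous_weight (p := p) one_pos)
    (fun u => (Coefficients.weight_pos one_pos u).le) κ p.lam hθ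
  exact HasStochInt.stochInt (hJ t ht)

/-- The individual integrals of the N agents share one kernel and their integrators sum to zero. The
identity is only almost sure because each integral is chosen separately. -/
theorem aggregateN_ae_eq (h : m.Assumption p μ) {N : ℕ} (hN : 1 ≤ N) {t : ℝ} (ht : t ∈ Icc 0 p.T) :
    m.aggregateN p μ N t
      =ᵐ[μ] m.aggregate p μ (p.a - p.a / N) (p.a / N) (p.a / N + p.lam) (m.XbarN N) t := by
  have hN' : (N : ℝ) ≠ 0 := by positivity
  have hθ : 0 ≤ p.a / N + p.lam := add_nonneg (h.perturbation hN).nonneg p.lam_nonneg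
  have hM : ∀ i ∈ Finset.range N, IsSqMartingale p.T m.F μ (m.X i - m.XbarN N) := fun i _ =>
    (h.X_mart i).sub (h.isSqMartingale_XbarN N)
  filter_upwards [HasStochInt.sum_of_forall_riemannSum_eq_zero _ hM ht
    (fun i hi => hasStochInt_individualKernel (hM i hi) (0 - p.a / N) hθ ht)
    (sum_sub_XbarN hN)] with ω hω
  simp only [Finset.sum_apply, Pi.zero_apply] at hω
  have h0 := sum_sub_XbarN (m := m) hN 0 ω
  simp only [aggregateN, positionN_eq hN ht, Pi.add_apply, Finset.sum_add_distrib, hω, h0,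
    Finset.sum_const, Finset.card_range, nsmul_eq_mul]
  field_simp
  ring

end Assumption

end Agents

theorem Assumption.condExp_positionMF {Ω : Type u} [mΩ : MeasurableSpace Ω] {m : Market Ω}
    {p : Coefficients} {μ : Measure Ω} [IsFiniteMeasure μ] (h : m.Assumption p μ)
    (hI : m.Immersed p μ) (i : ℕ) {t : ℝ} (ht : t ∈ Icc 0 p.T) :
    m.aggregateMF p μ t =ᵐ[μ] μ[m.positionMF p μ i t | m.F0 t] := by
  rw [aggregateMF_eq ht, positionMF_eq ht]
  have hJ := Assumption.hasStochInt_individualKernel (h.Xcheck_mart i) 0 p.lam_nonneg ht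
  have hA := h.aesm_aggregate hI p.a 0 p.lam_nonneg ht
  -- The comparison with the game of one player serves only to show that the mean-field aggregate is
  -- integrable.
  obtain ⟨K, hK⟩ := Perturbation.exists_close_aggregate.{u} p
  have hAi : Integrable (m.aggregate p μ p.a 0 p.lam m.Xbar t) μ :=
    (hK Ω μ m _ _ _ _ (h.perturbation le_rfl) t ht).bound.integrable
  have hXi := (h.Xcheck_mart i).integrable p.zero_mem
  have hJi := hJ.memLp.integrable (by norm_num : (1 : ℝ≥0∞) ≤ 2)
  filter_upwards [condExp_add (hAi.add hXi) hJi (m.F0 t), condExp_add hAi hXi (m.F0 t),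
    condExp_of_aestronglyMeasurable' (m.F0.le t) hA hAi, h.condExp_Xcheck hI i p.zero_mem ht ht.1,
    h.condExp_stochInt_Xcheck hI i ht hJ] with ω h1 h2 h3 h4 h5
  rw [h1, Pi.add_apply, h2, Pi.add_apply, h3, h4, h5]
  simp

end Market

/-! ### The final estimate. -/

theorem L2Bound.supSecondMoment_le {Ω : Type u} {mΩ : MeasurableSpace Ω} {μ : Measure Ω} {T K : ℝ}
    {Z Z₀ : ℝ → Ω → ℝ} (h : ∀ t ∈ Icc 0 T, L2Bound μ (Z t - Z₀ t) K) :
    supSecondMoment T μ (Z - Z₀) ≤ ENNReal.ofReal (K ^ 2) :=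
  iSup₂_le fun t ht => (h t ht).secondMoment_le

namespace Market

/-- The common bound, up to constants, for the distance between the two games. -/
def gap {Ω : Type u} [MeasurableSpace Ω] (m : Market Ω) (p : Coefficients) (μ : Measure Ω)
    (N : ℕ) : ℝ :=
  (m.priceBound p μ + √(∫ ω, m.Xbar p.T ω ^ 2 ∂μ)) / N + m.spread p μ / √N

section

variable {Ω : Type u} [MeasurableSpace Ω] {m : Market Ω} {p : Coefficients} {μ : Measure Ω} {N : ℕ}

theorem spread_div_le_gap (hs : 0 ≤ m.priceBound p μ) : m.spread p μ / √N ≤ m.gap p μ N :=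
  le_add_of_nonneg_left (by positivity)

theorem Assumption.gap_nonneg (h : m.Assumption p μ) : 0 ≤ m.gap p μ N := by
  have := (h.l2Bound_price 0).nonneg
  have := m.spread_nonneg (p := p) (μ := μ)
  unfold gap
  positivity

theorem Assumption.error_le_gap (h : m.Assumption p μ) :
    p.a / N * (m.priceBound p μ + √(∫ ω, m.Xbar p.T ω ^ 2 ∂μ)) + m.spread p μ / √N
      ≤ (1 + p.a) * m.gap p μ N := by
  have h1 := (h.l2Bound_price 0).nonneg
  have h2 := m.spread_nonneg (p := p) (μ := μ)
  have ha := p.a_nonneg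
  have h3 : 0 ≤ (m.priceBound p μ + √(∫ ω, m.Xbar p.T ω ^ 2 ∂μ)) / N := by positivity
  have h4 : 0 ≤ p.a * (m.spread p μ / √N) := by positivity
  rw [gap, div_mul_eq_mul_div, mul_div_assoc]
  linarith

/-- The gap is a sum of three terms, and the square of such a sum is at most three times the sum of
the squares. The spread enters with 1/√N, hence with 1/N after squaring. -/
theorem Assumption.ofReal_gap_sq_le (h : m.Assumption p μ) (hN : 1 ≤ N) {C : ℝ} (hC : 0 ≤ C) :
    ENNReal.ofReal (C * m.gap p μ N ^ 2)
      ≤ (Real.toNNReal (3 * C) : ℝ≥0∞) / (N : ℝ≥0∞) ^ 2 * momentOfSup p.T μ m.S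
        + (Real.toNNReal (3 * C) : ℝ≥0∞) / (N : ℝ≥0∞) ^ 2 * secondMoment μ (m.Xbar p.T)
        + (Real.toNNReal (3 * C) : ℝ≥0∞) / (N : ℝ≥0∞) * secondMoment μ (m.Xcheck 0 p.T) := by
  have hN0 : (0 : ℝ) < N := by positivity
  have hx : 0 ≤ ∫ ω, m.Xbar p.T ω ^ 2 ∂μ := integral_nonneg fun ω => sq_nonneg _
  have hc : 0 ≤ ∫ ω, m.Xcheck 0 p.T ω ^ 2 ∂μ := integral_nonneg fun ω => sq_nonneg _
  have e2 : (Real.toNNReal (3 * C) : ℝ≥0∞) / (N : ℝ≥0∞) ^ 2 = ENNReal.ofReal (3 * C / N ^ 2) := by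
    rw [ENNReal.ofReal_div_of_pos (by positivity), ENNReal.ofReal_pow hN0.le, ENNReal.ofReal_natCast]
    rfl
  have e1 : (Real.toNNReal (3 * C) : ℝ≥0∞) / (N : ℝ≥0∞) = ENNReal.ofReal (3 * C / N) := by
    rw [ENNReal.ofReal_div_of_pos hN0, ENNReal.ofReal_natCast]
    rfl
  rw [e1, e2, ← h.ofReal_priceBound_sq, (h.Xbar_mart.2 _ p.T_mem).secondMoment_eq,
    ((h.Xcheck_mart 0).2 _ p.T_mem).secondMoment_eq, ← ENNReal.ofReal_mul (by positivity),
    ← ENNReal.ofReal_mul (by positivity), ← ENNReal.ofReal_mul (by positivity),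
    ← ENNReal.ofReal_add (by positivity) (by positivity),
    ← ENNReal.ofReal_add (by positivity) (by positivity)]
  refine ENNReal.ofReal_le_ofReal ?_
  have key : ∀ u v w : ℝ, (u + v + w) ^ 2 ≤ 3 * (u ^ 2 + v ^ 2 + w ^ 2) := fun u v w => by
    nlinarith [sq_nonneg (u - v), sq_nonneg (u - w), sq_nonneg (v - w)]
  rw [gap, add_div]
  refine (mul_le_mul_of_nonneg_left (key _ _ _) hC).trans (le_of_eq ?_)
  rw [div_pow, div_pow, div_pow, Real.sq_sqrt hx, Real.sq_sqrt hN0.le, spread, Real.sq_sqrt hc]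
  ring

end

/-- All four distances between the two games are bounded by the gap, with a constant that depends
only on the coefficients. -/
theorem exists_l2Bound_sub (p : Coefficients) : ∃ B, ∀ (Ω : Type u) [MeasurableSpace Ω]
    (μ : Measure Ω) [IsFiniteMeasure μ] (m : Market Ω), m.Assumption p μ →
    ∀ N : ℕ, 1 ≤ N → ∀ L L₀ : ℝ → Ω → ℝ,
    (∀ t ∈ Icc 0 p.T, HasStochInt μ (fun s => 1 * Real.exp ((p.a - p.a / N) * p.clock s)
        * (1 + (p.a / N + p.lam) * expKer (p.a - p.a / N) (p.clock p.T - p.clock s))⁻¹)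
      (m.driver p μ (p.a - p.a / N) (p.a / N + p.lam) (m.XbarN N)) t (L t)) →
    (∀ t ∈ Icc 0 p.T, HasStochInt μ (fun s => 1 * Real.exp (p.a * p.clock s)
        * (1 + p.lam * expKer p.a (p.clock p.T - p.clock s))⁻¹)
      (m.driver p μ p.a p.lam m.Xbar) t (L₀ t)) →
    ∀ t ∈ Icc 0 p.T,
      (∀ i, L2Bound μ (m.positionN p μ N i t - m.positionMF p μ i t) (B * m.gap p μ N)) ∧
      L2Bound μ (m.aggregateN p μ N t - m.aggregateMF p μ t) (B * m.gap p μ N) ∧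
      L2Bound μ (m.priceN p μ N t - m.priceMF p μ t) (B * m.gap p μ N) ∧
      L2Bound μ (m.aggregateRate p μ (p.a - p.a / N) (p.a / N) L t
        - m.aggregateRate p μ p.a 0 L₀ t) (B * m.gap p μ N) := by
  obtain ⟨K, hK⟩ := Perturbation.exists_close_aggregate.{u} p
  obtain ⟨K', hK'⟩ := Perturbation.exists_close_aggregateRate.{u} p
  obtain ⟨K₁, hK₁⟩ := p.exists_lip_individualKernel
  have ha := p.a_nonneg
  have hK₁0 : 0 ≤ K₁ := (hK₁ 0 le_rfl ha 0 0 le_rfl le_rfl p.T_pos.le).nonneg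
  -- The summands pay for the aggregate position, the initial error X̄^N_0 - X̄_0, the individual
  -- integral, the price (a times two aggregate errors) and the rate. Absolute values are taken
  -- because the signs of `K` and `K'` are not at hand.
  refine ⟨|K| * (1 + p.a) + 1 + K₁ * (2 + p.a) * (1 + p.a) + 2 * p.a * (|K| * (1 + p.a))
    + |K'| * (1 + p.a), ?_⟩
  intro Ω _ μ _ m h N hN L L₀ hL hL₀
  have hN0 : (0 : ℝ) < N := by positivity
  have hP := h.perturbation hN
  have hε := hP.nonneg
  set B₁ := |K| * (1 + p.a) with hB₁
  set B₂ := K₁ * (2 + p.a) * (1 + p.a) with hB₂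
  set B₃ := 2 * p.a * B₁ with hB₃
  set B₄ := |K'| * (1 + p.a) with hB₄
  have h1 : 0 ≤ B₁ := by positivity
  have h2 : 0 ≤ B₂ := by positivity
  have h3 : 0 ≤ B₃ := by positivity
  have h4 : 0 ≤ B₄ := by positivity
  have hg := h.gap_nonneg (N := N)
  have scale : ∀ k δ b : ℝ, δ ≤ (1 + p.a) * m.gap p μ N → |k| * (1 + p.a) ≤ b → 0 ≤ δ →
      k * δ ≤ b * m.gap p μ N := fun k δ b hδ hb hδ0 =>
    calc k * δ ≤ |k| * ((1 + p.a) * m.gap p μ N) := by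
          gcongr
          exact le_abs_self k
      _ = |k| * (1 + p.a) * m.gap p μ N := by ring
      _ ≤ b * m.gap p μ N := by gcongr
  have hagg : ∀ t ∈ Icc 0 p.T, L2Bound μ
      (m.aggregate p μ (p.a - p.a / N) (p.a / N) (p.a / N + p.lam) (m.XbarN N) t
        - m.aggregate p μ p.a 0 p.lam m.Xbar t) (B₁ * m.gap p μ N) := fun t ht =>
    (hK Ω μ m _ _ _ _ hP t ht).diff.mono (scale _ _ _ h.error_le_gap le_rfl hP.error_nonneg)
  have hagg' : ∀ t ∈ Icc 0 p.T, L2Bound μ (m.aggregateN p μ N t - m.aggregateMF p μ t)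
      (B₁ * m.gap p μ N) := fun t ht => by
    rw [aggregateMF_eq ht]
    exact (hagg t ht).congr ((h.aggregateN_ae_eq hN ht).symm.sub (EventuallyEq.refl _ _))
  have hs : m.spread p μ / √N ≤ m.gap p μ N := spread_div_le_gap (h.l2Bound_price 0).nonneg
  have hs0 : 0 ≤ m.spread p μ / √N := div_nonneg m.spread_nonneg (Real.sqrt_nonneg _)
  intro t ht
  refine ⟨fun i => ?_, (hagg' t ht).mono ?_, ?_, ?_⟩
  · have hM := (h.X_mart i).sub (h.isSqMartingale_XbarN N)
    -- For the individual part the scale is the spread σ alone. The error scale (1 + a)σ/√N covers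
    -- both the forecast error σ/√N and the coefficient error, since εσ = aσ/N ≤ aσ/√N.
    have hpair : LipPair μ (m.spread p μ) ((1 + p.a) * (m.spread p μ / √N)) 1
        ((m.X i - m.XbarN N) t) (m.Xcheck i t) := by
      refine ⟨zero_le_one, (one_mul (m.spread p μ)).symm ▸ h.l2Bound_Xcheck i ht, ?_⟩
      rw [one_mul]
      have e : (m.X i - m.XbarN N) t - m.Xcheck i t = -(m.XbarN N t - m.Xbar t) := by
        funext ω
        simp only [Xcheck, Pi.sub_apply, Pi.neg_apply]
        ring
      rw [e]
      exact (h.l2Bound_XbarN_sub hN ht).neg.mono (le_mul_of_one_le_left hs0 (by linarith))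
    have hεs : p.a / N * m.spread p μ ≤ (1 + p.a) * (m.spread p μ / √N) := by
      have hsq : √(N : ℝ) ≤ N := Real.sqrt_le_iff.2 ⟨hN0.le, by
        have : (1 : ℝ) ≤ N := by exact_mod_cast hN
        nlinarith⟩
      calc p.a / N * m.spread p μ = p.a * (m.spread p μ / N) := by ring
        _ ≤ p.a * (m.spread p μ / √N) := by
          have := m.spread_nonneg (p := p) (μ := μ)
          have := Real.sqrt_pos.2 hN0
          gcongr
        _ ≤ (1 + p.a) * (m.spread p μ / √N) := by linarith
    have hJ := (hpair.stochInt (L := K₁) hM (h.Xcheck_mart i) ht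
      (Assumption.hasStochInt_individualKernel hM (0 - p.a / N)
        (add_nonneg hε p.lam_nonneg) ht)
      (Assumption.hasStochInt_individualKernel (h.Xcheck_mart i) 0 p.lam_nonneg ht)
      (fun s hs => hK₁ _ hε hP.le s t hs.1 hs.2 ht.2) hε hP.le m.spread_nonneg hεs).diff
    have e : m.positionN p μ N i t - m.positionMF p μ i t
        = (m.aggregate p μ (p.a - p.a / N) (p.a / N) (p.a / N + p.lam) (m.XbarN N) t
            - m.aggregate p μ p.a 0 p.lam m.Xbar t) - (m.XbarN N 0 - m.Xbar 0)
          + (stochInt μ (p.individualKernel (0 - p.a / N) (p.a / N + p.lam) t)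
              (m.X i - m.XbarN N) t - stochInt μ (p.individualKernel 0 p.lam t) (m.Xcheck i) t) := by
      rw [positionN_eq hN ht, positionMF_eq ht]
      funext ω
      simp only [Xcheck, Pi.add_apply, Pi.sub_apply]
      ring
    rw [e]
    refine (((hagg t ht).sub (h.l2Bound_XbarN_sub hN p.zero_mem)).add hJ).mono ?_
    have : K₁ * 1 * (2 + p.a) * ((1 + p.a) * (m.spread p μ / √N)) ≤ B₂ * m.gap p μ N := by
      rw [mul_one, ← mul_assoc]
      gcongr
    nlinarith
  · nlinarith
  · have e : m.priceN p μ N t - m.priceMF p μ t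
        = p.a • ((m.aggregateN p μ N t - m.aggregateMF p μ t)
          - (m.aggregateN p μ N 0 - m.aggregateMF p μ 0)) := by
      funext ω
      simp only [priceN, priceMF, Pi.sub_apply, Pi.smul_apply, smul_eq_mul]
      ring
    rw [e]
    refine (((hagg' t ht).sub (hagg' 0 p.zero_mem)).smul_le p.abs_a_le).mono ?_
    have : p.a * (B₁ * m.gap p μ N + B₁ * m.gap p μ N) = B₃ * m.gap p μ N := by
      rw [hB₃]; ring
    rw [this]
    gcongr
    linarith
  · exact (hK' Ω μ m _ _ _ _ hP L L₀ hL hL₀ t ht).diff.mono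
      (scale _ _ _ h.error_le_gap (by linarith) hP.error_nonneg)

end Market

theorem proposition1 (p : Coefficients) :
    ∃ C : ℝ≥0, ∀ (Ω : Type u) [MeasurableSpace Ω] (μ : Measure Ω) [IsProbabilityMeasure μ]
      (m : Market Ω), m.Assumption p μ →
      (m.Immersed p μ → ∀ i : ℕ, ∀ t ∈ Icc 0 p.T,
        m.aggregateMF p μ t =ᵐ[μ] μ[m.positionMF p μ i t | m.F0 t]) ∧
      ∃ (rateN : ℕ → ℝ → Ω → ℝ) (rateMF : ℝ → Ω → ℝ),
        (∀ N : ℕ, 1 ≤ N → m.IsTradingRate p μ (m.aggregateN p μ N) (rateN N)) ∧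
        m.IsTradingRate p μ (m.aggregateMF p μ) rateMF ∧
        ∀ N : ℕ, 1 ≤ N → ∀ i < N,
          supSecondMoment p.T μ (m.positionN p μ N i - m.positionMF p μ i)
            + supSecondMoment p.T μ (m.aggregateN p μ N - m.aggregateMF p μ)
            + supSecondMoment p.T μ (m.priceN p μ N - m.priceMF p μ)
            + supSecondMoment p.T μ (rateN N - rateMF)
          ≤ (C : ℝ≥0∞) / (N : ℝ≥0∞) ^ 2 * momentOfSup p.T μ m.S
            + (C : ℝ≥0∞) / (N : ℝ≥0∞) ^ 2 * secondMoment μ (m.Xbar p.T)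
            + (C : ℝ≥0∞) / (N : ℝ≥0∞) * secondMoment μ (m.Xcheck i p.T) := by
  obtain ⟨B, hB⟩ := Market.exists_l2Bound_sub.{u} p
  -- Each of the four distances is at most B² times the squared gap, and expanding that square costs
  -- the factor 3.
  refine ⟨Real.toNNReal (3 * (4 * B ^ 2)), ?_⟩
  intro Ω _ μ _ m h
  refine ⟨fun hI i t ht => h.condExp_positionMF hI i ht, ?_⟩
  have hε : ∀ N : ℕ, 0 ≤ p.a / N + p.lam := fun N => by
    have := p.a_nonneg
    have := p.lam_nonneg
    positivity
  -- The explicit versions of the rates make the bound valid at every time, not just almost every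
  -- one. The value N = 0 is harmless, as a/0 = 0.
  choose L hL _ hrate using fun N : ℕ => h.exists_isTradingRate (h.isSqMartingale_XbarN N)
    (p.a - p.a / N) (hε N) (p.a / N)
  obtain ⟨L₀, hL₀, -, hrate₀⟩ := h.exists_isTradingRate h.Xbar_mart p.a p.lam_nonneg 0
  refine ⟨fun N => m.aggregateRate p μ (p.a - p.a / N) (p.a / N) (L N),
    m.aggregateRate p μ p.a 0 L₀, fun N hN => (hrate N).congr fun t ht => h.aggregateN_ae_eq hN ht,
    hrate₀.congr fun t ht => (Market.aggregateMF_eq ht).eventuallyEq, fun N hN i _ => ?_⟩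
  have hb := hB Ω μ m h N hN (L N) L₀ (hL N) hL₀
  have hi : secondMoment μ (m.Xcheck i p.T) = secondMoment μ (m.Xcheck 0 p.T) := by
    rw [((h.Xcheck_mart i).2 _ p.T_mem).secondMoment_eq,
      ((h.Xcheck_mart 0).2 _ p.T_mem).secondMoment_eq, h.Xcheck_var i 0]
  rw [hi]
  refine le_trans ?_ (h.ofReal_gap_sq_le hN (by positivity))
  refine (add_le_add (add_le_add (add_le_add
    (L2Bound.supSecondMoment_le fun t ht => (hb t ht).1 i)
    (L2Bound.supSecondMoment_le fun t ht => (hb t ht).2.1))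
    (L2Bound.supSecondMoment_le fun t ht => (hb t ht).2.2.1))
    (L2Bound.supSecondMoment_le fun t ht => (hb t ht).2.2.2)).trans (le_of_eq ?_)
  rw [← ENNReal.ofReal_add (by positivity) (by positivity),
    ← ENNReal.ofReal_add (by positivity) (by positivity),
    ← ENNReal.ofReal_add (by positivity) (by positivity)]
  congr 1
  ring

end
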